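/- Let $n,k$ be integers with $2\le k\le n-2$; all indices are modulo $n$ and everything is over $\mathbb C$. For an $n$-gon $P=(P_i)$ in $\mathbb P^2$ put $T_k(P)_i=P_iP_{i+k}\cap P_{i+1}P_{i+k+1}$, and say that $Q$ is inscribed in $P$ if $Q_i\in P_iP_{i+1}$ for all $i$. Let $\widetilde\Gamma$ be the bipartite graph whose white and black vertices are both indexed by $\mathbb Z^2$, the black vertex $v$ being joined to the white vertices $v,\,v+(1,0),\,v+(0,1),\,v+(1,1)$. The vertex $(a,b)$ carries the index $a+kb \bmod n$, and $\Lambda=\{(a,b): a+kb\equiv 0 \bmod n\}$ acts by translations. The quotient $\Gamma=\widetilde\Gamma/\Lambda$ is a graph on a torus with $\pi_1=H_1=\Lambda$; its black vertex $i$ is joined to the white vertices $i,i+1,i+k,i+k+1$, and its faces are quadrilaterals. Given points $P_i$ at the white vertices (white data), let $\mathcal B=\mathcal B_P$ be the set of $n$-tuples of lines $q=(q_i)$ at the black vertices such that the points at the neighbours of every black vertex, and the lines at the neighbours of every white vertex, form a circuit (they are dependent, every proper subset being independent), and such that every face is coherent: a face with points $A,B$ and lines $c,d$ satisfies $\frac{c(A)\,d(B)}{c(B)\,d(A)}=1$,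 all four pairings being nonzero. Lift the points to vectors $\mathbf A_i$, let $\kappa$ be the nonzero coefficients of the linear relations $\sum_{w\sim v}\kappa(v,w)\mathbf A_w=0$, and for $\alpha\in H^1(T^2,\mathbb C^*)=\mathrm{Hom}(\Lambda,\mathbb C^*)$ let $\mathcal K_\alpha$ be the operator $f\mapsto\big(v\mapsto\sum_{w\sim v}\kappa(v,w)f(w)\big)$ from functions on the white vertices of $\widetilde\Gamma$ with $f(\gamma\cdot w)=\alpha(\gamma)f(w)$ to such functions on the black vertices. The spectral curve is $\mathcal S=\mathcal S_P=\{\alpha:\mathcal K_\alpha\text{ is not an isomorphism}\}$. For $q\in\mathcal B_P$ let $\mathcal F(q)\in H^1(T^2,\mathbb C^*)$ be the cohomology class of the cocycle that assigns to an edge the pairing of lifts of the line and the point at its ends. Let $\mathcal Q_P$ be the set of polygons $Q$ such that $Q$ is inscribed in $P$ and $T_k(Q)$ is inscribed in $T_k(P)$, and which are nondegenerate: the lines $q_i=Q_iQ_{i+k}$ are defined ($Q_i\ne Q_{i+k}$), $q_i$ does not pass through $P_i,P_{i+1},P_{i+k},P_{i+k+1}$, and no three of $q_i,q_{i-1},q_{i-k},q_{i-k-1}$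 are concurrent. There is a dense Zariski open set of $n$-gons $P\in(\mathbb P^2)^n$ for which $P$ is a circuit configuration, $\mathcal F$ is well defined on $\mathcal B_P$, the lines $q_i=Q_iQ_{i+k}$ of every $Q\in\mathcal Q_P$ form an element of $\mathcal B_P$, and the following holds whenever $\mathcal S_P$ is irreducible (in the Zariski topology of the algebraic torus $H^1(T^2,\mathbb C^*)$): 1. $\mathcal S_P$ has dimension one. 2. $\mathcal F$ maps $\mathcal B_P$ to $\mathcal S_P$ and is birational: there is a dense open $U\subset\mathcal S_P$ over which $\mathcal F$ is an isomorphism $\mathcal F^{-1}(U)\to U$ (a regular bijection with regular inverse), and $\mathcal F^{-1}(U)$ is open in $\mathcal B_P$ and is a dense open subset of an irreducible component of $\mathcal B_P$. In particular, a generic point of $\mathcal S_P$ has exactly one preimage, and if $\mathcal B_P$ is irreducible, $\mathcal F$ is a birational map of irreducible varieties. 3. In the same sense, $Q\mapsto\mathcal F\big((Q_iQ_{i+k})_i\big)$ is a birational map from $\mathcal Q_P$ to $\mathcal S_P$. Thus the polygons $Q$ with $Q$ inscribed in $P$ and $T_k(Q)$ inscribed in $T_k(P)$ form a one-dimensional family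 parametrized by the spectral curve. -/

import Mathlib

open scoped LinearAlgebra.Projectivization

noncomputable section

namespace Pentagram

/-! ### Tuples of points and lines of the complex projective plane, with the Zariski topology -/

/-- `n`-tuples (indexed by `ℤ/n`) of points of the projective plane over `ℂ`: an `n`-gon.
A line is represented by the coordinate vector of a covector, up to scale, so the same type
also serves for `n`-tuples of lines. -/
def ProjTuple (n : ℕ) : Type := ZMod n → ℙ ℂ (Fin 3 → ℂ)

/-- `A` is a lift of the tuple `P` to nonzero vectors (or covectors) of `ℂ³`. -/
def IsLift {n : ℕ} (A : ZMod n → Fin 3 → ℂ) (P : ProjTuple n) : Prop :=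
  ∀ i, ∃ h : A i ≠ 0, Projectivization.mk ℂ (A i) h = P i

/-- The value of a polynomial in the `3n` homogeneous coordinates. -/
def evalLift {n : ℕ} (F : MvPolynomial (ZMod n × Fin 3) ℂ) (A : ZMod n → Fin 3 → ℂ) : ℂ :=
  MvPolynomial.eval (fun p => A p.1 p.2) F

/-- The Zariski topology of `(ℙ²)ⁿ`.  The basic open sets are those whose cone of lifts is the
non-vanishing set of one polynomial in the homogeneous coordinates. -/
instance instTopologicalSpaceProjTuple (n : ℕ) : TopologicalSpace (ProjTuple n) :=
  TopologicalSpace.generateFrom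
    {W | ∃ F : MvPolynomial (ZMod n × Fin 3) ℂ, ∀ (P : ProjTuple n) (A : ZMod n → Fin 3 → ℂ),
      IsLift A P → (P ∈ W ↔ evalLift F A ≠ 0)}

/-! ### The bipartite graph of the pentagram map `T_k` on a torus, and its universal cover

White and black vertices of the universal cover are both indexed by `ℤ × ℤ`: the white vertex
`(a, b)` sits at the lattice point `(a, b)`, the black one at `(a + 1/2, b + 1/2)`, and a black
vertex `v` is joined to the four white vertices `v + offset e`.  A vertex `(a, b)` carries the
index `a + k b` modulo `n`, and vertices of one colour with the same index are identified in
the quotient. -/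

/-- The four edges at a black vertex. -/
def offset : Fin 4 → ℤ × ℤ := ![(0, 0), (1, 0), (0, 1), (1, 1)]

/-- The index modulo `n` of a vertex of the universal cover. -/
def idx (n k : ℕ) : ℤ × ℤ →+ ZMod n where
  toFun v := (v.1 : ZMod n) + (k : ZMod n) * (v.2 : ZMod n)
  map_zero' := by simp
  map_add' v w := by
    simp only [Prod.fst_add, Prod.snd_add, Int.cast_add]
    ring

/-- The white vertex of the toric graph at the end of the edge `e` at the black vertex `v`;
thus `v` has the neighbours `v`, `v + 1`, `v + k`, `v + k + 1`. -/
def whiteNbr (n k : ℕ) (v : ZMod n) (e : Fin 4) : ZMod n := v + idx n k (offset e)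

/-- The black vertex of the toric graph at the end of the edge `e` at the white vertex `w`. -/
def blackNbr (n k : ℕ) (w : ZMod n) (e : Fin 4) : ZMod n := w - idx n k (offset e)

/-- The group of deck transformations of the universal cover: the fundamental group, and the
first homology group, of the torus. -/
abbrev deck (n k : ℕ) : AddSubgroup (ℤ × ℤ) := (idx n k).ker

/-! ### Circuit configurations and coherence -/

/-- A circuit in a projective space: a dependent family all of whose proper subfamilies are
independent. -/
def IsCircuit {ι : Type} (f : ι → ℙ ℂ (Fin 3 → ℂ)) : Prop :=
  Projectivization.Dependent f ∧
    ∀ s : Set ι, s ≠ Set.univ → Projectivization.Independent (fun i : s => f i)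

/-- White data: points such that the neighbours of every black vertex form a circuit. -/
def IsWhiteCircuit {n : ℕ} (k : ℕ) (P : ProjTuple n) : Prop :=
  ∀ v : ZMod n, IsCircuit (fun e : Fin 4 => P (whiteNbr n k v e))

/-- Lines such that the neighbours of every white vertex form a circuit. -/
def IsBlackCircuit {n : ℕ} (k : ℕ) (q : ProjTuple n) : Prop :=
  ∀ w : ZMod n, IsCircuit (fun e : Fin 4 => q (blackNbr n k w e))

/-- The multi-ratio `[A, c, B, d]` of two points `A, B` and two lines `c, d`.  With the
convention `x / 0 = 0` it is `1` only if all four pairings are nonzero. -/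
def multiRatio (A c B d : ℙ ℂ (Fin 3 → ℂ)) : ℂ :=
  ((c.rep ⬝ᵥ A.rep) * (d.rep ⬝ᵥ B.rep)) / ((c.rep ⬝ᵥ B.rep) * (d.rep ⬝ᵥ A.rep))

/-- Coherence of all tiles.  The faces of the graph are the quadrilaterals
`q_{i-k}, P_{i+1}, q_i, P_i` and `P_i, q_i, P_{i+k}, q_{i-1}`. -/
def IsCoherent {n : ℕ} (k : ℕ) (P q : ProjTuple n) : Prop :=
  ∀ i : ZMod n,
    multiRatio (P i) (q (i - k)) (P (i + 1)) (q i) = 1 ∧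
    multiRatio (P i) (q i) (P (i + k)) (q (i - 1)) = 1

/-- The space `𝓑` of black data compatible with the white data `P`: together they form a
coherent double circuit configuration. -/
def blackData {n : ℕ} (k : ℕ) (P : ProjTuple n) : Set (ProjTuple n) :=
  {q | IsWhiteCircuit k P ∧ IsBlackCircuit k q ∧ IsCoherent k P q}

/-! ### First cohomology of the torus -/

/-- `H¹(T², ℂˣ)`, the group of homomorphisms from the first homology of the torus to `ℂˣ`. -/
def H1 (n k : ℕ) : Type := AddChar (deck n k) ℂ

/-- The number `α(γ)`. -/
def H1.val {n k : ℕ} (α : H1 n k) (γ : deck n k) : ℂ := (show AddChar (deck n k) ℂ from α) γ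

instance instNonemptyH1 (n k : ℕ) : Nonempty (H1 n k) := ⟨(1 : AddChar (deck n k) ℂ)⟩

/-- A regular function (Laurent polynomial) on the algebraic torus `H¹(T², ℂˣ)`: a finite
linear combination of the characters `α ↦ α(γ)`. -/
def evalH1 {n k : ℕ} (φ : deck n k →₀ ℂ) (α : H1 n k) : ℂ := φ.sum fun γ c => c * α.val γ

/-- The Zariski topology of the algebraic torus `H¹(T², ℂˣ)`. -/
instance instTopologicalSpaceH1 (n k : ℕ) : TopologicalSpace (H1 n k) :=
  TopologicalSpace.generateFrom {W | ∃ φ : deck n k →₀ ℂ, W = {α | evalH1 φ α ≠ 0}}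

/-- Functions `f` on (white, or black) vertices of the universal cover such that
`f(γ · v) = α(γ) f(v)`. -/
def quasiPeriodic {n k : ℕ} (α : H1 n k) : Submodule ℂ (ℤ × ℤ → ℂ) where
  carrier := {f | ∀ (γ : deck n k) (v : ℤ × ℤ), f (γ + v) = α.val γ * f v}
  zero_mem' := by intro γ v; simp
  add_mem' := by
    intro f g hf hg γ v
    simp only [Pi.add_apply, hf γ v, hg γ v, mul_add]
  smul_mem' := by
    intro c f hf γ v
    simp only [Pi.smul_apply, hf γ v, smul_eq_mul]
    ring

/-! ### Kasteleyn operator and spectral curve -/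

/-- The Kasteleyn operator, from functions on white vertices of the universal cover to
functions on black ones; `κ v e` is the weight of the edge `e` at the black vertex `v`. -/
def kasteleyn (n k : ℕ) (κ : ZMod n → Fin 4 → ℂ) : (ℤ × ℤ → ℂ) →ₗ[ℂ] (ℤ × ℤ → ℂ) where
  toFun f v := ∑ e : Fin 4, κ (idx n k v) e * f (v + offset e)
  map_add' f g := by
    funext v
    simp only [Pi.add_apply, mul_add, Finset.sum_add_distrib]
  map_smul' c f := by
    funext v
    simp only [Pi.smul_apply, smul_eq_mul, RingHom.id_apply, Finset.mul_sum]
    exact Finset.sum_congr rfl fun e _ => by ring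

theorem kasteleyn_mem {n k : ℕ} (κ : ZMod n → Fin 4 → ℂ) (α : H1 n k) :
    ∀ f ∈ quasiPeriodic α, kasteleyn n k κ f ∈ quasiPeriodic α := by
  intro f hf γ v
  have hγ : idx n k (γ : ℤ × ℤ) = 0 := γ.2
  change ∑ e : Fin 4, κ (idx n k (γ + v)) e * f (γ + v + offset e)
    = α.val γ * ∑ e : Fin 4, κ (idx n k v) e * f (v + offset e)
  rw [Finset.mul_sum]
  refine Finset.sum_congr rfl fun e _ => ?_
  rw [map_add, hγ, zero_add, add_assoc, hf γ (v + offset e)]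
  ring

/-- The restriction of the Kasteleyn operator to the weight spaces of `α`. -/
def kasteleynOn {n k : ℕ} (κ : ZMod n → Fin 4 → ℂ) (α : H1 n k) :
    quasiPeriodic α →ₗ[ℂ] quasiPeriodic α :=
  (kasteleyn n k κ).restrict (kasteleyn_mem κ α)

/-- `κ` is a system of nonzero Kasteleyn weights of the vectors `A`: the coefficients of a linear
relation between the vectors at the neighbours of each black vertex. -/
def IsKasteleynWeights {n : ℕ} (k : ℕ) (A : ZMod n → Fin 3 → ℂ) (κ : ZMod n → Fin 4 → ℂ) : Prop :=
  (∀ v e, κ v e ≠ 0) ∧ ∀ v, ∑ e : Fin 4, κ v e • A (whiteNbr n k v e) = 0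

/-- The spectral curve of the white data `P`: the classes `α` for which the restricted Kasteleyn
operator is not an isomorphism.  (For a circuit configuration lifts and weights exist, and the
condition on `α` does not depend on their choice.) -/
def spectralCurve (n k : ℕ) (P : ProjTuple n) : Set (H1 n k) :=
  {α | ∃ (A : ZMod n → Fin 3 → ℂ) (κ : ZMod n → Fin 4 → ℂ),
    IsLift A P ∧ IsKasteleynWeights k A κ ∧ ¬ Function.Bijective (kasteleynOn κ α)}

/-! ### The cohomology class of a coherent tiling, and the map `𝓕` -/

/-- `α` is the cohomology class of the tiling `(P, q)`.  The cocycle assigns to an edge the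
pairing of the vector and covector at its ends; it represents `α` if on the universal cover it
is the coboundary of a nowhere zero function that is multiplied by `α(γ)` under `γ`. -/
def IsTilingClass {n k : ℕ} (P q : ProjTuple n) (α : H1 n k) : Prop :=
  ∃ (A l : ZMod n → Fin 3 → ℂ) (fW fB : ℤ × ℤ → ℂ),
    IsLift A P ∧ IsLift l q ∧ (∀ v, fW v ≠ 0) ∧ (∀ v, fB v ≠ 0) ∧
    fW ∈ quasiPeriodic α ∧ fB ∈ quasiPeriodic α ∧
    ∀ (v : ℤ × ℤ) (e : Fin 4),
      l (idx n k v) ⬝ᵥ A (idx n k (v + offset e)) = (fB v)⁻¹ * fW (v + offset e)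

/-- The map `𝓕`, sending black data to the cohomology class of the resulting tiling. -/
def classMap {n : ℕ} (k : ℕ) (P q : ProjTuple n) : H1 n k :=
  Classical.epsilon fun α => IsTilingClass P q α

/-! ### Polygons -/

/-- The lines `q_i = Q_i Q_{i+k}` spanned by the vertices of a polygon. -/
def diagonals {n : ℕ} (k : ℕ) (Q : ProjTuple n) : ProjTuple n :=
  fun i => Projectivization.cross (Q i) (Q (i + k))

/-- The pentagram map: `T_k(P)_i = P_i P_{i+k} ∩ P_{i+1} P_{i+k+1}`. -/
def pentagramMap {n : ℕ} (k : ℕ) (P : ProjTuple n) : ProjTuple n :=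
  fun i => Projectivization.cross (diagonals k P i) (diagonals k P (i + 1))

/-- `Q` is inscribed in `P`: the vertex `Q_i` lies on the side `P_i P_{i+1}`. -/
def Inscribed {n : ℕ} (Q P : ProjTuple n) : Prop :=
  ∀ i : ZMod n, P i ≠ P (i + 1) ∧
    Projectivization.orthogonal (Projectivization.cross (P i) (P (i + 1))) (Q i)

/-- The nondegenerate polygons `Q` such that `Q` is inscribed in `P` and `T_k(Q)` is inscribed in
`T_k(P)`.  Nondegeneracy means that the lines `q_i = Q_i Q_{i+k}` are defined, do not pass through
the vertices of `P` adjacent to them in the graph, and that no three of the lines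
`q_i, q_{i-1}, q_{i-k}, q_{i-k-1}` are concurrent (in particular, `T_k(Q)` is defined). -/
def inscribedFamily {n : ℕ} (k : ℕ) (P : ProjTuple n) : Set (ProjTuple n) :=
  {Q | (∀ i, Q i ≠ Q (i + k)) ∧
    (∀ v e, ¬ Projectivization.orthogonal (diagonals k Q v) (P (whiteNbr n k v e))) ∧
    IsBlackCircuit k (diagonals k Q) ∧
    Inscribed Q P ∧ Inscribed (pentagramMap k Q) (pentagramMap k P)}

/-! ### Regular maps and birationality -/

/-- `F` is regular on `V`: every coordinate `α(γ)` of `α = F(q)` is, locally for the Zariski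
topology, a quotient of polynomials in homogeneous coordinates of `q`. -/
def RegularToH1 {n k : ℕ} (F : ProjTuple n → H1 n k) (V : Set (ProjTuple n)) : Prop :=
  ∀ γ : deck n k, ∀ q₀ ∈ V, ∃ N D : MvPolynomial (ZMod n × Fin 3) ℂ,
    (∀ l, IsLift l q₀ → evalLift D l ≠ 0) ∧
    ∀ q ∈ V, ∀ l, IsLift l q → evalLift D l ≠ 0 →
      (F q).val γ = evalLift N l / evalLift D l

/-- `G` is regular on `U`: every component of `G(α)` is, locally for the Zariski topology, given
by three Laurent polynomials without common zeros. -/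
def RegularToProj {n k : ℕ} (G : H1 n k → ProjTuple n) (U : Set (H1 n k)) : Prop :=
  ∀ i : ZMod n, ∀ α₀ ∈ U, ∃ φ : Fin 3 → (deck n k →₀ ℂ),
    (fun j => evalH1 (φ j) α₀) ≠ 0 ∧
    ∀ α ∈ U, ∀ h : (fun j => evalH1 (φ j) α) ≠ 0,
      G α i = Projectivization.mk ℂ (fun j => evalH1 (φ j) α) h

/-- `Y'` is a dense open subset of `Y`. -/
def IsDenseOpenIn {X : Type} [TopologicalSpace X] (Y' Y : Set X) : Prop :=
  Y ⊆ closure Y' ∧ ∃ O : Set X, IsOpen O ∧ Y' = Y ∩ O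

/-- `Z` is an irreducible component of the subspace `Y`. -/
def IsIrredComponent {X : Type} [TopologicalSpace X] (Z Y : Set X) : Prop :=
  Maximal (fun Z' => Z' ⊆ Y ∧ IsIrreducible Z') Z

/-- `F` is a birational map from `X` to `S`: it maps `X` to `S`, and over a dense open subset `U`
of `S` it is an isomorphism from the full preimage `V` of `U`, where `V` is a dense open subset of
an irreducible component of `X` and open in `X`. -/
def IsBirationalOnto {n k : ℕ} (X : Set (ProjTuple n)) (S : Set (H1 n k))
    (F : ProjTuple n → H1 n k) : Prop :=
  Set.MapsTo F X S ∧
  ∃ (X₀ V : Set (ProjTuple n)) (U : Set (H1 n k)) (G : H1 n k → ProjTuple n),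
    IsDenseOpenIn U S ∧ V = X ∩ F ⁻¹' U ∧
    IsIrredComponent X₀ X ∧ IsDenseOpenIn V X₀ ∧ (∃ O, IsOpen O ∧ V = X ∩ O) ∧
    RegularToH1 F V ∧ RegularToProj G U ∧
    Set.MapsTo G U V ∧ (∀ q ∈ V, G (F q) = q) ∧ (∀ α ∈ U, F (G α) = α)

end Pentagram

end

noncomputable section

namespace Pentagram

/-! ### Coordinates on the algebraic torus `H¹(T², ℂˣ)` -/

section Coordinates

variable {n k : ℕ}

/-! Coherence of the faces says that the pairings of lines and points form a closed cocycle, so on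
`ℤ × ℤ` they factor as `fB⁻¹ * fW`, where both potentials are multiplied by one character α of Λ;
this α is 𝓕(q) (`IsCoherent.exists_isTilingClass`). Pairing a line with the relation among the
points around its black vertex shows that `fW` is a nowhere zero solution of the Kasteleyn equation,
so α lies on the spectral curve. Conversely, a solution `f` prescribes the values of a covector on
the four points around each black vertex: three values determine the covector, and the Kasteleyn
equation makes the fourth consistent (`lineAt_dot`). Hence 𝓕 can be inverted wherever the kernel is
one-dimensional and the resulting lines are in general position; the work lies in proving this at a
generic point of the curve.

In the coordinates z = α(n, 0), w = α(-k, 1) a quasi-periodic function is given by n values, and the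
Kasteleyn operator becomes an n × n matrix over ℂ[z, w] with determinant Δ = `kdet`. On the boundary
line w = 0 the equation degenerates to a two-term recursion: Δ restricts to a linear polynomial in
z, and at its root there is an explicit kernel vector without zero entries, `boundarySolution`. A
curve irreducible as a set could have a reducible or non-reduced equation, but the irreducible
restriction to w = 0 rules this out (`irreducible_kdet`). By the Nullstellensatz Δ then generates
the ideal of the curve, and the dimension follows.

Genericity of the kernel is linear algebra over ℂ[z, w]. A functional that vanishes on all columns
of the adjugate along the curve is a combination of the rows of the matrix (`exists_vecMul_of_dvd`),
hence vanishes on the boundary solution. A zero of `f`, or a coincidence of adjacent lines, makes a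
functional vanish whose boundary value is visibly nonzero. One more condition, that a line avoids
the intersection of P_iP_{i+1} and P_{i+k}P_{i+k+1}, is settled instead by degrees in w
(`exists_eq_zero_of_const_eq_vecMul`).

Polygons and lines correspond by q_i = Q_iQ_{i+k} and Q_i = q_{i-k} ∩ q_i. By Lagrange's identity
the two kinds of faces are coherent exactly when Q_i lies on P_iP_{i+1} and q_{i-1} ∩ q_i lies on
P_iP_{i+k}, the line carrying a side of T_k(P) (`isCoherent_iff`). The extra condition makes
q_{i-k}, q_i, q_{i+k} non-concurrent, so that the polygon built from the lines is nondegenerate. -/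

theorem mem_deck_iff {v : ℤ × ℤ} : v ∈ deck n k ↔ (n : ℤ) ∣ v.1 + k * v.2 := by
  rw [AddMonoidHom.mem_ker, ← ZMod.intCast_zmod_eq_zero_iff_dvd]
  simp [idx]

/-- The deck transformation `(n, 0)`. -/
def horizontalPeriod (n k : ℕ) : deck n k := ⟨((n : ℤ), 0), mem_deck_iff.2 (by simp)⟩

/-- The deck transformation `(-k, 1)`. -/
def shearPeriod (n k : ℕ) : deck n k := ⟨(-(k : ℤ), 1), mem_deck_iff.2 (by simp)⟩

theorem H1.val_add (α : H1 n k) (γ δ : deck n k) : α.val (γ + δ) = α.val γ * α.val δ :=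
  AddChar.map_add_eq_mul _ _ _

theorem H1.val_zero (α : H1 n k) : α.val 0 = 1 := AddChar.map_zero_eq_one _

theorem H1.val_ne_zero (α : H1 n k) (γ : deck n k) : α.val γ ≠ 0 := by
  intro h
  have := α.val_add γ (-γ)
  rw [add_neg_cancel, H1.val_zero, h, zero_mul] at this
  exact one_ne_zero this

theorem H1.val_zsmul (α : H1 n k) (m : ℤ) (γ : deck n k) : α.val (m • γ) = α.val γ ^ m :=
  AddChar.map_zsmul_eq_zpow _ _ _

theorem H1.ext {α β : H1 n k} (h : ∀ γ, α.val γ = β.val γ) : α = β :=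
  DFunLike.ext (F := AddChar (deck n k) ℂ) α β h

/-- The coordinate `z = α(n, 0)`. -/
def H1.z (α : H1 n k) : ℂ := α.val (horizontalPeriod n k)

/-- The coordinate `w = α(-k, 1)`. -/
def H1.w (α : H1 n k) : ℂ := α.val (shearPeriod n k)

theorem H1.z_ne_zero (α : H1 n k) : α.z ≠ 0 := α.val_ne_zero _

theorem H1.w_ne_zero (α : H1 n k) : α.w ≠ 0 := α.val_ne_zero _

/-- The exponent of `z` in the character of a deck transformation. -/
def level (n k : ℕ) (v : ℤ × ℤ) : ℤ := (v.1 + k * v.2) / n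

theorem level_mul {v : ℤ × ℤ} (hv : v ∈ deck n k) : level n k v * n = v.1 + k * v.2 :=
  Int.ediv_mul_cancel (mem_deck_iff.1 hv)

theorem level_add {v w : ℤ × ℤ} (hv : v ∈ deck n k) :
    level n k (v + w) = level n k v + level n k w := by
  unfold level
  rw [← Int.add_ediv_of_dvd_left (mem_deck_iff.1 hv)]
  congr 1
  simp only [Prod.fst_add, Prod.snd_add]
  ring

theorem H1.val_eq (α : H1 n k) (γ : deck n k) :
    α.val γ = α.z ^ level n k γ * α.w ^ (γ : ℤ × ℤ).2 := by
  have h : γ = level n k γ • horizontalPeriod n k + (γ : ℤ × ℤ).2 • shearPeriod n k := by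
    have := level_mul γ.2
    ext
    · simp only [AddSubgroup.coe_add, AddSubgroup.coe_zsmul, horizontalPeriod, shearPeriod,
        Prod.fst_add, Prod.smul_fst, smul_eq_mul]
      linarith
    · simp [horizontalPeriod, shearPeriod]
  conv_lhs => rw [h]
  rw [H1.val_add, H1.val_zsmul, H1.val_zsmul]
  rfl

theorem H1.ext_coord {α β : H1 n k} (hz : α.z = β.z) (hw : α.w = β.w) : α = β :=
  H1.ext fun γ => by rw [α.val_eq, β.val_eq, hz, hw]

/-- The class with given coordinates. -/
def H1.ofCoord (n k : ℕ) (z w : ℂ) (hz : z ≠ 0) (hw : w ≠ 0) : H1 n k :=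
  show AddChar (deck n k) ℂ from
  { toFun := fun γ => z ^ level n k γ * w ^ (γ : ℤ × ℤ).2
    map_zero_eq_one' := by simp [level]
    map_add_eq_mul' := fun γ δ => by
      rw [AddSubgroup.coe_add, level_add γ.2, zpow_add₀ hz, Prod.snd_add, zpow_add₀ hw]
      ring }

theorem H1.ofCoord_val {z w : ℂ} (hz : z ≠ 0) (hw : w ≠ 0) (γ : deck n k) :
    (H1.ofCoord n k z w hz hw).val γ = z ^ level n k γ * w ^ (γ : ℤ × ℤ).2 := rfl

theorem H1.ofCoord_z [NeZero n] {z w : ℂ} (hz : z ≠ 0) (hw : w ≠ 0) :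
    (H1.ofCoord n k z w hz hw).z = z := by
  rw [H1.z, H1.ofCoord_val]
  simp [horizontalPeriod, level, NeZero.ne n]

theorem H1.ofCoord_w {z w : ℂ} (hz : z ≠ 0) (hw : w ≠ 0) :
    (H1.ofCoord n k z w hz hw).w = w := by
  rw [H1.w, H1.ofCoord_val]
  simp [shearPeriod, level]

/-- The pair of coordinates. -/
def H1.coord (α : H1 n k) : Fin 2 → ℂ := ![α.z, α.w]

/-- The polynomial ring in the coordinates `z, w`. -/
abbrev Poly : Type := MvPolynomial (Fin 2) ℂ

/-- The value of a polynomial in the coordinates `z, w`. -/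
def H1.eval (α : H1 n k) : Poly →+* ℂ := MvPolynomial.eval α.coord

@[simp] theorem H1.eval_X_zero (α : H1 n k) : α.eval (MvPolynomial.X 0) = α.z := by
  simp [H1.eval, H1.coord]

@[simp] theorem H1.eval_X_one (α : H1 n k) : α.eval (MvPolynomial.X 1) = α.w := by
  simp [H1.eval, H1.coord]

@[simp] theorem H1.eval_C (α : H1 n k) (c : ℂ) : α.eval (MvPolynomial.C c) = c := by
  simp [H1.eval]

theorem evalH1_add (φ ψ : deck n k →₀ ℂ) (α : H1 n k) :
    evalH1 (φ + ψ) α = evalH1 φ α + evalH1 ψ α :=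
  Finsupp.sum_add_index' (fun _ => zero_mul _) fun _ _ _ => add_mul _ _ _

theorem evalH1_single (γ : deck n k) (c : ℂ) (α : H1 n k) :
    evalH1 (Finsupp.single γ c) α = c * α.val γ :=
  Finsupp.sum_single_index (zero_mul _)

theorem exists_evalH1_mul_val (φ : deck n k →₀ ℂ) (γ : deck n k) :
    ∃ ψ : deck n k →₀ ℂ, ∀ α, evalH1 ψ α = evalH1 φ α * α.val γ := by
  refine ⟨φ.mapDomain (· + γ), fun α => ?_⟩
  unfold evalH1
  rw [Finsupp.sum_mapDomain_index (fun _ => zero_mul _) (fun _ _ _ => add_mul _ _ _),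
    Finsupp.sum_mul]
  exact Finsupp.sum_congr fun δ _ => by rw [H1.val_add, mul_assoc]

/-- Polynomials in the coordinates are regular functions on `H¹(T², ℂˣ)`. -/
theorem exists_evalH1_eq (n k : ℕ) (p : Poly) :
    ∃ φ : deck n k →₀ ℂ, ∀ α, evalH1 φ α = α.eval p := by
  induction p using MvPolynomial.induction_on with
  | C a => exact ⟨Finsupp.single 0 a, fun α => by rw [evalH1_single, H1.val_zero]; simp⟩
  | add p q hp hq =>
    obtain ⟨φ, hφ⟩ := hp
    obtain ⟨ψ, hψ⟩ := hq
    exact ⟨φ + ψ, fun α => by rw [evalH1_add, hφ, hψ, map_add]⟩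
  | mul_X p i hp =>
    obtain ⟨φ, hφ⟩ := hp
    obtain ⟨ψ, hψ⟩ := exists_evalH1_mul_val φ (![horizontalPeriod n k, shearPeriod n k] i)
    refine ⟨ψ, fun α => ?_⟩
    rw [hψ, hφ, map_mul]
    fin_cases i
    · simp [H1.z]
    · simp [H1.w]

/-- Up to a monomial factor, regular functions on `H¹(T², ℂˣ)` are polynomials in the
coordinates. -/
theorem exists_eval_eq (φ : deck n k →₀ ℂ) :
    ∃ N : ℕ, ∀ M, N ≤ M → ∃ p : Poly, ∀ α : H1 n k,
      α.eval p = evalH1 φ α * (α.z * α.w) ^ M := by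
  induction φ using Finsupp.induction_linear with
  | zero => exact ⟨0, fun M _ => ⟨0, fun α => by simp [evalH1]⟩⟩
  | add φ ψ hφ hψ =>
    obtain ⟨N, hN⟩ := hφ
    obtain ⟨N', hN'⟩ := hψ
    -- Allowing every exponent above a bound lets both summands be cleared by the same monomial.
    refine ⟨max N N', fun M hM => ?_⟩
    obtain ⟨p, hp⟩ := hN M (le_trans (le_max_left _ _) hM)
    obtain ⟨q, hq⟩ := hN' M (le_trans (le_max_right _ _) hM)
    exact ⟨p + q, fun α => by rw [map_add, hp, hq, evalH1_add, add_mul]⟩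
  | single γ c =>
    -- With this bound both exponents become nonnegative after the shift by `M`.
    refine ⟨(level n k γ).natAbs + (γ : ℤ × ℤ).2.natAbs, fun M hM => ?_⟩
    obtain ⟨i, hi⟩ : ∃ i : ℕ, (i : ℤ) = M + level n k γ := ⟨(M + level n k γ).toNat, by omega⟩
    obtain ⟨j, hj⟩ : ∃ j : ℕ, (j : ℤ) = M + (γ : ℤ × ℤ).2 :=
      ⟨(M + (γ : ℤ × ℤ).2).toNat, by omega⟩
    refine ⟨MvPolynomial.C c * MvPolynomial.X 0 ^ i * MvPolynomial.X 1 ^ j, fun α => ?_⟩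
    simp only [map_mul, map_pow, H1.eval_C, H1.eval_X_zero, H1.eval_X_one]
    rw [evalH1_single, α.val_eq, mul_pow, ← zpow_natCast α.z i, ← zpow_natCast α.w j, hi, hj,
      zpow_add₀ α.z_ne_zero, zpow_add₀ α.w_ne_zero, zpow_natCast, zpow_natCast]
    ring

/-- The basic open set where a polynomial does not vanish. -/
def basicOpen (n k : ℕ) (p : Poly) : Set (H1 n k) := {α | α.eval p ≠ 0}

theorem isOpen_basicOpen (p : Poly) : IsOpen (basicOpen n k p) := by
  obtain ⟨φ, hφ⟩ := exists_evalH1_eq n k p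
  refine TopologicalSpace.isOpen_generateFrom_of_mem ⟨φ, ?_⟩
  ext α
  simp only [basicOpen, Set.mem_ofPred_eq, hφ]

theorem exists_basicOpen_eq (φ : deck n k →₀ ℂ) :
    ∃ p : Poly, {α | evalH1 φ α ≠ 0} = basicOpen n k p := by
  obtain ⟨N, hN⟩ := exists_eval_eq φ
  obtain ⟨p, hp⟩ := hN N le_rfl
  refine ⟨p, ?_⟩
  ext α
  simp only [basicOpen, Set.mem_ofPred_eq, hp]
  simp [α.z_ne_zero, α.w_ne_zero]

/-- The unit `z * w` clears the denominators of a Laurent polynomial, and multiplying polynomials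
intersects basic open sets. -/
theorem isTopologicalBasis_basicOpen (n k : ℕ) :
    TopologicalSpace.IsTopologicalBasis (Set.range (basicOpen n k)) := by
  have h : (instTopologicalSpaceH1 n k) =
      TopologicalSpace.generateFrom (Set.range (basicOpen n k)) := by
    refine le_antisymm (le_generateFrom ?_) (le_generateFrom ?_)
    · rintro _ ⟨p, rfl⟩
      exact isOpen_basicOpen p
    · rintro _ ⟨φ, rfl⟩
      obtain ⟨p, hp⟩ := exists_basicOpen_eq φ
      rw [hp]
      exact TopologicalSpace.isOpen_generateFrom_of_mem ⟨p, rfl⟩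
  have h' := TopologicalSpace.isTopologicalBasis_of_subbasis_of_inter h (by
    rintro _ ⟨p, rfl⟩ _ ⟨q, rfl⟩
    exact ⟨p * q, by ext α; simp [basicOpen]⟩)
  rwa [Set.insert_eq_of_mem] at h'
  exact ⟨1, by ext α; simp [basicOpen]⟩

/-- A point outside a closed set is separated from it by a polynomial. -/
theorem exists_eval_ne_zero_of_notMem {Z : Set (H1 n k)} (hZ : IsClosed Z) {α : H1 n k}
    (hα : α ∉ Z) : ∃ p : Poly, α.eval p ≠ 0 ∧ ∀ β ∈ Z, β.eval p = 0 := by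
  obtain ⟨_, ⟨p, rfl⟩, hp, hpZ⟩ :=
    (isTopologicalBasis_basicOpen n k).exists_subset_of_mem_open (u := Zᶜ) hα hZ.isOpen_compl
  exact ⟨p, hp, fun β hβ => by_contra fun h => hpZ h hβ⟩

/-- The ideal of polynomials vanishing on a set. -/
def idealOf (Z : Set (H1 n k)) : Ideal Poly where
  carrier := {p | ∀ α ∈ Z, α.eval p = 0}
  zero_mem' _ _ := map_zero _
  add_mem' hp hq α hα := by rw [map_add, hp α hα, hq α hα, add_zero]
  smul_mem' p q hq α hα := by rw [smul_eq_mul, map_mul, hq α hα, mul_zero]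

theorem mem_idealOf {Z : Set (H1 n k)} {p : Poly} : p ∈ idealOf Z ↔ ∀ α ∈ Z, α.eval p = 0 :=
  Iff.rfl

theorem idealOf_isPrime {Z : Set (H1 n k)} (hZ : IsIrreducible Z) : (idealOf Z).IsPrime := by
  refine Ideal.isPrime_iff.2 ⟨fun h => ?_, fun {p q} hpq => ?_⟩
  · obtain ⟨α, hα⟩ := hZ.1
    have : (1 : Poly) ∈ idealOf Z := h ▸ Submodule.mem_top
    exact one_ne_zero ((map_one α.eval).symm.trans (this α hα))
  · by_contra hcon
    simp only [mem_idealOf, not_or, not_forall] at hcon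
    obtain ⟨⟨α, hα, hp⟩, β, hβ, hq⟩ := hcon
    obtain ⟨γ, hγ, hγp, hγq⟩ := hZ.2 _ _ (isOpen_basicOpen p) (isOpen_basicOpen q)
      ⟨α, hα, hp⟩ ⟨β, hβ, hq⟩
    have := hpq γ hγ
    rw [map_mul] at this
    exact (mul_ne_zero hγp hγq) this

/-- The inclusion is strict because a closed set is recovered from the polynomials vanishing on it.
-/
theorem idealOf_lt {Z Y : Set (H1 n k)} (hZ : IsClosed Z) (h : Z ⊂ Y) :
    idealOf Y < idealOf Z := by
  refine lt_of_le_of_ne (fun p hp α hα => hp α (h.1 hα)) fun heq => h.2 fun α hα => ?_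
  by_contra hαZ
  obtain ⟨p, hp, hpZ⟩ := exists_eval_ne_zero_of_notMem hZ hαZ
  have : p ∈ idealOf Y := heq ▸ hpZ
  exact hp (this α hα)

theorem isClosed_singleton (α : H1 n k) : IsClosed ({α} : Set (H1 n k)) := by
  have : ({α} : Set (H1 n k)) =
      (basicOpen n k (MvPolynomial.X 0 - MvPolynomial.C α.z))ᶜ ∩
        (basicOpen n k (MvPolynomial.X 1 - MvPolynomial.C α.w))ᶜ := by
    ext β
    simp only [basicOpen, Set.mem_singleton_iff, Set.mem_inter_iff, Set.mem_compl_iff,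
      Set.mem_ofPred_eq, not_not, map_sub, H1.eval_X_zero, H1.eval_X_one, H1.eval_C, sub_eq_zero]
    exact ⟨fun h => h ▸ ⟨rfl, rfl⟩, fun h => H1.ext_coord h.1 h.2⟩
  rw [this]
  exact (isOpen_basicOpen _).isClosed_compl.inter (isOpen_basicOpen _).isClosed_compl

end Coordinates

/-! ### Linear algebra of the projective plane -/

section Plane

open Matrix

/-- The triple product of vectors of `ℂ³`. -/
def triple (u v w : Fin 3 → ℂ) : ℂ := u ⬝ᵥ crossProduct v w

theorem triple_eq (u v w : Fin 3 → ℂ) : triple u v w =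
    u 0 * (v 1 * w 2 - v 2 * w 1) + u 1 * (v 2 * w 0 - v 0 * w 2)
      + u 2 * (v 0 * w 1 - v 1 * w 0) := by
  simp [triple, cross_apply, dotProduct, Fin.sum_univ_three]

theorem dot_eq (u v : Fin 3 → ℂ) : u ⬝ᵥ v = u 0 * v 0 + u 1 * v 1 + u 2 * v 2 := by
  simp [dotProduct, Fin.sum_univ_three]

theorem cross_zero (u v : Fin 3 → ℂ) : crossProduct u v 0 = u 1 * v 2 - u 2 * v 1 := by
  simp [cross_apply]

theorem cross_one (u v : Fin 3 → ℂ) : crossProduct u v 1 = u 2 * v 0 - u 0 * v 2 := by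
  simp [cross_apply]

theorem cross_two (u v : Fin 3 → ℂ) : crossProduct u v 2 = u 0 * v 1 - u 1 * v 0 := by
  simp [cross_apply]

theorem triple_rotate (u v w : Fin 3 → ℂ) : triple v w u = triple u v w := by
  simp only [triple_eq]; ring

theorem triple_swap (u v w : Fin 3 → ℂ) : triple v u w = -triple u v w := by
  simp only [triple_eq]; ring

theorem linearIndependent_of_triple_ne_zero {u v w : Fin 3 → ℂ} (h : triple u v w ≠ 0) :
    LinearIndependent ℂ ![u, v, w] := by
  have := Matrix.linearIndependent_rows_of_det_ne_zero (A := Matrix.of ![u, v, w])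
    (by rwa [triple, triple_product_eq_det] at h)
  exact this

/-- The linear relation between four vectors of `ℂ³`. -/
theorem four_term_relation (a b c d : Fin 3 → ℂ) :
    triple b c d • a - triple a c d • b + triple a b d • c - triple a b c • d = 0 := by
  ext i
  fin_cases i <;> simp [triple_eq] <;> ring

/-- Cramer's rule without division: up to the factor `triple a b c`, the three cross products form
the dual basis of `a, b, c`. -/
theorem smul_eq_interpolation (l a b c : Fin 3 → ℂ) :
    triple a b c • l = (l ⬝ᵥ a) • crossProduct b c + (l ⬝ᵥ b) • crossProduct c a
      + (l ⬝ᵥ c) • crossProduct a b := by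
  ext i
  fin_cases i <;>
    simp [triple_eq, dot_eq, cross_apply] <;> ring

theorem covector_ext {a b c l m : Fin 3 → ℂ} (h : triple a b c ≠ 0) (ha : l ⬝ᵥ a = m ⬝ᵥ a)
    (hb : l ⬝ᵥ b = m ⬝ᵥ b) (hc : l ⬝ᵥ c = m ⬝ᵥ c) : l = m :=
  smul_right_injective _ h (by
    change triple a b c • l = triple a b c • m
    rw [smul_eq_interpolation l, smul_eq_interpolation m, ha, hb, hc])

theorem cross_ne_zero_of_triple {u v w : Fin 3 → ℂ} (h : triple u v w ≠ 0) :
    crossProduct v w ≠ 0 := fun h0 => h (by rw [triple, h0, dotProduct_zero])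

/-- A covector vanishing on two independent vectors is proportional to their cross product. -/
theorem exists_smul_cross {u v l : Fin 3 → ℂ} (h : crossProduct u v ≠ 0) (hu : l ⬝ᵥ u = 0)
    (hv : l ⬝ᵥ v = 0) : ∃ s : ℂ, l = s • crossProduct u v := by
  obtain ⟨w, hw⟩ : ∃ w : Fin 3 → ℂ, triple w u v ≠ 0 := by
    by_contra hcon
    push Not at hcon
    exact h (dotProduct_eq_zero _ fun w => by rw [dotProduct_comm]; exact hcon w)
  refine ⟨(triple w u v)⁻¹ * (l ⬝ᵥ w), ?_⟩
  have := smul_eq_interpolation l w u v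
  rw [hu, hv, zero_smul, zero_smul, add_zero, add_zero] at this
  rw [mul_smul, ← this, inv_smul_smul₀ hw]

theorem cross_cross_self (u v x : Fin 3 → ℂ) :
    crossProduct (crossProduct u v) (crossProduct u x) = triple u v x • u := by
  ext i
  fin_cases i <;> simp [triple_eq, cross_apply] <;> ring

theorem cross_smul_smul (a b : ℂ) (u v : Fin 3 → ℂ) :
    crossProduct (a • u) (b • v) = (a * b) • crossProduct u v := by
  rw [map_smul, map_smul, LinearMap.smul_apply, smul_smul, mul_comm b a]

theorem mk_eq_mk_iff_cross {u v : Fin 3 → ℂ} (hu : u ≠ 0) (hv : v ≠ 0) :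
    Projectivization.mk ℂ u hu = Projectivization.mk ℂ v hv ↔ crossProduct u v = 0 :=
  Projectivization.mk_eq_mk_iff_crossProduct_eq_zero hu hv

theorem mk_smul_eq {c : ℂ} {u v : Fin 3 → ℂ} (hu : u ≠ 0) (hv : v ≠ 0) (h : u = c • v) :
    Projectivization.mk ℂ u hu = Projectivization.mk ℂ v hv :=
  (Projectivization.mk_eq_mk_iff' ℂ u v hu hv).2 ⟨c, h.symm⟩

/-- Four points such that any three are independent form a circuit. -/
theorem isCircuit_of_triple {f : Fin 4 → ℙ ℂ (Fin 3 → ℂ)} {v : Fin 4 → Fin 3 → ℂ}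
    (hf : ∀ i, ∃ h : v i ≠ 0, Projectivization.mk ℂ (v i) h = f i)
    (h012 : triple (v 0) (v 1) (v 2) ≠ 0) (h013 : triple (v 0) (v 1) (v 3) ≠ 0)
    (h023 : triple (v 0) (v 2) (v 3) ≠ 0) (h123 : triple (v 1) (v 2) (v 3) ≠ 0) :
    IsCircuit f := by
  choose hv hf using hf
  obtain rfl : (fun i => Projectivization.mk ℂ (v i) (hv i)) = f := funext hf
  refine ⟨Projectivization.Dependent.mk v hv fun h => ?_, fun s hs => ?_⟩
  · have := h.fintype_card_le_finrank
    simp at this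
  · refine Projectivization.Independent.mk (fun i : s => v i) (fun i => hv i) ?_
    -- A proper subfamily omits some index `e`, hence is part of the three vectors other than `e`.
    obtain ⟨e, he⟩ := (Set.ne_univ_iff_exists_notMem s).1 hs
    have key : LinearIndependent ℂ (v ∘ e.succAbove) := by
      have aux : ∀ a b c, triple (v a) (v b) (v c) ≠ 0 →
          (∀ i, e.succAbove i = ![a, b, c] i) → LinearIndependent ℂ (v ∘ e.succAbove) := by
        intro a b c h hi
        convert linearIndependent_of_triple_ne_zero h using 1
        funext i
        rw [Function.comp_apply, hi]
        fin_cases i <;> rfl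
      fin_cases e
      · exact aux 1 2 3 h123 (by decide)
      · exact aux 0 2 3 h023 (by decide)
      · exact aux 0 1 3 h013 (by decide)
      · exact aux 0 1 2 h012 (by decide)
    have hmem : ∀ i : s, ∃ j, e.succAbove j = i := fun i =>
      Fin.exists_succAbove_eq fun h => he (h ▸ i.2)
    choose g hg using hmem
    have : (fun i : s => v i) = (v ∘ e.succAbove) ∘ g := by
      funext i
      simp [hg]
    rw [this]
    exact key.comp g fun i j hij => Subtype.ext (by rw [← hg i, ← hg j, hij])

/-- Members of a circuit are distinct. -/
theorem IsCircuit.ne {f : Fin 4 → ℙ ℂ (Fin 3 → ℂ)} (h : IsCircuit f) {i j : Fin 4}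
    (hij : i ≠ j) : f i ≠ f j := by
  have hs : ({i, j} : Set (Fin 4)) ≠ Set.univ := by
    intro hu
    have h1 : ∀ x : Fin 4, x = i ∨ x = j := fun x => by
      have : x ∈ ({i, j} : Set (Fin 4)) := hu ▸ Set.mem_univ x
      simpa using this
    revert h1 hij
    fin_cases i <;> fin_cases j <;> decide
  have hind := Projectivization.independent_iff.1 (h.2 _ hs)
  intro heq
  have := hind.injective (a₁ := ⟨i, by simp⟩) (a₂ := ⟨j, by simp⟩) (by simp [heq])
  exact hij (congrArg Subtype.val this)

/-- Each of the four vectors occurs once in the numerator and once in the denominator, so the scale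
factors cancel. -/
theorem multiRatio_mk {A c B d : Fin 3 → ℂ} (hA : A ≠ 0) (hc : c ≠ 0) (hB : B ≠ 0) (hd : d ≠ 0) :
    multiRatio (Projectivization.mk ℂ A hA) (Projectivization.mk ℂ c hc)
      (Projectivization.mk ℂ B hB) (Projectivization.mk ℂ d hd)
      = ((c ⬝ᵥ A) * (d ⬝ᵥ B)) / ((c ⬝ᵥ B) * (d ⬝ᵥ A)) := by
  obtain ⟨a, ha⟩ := Projectivization.exists_smul_eq_mk_rep ℂ A hA
  obtain ⟨b, hb⟩ := Projectivization.exists_smul_eq_mk_rep ℂ B hB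
  obtain ⟨s, hs⟩ := Projectivization.exists_smul_eq_mk_rep ℂ c hc
  obtain ⟨t, ht⟩ := Projectivization.exists_smul_eq_mk_rep ℂ d hd
  unfold multiRatio
  rw [← ha, ← hb, ← hs, ← ht]
  simp only [Units.smul_def, smul_dotProduct, dotProduct_smul, smul_eq_mul]
  rw [show ((a : ℂ) * (s * (c ⬝ᵥ A)) * (b * (t * (d ⬝ᵥ B))))
      = (s * a * t * b) * ((c ⬝ᵥ A) * (d ⬝ᵥ B)) by ring,
    show ((b : ℂ) * (s * (c ⬝ᵥ B)) * (a * (t * (d ⬝ᵥ A))))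
      = (s * a * t * b) * ((c ⬝ᵥ B) * (d ⬝ᵥ A)) by ring]
  exact mul_div_mul_left _ _ (by simp)

end Plane

/-! ### Lifts -/

section Lifts

variable {n : ℕ}

theorem isLift_rep (P : ProjTuple n) : IsLift (fun i => (P i).rep) P :=
  fun i => ⟨(P i).rep_nonzero, (P i).mk_rep⟩

theorem IsLift.ne_zero {A : ZMod n → Fin 3 → ℂ} {P : ProjTuple n} (h : IsLift A P) (i : ZMod n) :
    A i ≠ 0 := (h i).1

theorem IsLift.mk_eq {A : ZMod n → Fin 3 → ℂ} {P : ProjTuple n} (h : IsLift A P) (i : ZMod n) :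
    P i = Projectivization.mk ℂ (A i) (h.ne_zero i) := (h i).2.symm

theorem isLift_mk {A : ZMod n → Fin 3 → ℂ} (h : ∀ i, A i ≠ 0) :
    IsLift A (fun i => Projectivization.mk ℂ (A i) (h i)) := fun i => ⟨h i, rfl⟩

theorem IsLift.eq {A : ZMod n → Fin 3 → ℂ} {P Q : ProjTuple n} (hP : IsLift A P)
    (hQ : IsLift A Q) : P = Q := funext fun i => by rw [hP.mk_eq, hQ.mk_eq]

theorem IsLift.smul {A : ZMod n → Fin 3 → ℂ} {P : ProjTuple n} (h : IsLift A P)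
    {c : ZMod n → ℂ} (hc : ∀ i, c i ≠ 0) : IsLift (fun i => c i • A i) P := fun i =>
  ⟨smul_ne_zero (hc i) (h.ne_zero i), by
    rw [h.mk_eq i]
    exact mk_smul_eq _ _ rfl⟩

theorem IsLift.exists_smul {A B : ZMod n → Fin 3 → ℂ} {P : ProjTuple n} (hA : IsLift A P)
    (hB : IsLift B P) : ∃ c : ZMod n → ℂ, (∀ i, c i ≠ 0) ∧ B = fun i => c i • A i := by
  have : ∀ i, ∃ c : ℂ, B i = c • A i := fun i => by
    obtain ⟨c, hc⟩ := (Projectivization.mk_eq_mk_iff' ℂ (B i) (A i) (hB.ne_zero i)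
      (hA.ne_zero i)).1 ((hB.mk_eq i).symm.trans (hA.mk_eq i))
    exact ⟨c, hc.symm⟩
  choose c hc using this
  exact ⟨c, fun i h0 => hB.ne_zero i (by rw [hc, h0, zero_smul]), funext hc⟩

theorem IsLift.cross {k : ℕ} {l : ZMod n → Fin 3 → ℂ} {Q : ProjTuple n} (h : IsLift l Q)
    (hQ : ∀ i, Q i ≠ Q (i + k)) :
    IsLift (fun i => crossProduct (l i) (l (i + k))) (diagonals k Q) := fun i => by
  have hne := hQ i
  rw [h.mk_eq i, h.mk_eq (i + k)] at hne
  exact ⟨fun h0 => hne ((mk_eq_mk_iff_cross _ _).2 h0), by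
    rw [diagonals, h.mk_eq i, h.mk_eq (i + k), Projectivization.cross_mk_of_ne _ _ hne]⟩

end Lifts

/-! ### The Zariski topology of `(ℙ²)ⁿ` -/

section ZariskiProj

variable {n : ℕ}

/-- Rescaling of the vectors of a tuple. -/
def rescale (c : ZMod n → ℂ) (l : ZMod n → Fin 3 → ℂ) : ZMod n → Fin 3 → ℂ := fun i => c i • l i

theorem evalLift_mul (F G : MvPolynomial (ZMod n × Fin 3) ℂ) (l : ZMod n → Fin 3 → ℂ) :
    evalLift (F * G) l = evalLift F l * evalLift G l := map_mul _ _ _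

theorem evalLift_add (F G : MvPolynomial (ZMod n × Fin 3) ℂ) (l : ZMod n → Fin 3 → ℂ) :
    evalLift (F + G) l = evalLift F l + evalLift G l := map_add _ _ _

theorem evalLift_X (i : ZMod n) (j : Fin 3) (l : ZMod n → Fin 3 → ℂ) :
    evalLift (MvPolynomial.X (i, j)) l = l i j := MvPolynomial.eval_X _

theorem evalLift_prod {ι : Type*} (s : Finset ι) (F : ι → MvPolynomial (ZMod n × Fin 3) ℂ)
    (l : ZMod n → Fin 3 → ℂ) : evalLift (∏ i ∈ s, F i) l = ∏ i ∈ s, evalLift (F i) l :=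
  map_prod (MvPolynomial.eval _) _ _

/-- The vanishing of the polynomial does not depend on the choice of a lift. -/
def ScaleInvariant (F : MvPolynomial (ZMod n × Fin 3) ℂ) : Prop :=
  ∀ c : ZMod n → ℂ, (∀ i, c i ≠ 0) → ∀ l, evalLift F (rescale c l) ≠ 0 ↔ evalLift F l ≠ 0

theorem ScaleInvariant.mul {F G : MvPolynomial (ZMod n × Fin 3) ℂ} (hF : ScaleInvariant F)
    (hG : ScaleInvariant G) : ScaleInvariant (F * G) := fun c hc l => by
  simp only [evalLift_mul, mul_ne_zero_iff, hF c hc l, hG c hc l]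

theorem ScaleInvariant.prod {ι : Type*} (s : Finset ι)
    {F : ι → MvPolynomial (ZMod n × Fin 3) ℂ} (hF : ∀ i ∈ s, ScaleInvariant (F i)) :
    ScaleInvariant (∏ i ∈ s, F i) := fun c hc l => by
  simp only [evalLift_prod, Finset.prod_ne_zero_iff]
  exact forall₂_congr fun i hi => hF i hi c hc l

/-- The tuples on the lifts of which a polynomial does not vanish. -/
def nonvanishing (F : MvPolynomial (ZMod n × Fin 3) ℂ) : Set (ProjTuple n) :=
  {P | ∀ A, IsLift A P → evalLift F A ≠ 0}

theorem mem_nonvanishing_iff {F : MvPolynomial (ZMod n × Fin 3) ℂ} (hF : ScaleInvariant F)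
    {P : ProjTuple n} {A : ZMod n → Fin 3 → ℂ} (hA : IsLift A P) :
    P ∈ nonvanishing F ↔ evalLift F A ≠ 0 := by
  refine ⟨fun h => h A hA, fun h B hB => ?_⟩
  obtain ⟨c, hc, rfl⟩ := hA.exists_smul hB
  exact (hF c hc A).2 h

theorem isOpen_nonvanishing {F : MvPolynomial (ZMod n × Fin 3) ℂ} (hF : ScaleInvariant F) :
    IsOpen (nonvanishing F) :=
  TopologicalSpace.isOpen_generateFrom_of_mem ⟨F, fun _ _ hA => mem_nonvanishing_iff hF hA⟩

theorem dense_nonvanishing [NeZero n] {F : MvPolynomial (ZMod n × Fin 3) ℂ} (hF : F ≠ 0)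
    (hinv : ScaleInvariant F) : Dense (nonvanishing F) := by
  have h := TopologicalSpace.isTopologicalBasis_of_subbasis_of_inter
    (α := ProjTuple n) (r := {W | ∃ F : MvPolynomial (ZMod n × Fin 3) ℂ, ∀ (P : ProjTuple n)
      (A : ZMod n → Fin 3 → ℂ), IsLift A P → (P ∈ W ↔ evalLift F A ≠ 0)}) rfl (by
    rintro s ⟨F, hF⟩ t ⟨G, hG⟩
    exact ⟨F * G, fun P A hA => by
      rw [Set.mem_inter_iff, hF P A hA, hG P A hA, evalLift_mul, mul_ne_zero_iff]⟩)
  rw [Set.insert_eq_of_mem] at h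
  swap
  · exact ⟨1, fun P A _ => by simp [evalLift]⟩
  rw [h.dense_iff]
  rintro W ⟨E, hE⟩ ⟨P, hP⟩
  have hE0 : E ≠ 0 := by
    rintro rfl
    have := (hE P _ (isLift_rep P)).1 hP
    simp [evalLift] at this
  -- The factors `X (i, 0)` force every vector of the chosen tuple to be nonzero, so that it
  -- represents a point.
  have hprod : E * F * ∏ i : ZMod n, MvPolynomial.X (i, (0 : Fin 3)) ≠ 0 :=
    mul_ne_zero (mul_ne_zero hE0 hF) (Finset.prod_ne_zero_iff.2 fun i _ => MvPolynomial.X_ne_zero _)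
  obtain ⟨x, hx⟩ : ∃ x, MvPolynomial.eval x
      (E * F * ∏ i : ZMod n, MvPolynomial.X (i, (0 : Fin 3))) ≠ 0 := by
    by_contra hcon
    push Not at hcon
    exact hprod (MvPolynomial.funext fun x => by rw [hcon x, map_zero])
  have hx' : evalLift (E * F * ∏ i : ZMod n, MvPolynomial.X (i, (0 : Fin 3)))
      (fun i j => x (i, j)) ≠ 0 := hx
  rw [evalLift_mul, evalLift_mul, evalLift_prod] at hx'
  obtain ⟨⟨hxE, hxF⟩, hx0⟩ := (mul_ne_zero_iff.trans (and_congr_left' mul_ne_zero_iff)).1 hx'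
  rw [Finset.prod_ne_zero_iff] at hx0
  have hne : ∀ i : ZMod n, (fun j => x (i, j)) ≠ 0 := fun i h0 =>
    hx0 i (Finset.mem_univ _) (by rw [evalLift_X]; exact congrFun h0 0)
  have hlift := isLift_mk hne
  refine ⟨_, (hE _ _ hlift).2 hxE, (mem_nonvanishing_iff hinv hlift).2 hxF⟩

end ZariskiProj

/-! ### Rational functions and birational maps -/

section Rational

variable {n : ℕ}

/-- The quotient of the polynomials does not depend on the choice of a lift. -/
def IsScaleInvariantQuotient (N D : MvPolynomial (ZMod n × Fin 3) ℂ) : Prop :=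
  ScaleInvariant D ∧ ∀ c : ZMod n → ℂ, (∀ i, c i ≠ 0) → ∀ l,
    evalLift N (rescale c l) * evalLift D l = evalLift N l * evalLift D (rescale c l)

/-- A function given on `X` by a quotient of polynomials in homogeneous coordinates. -/
def RationalOn (X : Set (ProjTuple n)) (θ : ProjTuple n → ℂ) : Prop :=
  ∃ N D : MvPolynomial (ZMod n × Fin 3) ℂ, IsScaleInvariantQuotient N D ∧
    ∀ q ∈ X, ∀ l, IsLift l q → evalLift D l ≠ 0 ∧ θ q = evalLift N l / evalLift D l

variable {X : Set (ProjTuple n)} {θ η : ProjTuple n → ℂ}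

theorem rationalOn_const (X : Set (ProjTuple n)) (c : ℂ) : RationalOn X fun _ => c :=
  ⟨MvPolynomial.C c, 1, ⟨fun _ _ _ => by simp [evalLift], fun _ _ _ => by simp [evalLift]⟩,
    fun _ _ _ _ => by simp [evalLift]⟩

theorem RationalOn.congr (h : RationalOn X θ) (he : ∀ q ∈ X, η q = θ q) : RationalOn X η := by
  obtain ⟨N, D, hi, h⟩ := h
  exact ⟨N, D, hi, fun q hq l hl => by rw [he q hq]; exact h q hq l hl⟩

theorem RationalOn.mul (hθ : RationalOn X θ) (hη : RationalOn X η) :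
    RationalOn X fun q => θ q * η q := by
  obtain ⟨N, D, ⟨hD, hi⟩, h⟩ := hθ
  obtain ⟨N', D', ⟨hD', hi'⟩, h'⟩ := hη
  refine ⟨N * N', D * D', ⟨hD.mul hD', fun c hc l => ?_⟩, fun q hq l hl => ?_⟩
  · simp only [evalLift_mul]
    linear_combination (evalLift N' (rescale c l) * evalLift D' l) * hi c hc l
      + (evalLift N l * evalLift D (rescale c l)) * hi' c hc l
  · obtain ⟨h1, h2⟩ := h q hq l hl
    obtain ⟨h3, h4⟩ := h' q hq l hl
    simp only [evalLift_mul]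
    exact ⟨mul_ne_zero h1 h3, by rw [h2, h4, div_mul_div_comm]⟩

theorem RationalOn.add (hθ : RationalOn X θ) (hη : RationalOn X η) :
    RationalOn X fun q => θ q + η q := by
  obtain ⟨N, D, ⟨hD, hi⟩, h⟩ := hθ
  obtain ⟨N', D', ⟨hD', hi'⟩, h'⟩ := hη
  refine ⟨N * D' + D * N', D * D', ⟨hD.mul hD', fun c hc l => ?_⟩, fun q hq l hl => ?_⟩
  · simp only [evalLift_mul, evalLift_add]
    linear_combination (evalLift D' (rescale c l) * evalLift D' l) * hi c hc l
      + (evalLift D l * evalLift D (rescale c l)) * hi' c hc l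
  · obtain ⟨h1, h2⟩ := h q hq l hl
    obtain ⟨h3, h4⟩ := h' q hq l hl
    simp only [evalLift_mul, evalLift_add]
    exact ⟨mul_ne_zero h1 h3, by rw [h2, h4, div_add_div _ _ h1 h3]⟩

theorem RationalOn.inv (hθ : RationalOn X θ) (h0 : ∀ q ∈ X, θ q ≠ 0) :
    RationalOn X fun q => (θ q)⁻¹ := by
  obtain ⟨N, D, ⟨hD, hi⟩, h⟩ := hθ
  -- The factor `D` is kept because the vanishing of `N` is independent of the lift only where `D`
  -- is nonzero.
  refine ⟨D * D, N * D, ⟨fun c hc l => ?_, fun c hc l => ?_⟩, fun q hq l hl => ?_⟩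
  · simp only [evalLift_mul, mul_ne_zero_iff, hD c hc l]
    refine and_congr_left fun hl => ?_
    rw [← mul_ne_zero_iff_right hl, hi c hc l, mul_ne_zero_iff_right ((hD c hc l).2 hl)]
  · simp only [evalLift_mul]
    linear_combination (-evalLift D (rescale c l) * evalLift D l) * hi c hc l
  · obtain ⟨h1, h2⟩ := h q hq l hl
    have hN : evalLift N l ≠ 0 := fun h3 => h0 q hq (by rw [h2, h3, zero_div])
    simp only [evalLift_mul]
    exact ⟨mul_ne_zero hN h1, by rw [h2]; field_simp⟩

theorem RationalOn.pow (hθ : RationalOn X θ) (m : ℕ) : RationalOn X fun q => θ q ^ m := by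
  induction m with
  | zero => simpa using rationalOn_const X 1
  | succ m ih => simpa only [pow_succ] using ih.mul hθ

theorem RationalOn.zpow (hθ : RationalOn X θ) (h0 : ∀ q ∈ X, θ q ≠ 0) (m : ℤ) :
    RationalOn X fun q => θ q ^ m := by
  cases m with
  | ofNat m => simpa using hθ.pow m
  | negSucc m =>
    simpa only [zpow_negSucc] using (hθ.pow (m + 1)).inv fun q hq => pow_ne_zero _ (h0 q hq)

theorem rationalOn_prod {ι : Type*} (s : Finset ι) {θ : ι → ProjTuple n → ℂ}
    (h : ∀ i ∈ s, RationalOn X (θ i)) : RationalOn X fun q => ∏ i ∈ s, θ i q := by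
  classical
  induction s using Finset.induction_on with
  | empty => simpa using rationalOn_const X 1
  | insert i s hi ih =>
    simp only [Finset.prod_insert hi]
    exact (h i (Finset.mem_insert_self _ _)).mul
      (ih fun j hj => h j (Finset.mem_insert_of_mem hj))

theorem RationalOn.exists_isOpen (hθ : RationalOn X θ) :
    ∃ O : Set (ProjTuple n), IsOpen O ∧ ∀ q ∈ X, q ∈ O ↔ θ q ≠ 0 := by
  obtain ⟨N, D, ⟨hD, hi⟩, h⟩ := hθ
  have hinv : ScaleInvariant (N * D) := fun c hc l => by
    simp only [evalLift_mul, mul_ne_zero_iff, hD c hc l]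
    refine and_congr_left fun hl => ?_
    rw [← mul_ne_zero_iff_right hl, hi c hc l, mul_ne_zero_iff_right ((hD c hc l).2 hl)]
  refine ⟨nonvanishing (N * D), isOpen_nonvanishing hinv, fun q hq => ?_⟩
  obtain ⟨h1, h2⟩ := h q hq _ (isLift_rep q)
  rw [mem_nonvanishing_iff hinv (isLift_rep q), evalLift_mul, h2]
  simp [h1]

variable {k : ℕ}

theorem rationalOn_eval {F : ProjTuple n → H1 n k} (hz : RationalOn X fun q => (F q).z)
    (hw : RationalOn X fun q => (F q).w) (p : Poly) : RationalOn X fun q => (F q).eval p := by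
  induction p using MvPolynomial.induction_on with
  | C a => simpa using rationalOn_const X a
  | add p q hp hq => simpa only [map_add] using hp.add hq
  | mul_X p i hp =>
    simp only [map_mul]
    refine hp.mul ?_
    fin_cases i
    · simpa using hz
    · simpa using hw

theorem regularToH1_of_rationalOn {F : ProjTuple n → H1 n k} {V : Set (ProjTuple n)}
    (hVX : V ⊆ X) (hz : RationalOn X fun q => (F q).z) (hw : RationalOn X fun q => (F q).w) :
    RegularToH1 F V := fun γ q₀ hq₀ => by
  obtain ⟨N, D, -, h⟩ : RationalOn X fun q => (F q).val γ := by
    simp only [H1.val_eq]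
    exact (hz.zpow (fun q _ => (F q).z_ne_zero) _).mul (hw.zpow (fun q _ => (F q).w_ne_zero) _)
  exact ⟨N, D, fun l hl => (h q₀ (hVX hq₀) l hl).1, fun q hq l hl _ => (h q (hVX hq) l hl).2⟩

theorem H1.eval_aeval (α : H1 n k) (ψ : ZMod n → Fin 3 → Poly)
    (F : MvPolynomial (ZMod n × Fin 3) ℂ) :
    α.eval (MvPolynomial.aeval (fun p : ZMod n × Fin 3 => ψ p.1 p.2) F)
      = evalLift F fun i j => α.eval (ψ i j) := by
  induction F using MvPolynomial.induction_on with
  | C a => simp [evalLift, MvPolynomial.algebraMap_eq]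
  | add p q hp hq => rw [map_add, map_add, hp, hq, evalLift_add]
  | mul_X p i hp => rw [map_mul, map_mul, hp, evalLift_mul, MvPolynomial.aeval_X, evalLift_X]

/-- Substituting the parametrization into a polynomial in homogeneous coordinates gives a polynomial
in `z, w`, so basic open sets pull back to basic open sets. -/
theorem continuousOn_of_isLift {G : H1 n k → ProjTuple n} {U : Set (H1 n k)}
    {ψ : ZMod n → Fin 3 → Poly} (hG : ∀ α ∈ U, IsLift (fun i j => α.eval (ψ i j)) (G α)) :
    ContinuousOn G U := by
  rw [continuousOn_iff_continuous_domRestrict]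
  refine continuous_generateFrom_iff.2 ?_
  rintro W ⟨F, hF⟩
  refine ⟨_, isOpen_basicOpen
    (MvPolynomial.aeval (fun p : ZMod n × Fin 3 => ψ p.1 p.2) F), ?_⟩
  ext ⟨α, hα⟩
  simp only [Set.mem_preimage, Set.domRestrict_apply, basicOpen, Set.mem_ofPred_eq, H1.eval_aeval]
  exact (hF _ _ (hG α hα)).symm

theorem regularToProj_of_isLift {G : H1 n k → ProjTuple n} {U : Set (H1 n k)}
    {ψ : ZMod n → Fin 3 → Poly} (hG : ∀ α ∈ U, IsLift (fun i j => α.eval (ψ i j)) (G α)) :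
    RegularToProj G U := fun i α₀ hα₀ => by
  choose φ hφ using fun j => exists_evalH1_eq n k (ψ i j)
  have he : ∀ α, (fun j => evalH1 (φ j) α) = fun j => α.eval (ψ i j) := fun α =>
    funext fun j => hφ j α
  refine ⟨φ, ?_, fun α hα h => ?_⟩
  · rw [he]
    exact (hG α₀ hα₀).ne_zero i
  · rw [(hG α hα).mk_eq i]
    congr 1
    exact (he α).symm

/-- A map of varieties with a rational inverse that is regular over a nonempty open subset of
its irreducible target is birational. -/
theorem isBirationalOnto_of_isLift {S : Set (H1 n k)} {F : ProjTuple n → H1 n k}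
    (hS : IsIrreducible S) (hFS : Set.MapsTo F X S) (hz : RationalOn X fun q => (F q).z)
    (hw : RationalOn X fun q => (F q).w) (H : Poly) (hH : ∃ α ∈ S, α.eval H ≠ 0)
    {G : H1 n k → ProjTuple n} {ψ : ZMod n → Fin 3 → Poly}
    (hG : ∀ α ∈ S, α.eval H ≠ 0 → IsLift (fun i j => α.eval (ψ i j)) (G α))
    (hGX : ∀ α ∈ S, α.eval H ≠ 0 → G α ∈ X) (hFG : ∀ α ∈ S, α.eval H ≠ 0 → F (G α) = α)
    (hGF : ∀ q ∈ X, (F q).eval H ≠ 0 → G (F q) = q) : IsBirationalOnto X S F := by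
  have hHo := isOpen_basicOpen (n := n) (k := k) H
  set U := S ∩ basicOpen n k H with hU
  set V := X ∩ F ⁻¹' U with hV
  have hGU : ∀ α ∈ U, IsLift (fun i j => α.eval (ψ i j)) (G α) := fun α hα => hG α hα.1 hα.2
  have hUirr : IsIrreducible U := by
    obtain ⟨α, hα, hαH⟩ := hH
    refine ⟨⟨α, hα, hαH⟩, fun u v hu hv ⟨x, hx, hxu⟩ ⟨y, hy, hyv⟩ => ?_⟩
    obtain ⟨t, ht, ⟨h1, h2⟩, -, h3⟩ := hS.2 (basicOpen n k H ∩ u) (basicOpen n k H ∩ v)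
      (hHo.inter hu) (hHo.inter hv) ⟨x, hx.1, hx.2, hxu⟩ ⟨y, hy.1, hy.2, hyv⟩
    exact ⟨t, ⟨ht, h1⟩, h2, h3⟩
  have hVimage : V = G '' U := by
    ext q
    constructor
    · rintro ⟨hqX, hq⟩
      exact ⟨F q, hq, hGF q hqX hq.2⟩
    · rintro ⟨α, hα, rfl⟩
      exact ⟨hGX α hα.1 hα.2, by
        rw [Set.mem_preimage, hFG α hα.1 hα.2]
        exact hα⟩
  have hVirr : IsIrreducible V := by
    rw [hVimage]
    exact hUirr.image G (continuousOn_of_isLift hGU)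
  obtain ⟨O, hO, hOX⟩ := (rationalOn_eval hz hw H).exists_isOpen
  have hVO : V = X ∩ O := by
    ext q
    constructor
    · rintro ⟨hq, hqU⟩
      exact ⟨hq, (hOX q hq).2 hqU.2⟩
    · rintro ⟨hq, hqO⟩
      exact ⟨hq, hFS hq, (hOX q hq).1 hqO⟩
  -- The component sought is the closure of `V` in `X`.
  have hVX0 : V ⊆ X ∩ closure V := fun q hq => ⟨hq.1, subset_closure hq⟩
  refine ⟨hFS, X ∩ closure V, V, U, G, ⟨?_, _, hHo, rfl⟩, rfl, ⟨⟨Set.inter_subset_left, ?_⟩, ?_⟩,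
    ⟨Set.inter_subset_right, O, hO, ?_⟩, ⟨O, hO, hVO⟩,
    regularToH1_of_rationalOn Set.inter_subset_left hz hw, regularToProj_of_isLift hGU, ?_, ?_,
    fun α hα => hFG α hα.1 hα.2⟩
  · intro α hα
    rw [mem_closure_iff]
    intro o ho hαo
    obtain ⟨β, hβ, h1, h2⟩ := hS.2 o _ ho hHo ⟨α, hα, hαo⟩ hH
    exact ⟨β, h1, hβ, h2⟩
  · refine ⟨hVirr.1.mono hVX0, fun u v hu hv ⟨x, hx, hxu⟩ ⟨y, hy, hyv⟩ => ?_⟩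
    obtain ⟨x', hx'u, hx'⟩ := mem_closure_iff.1 hx.2 u hu hxu
    obtain ⟨y', hy'v, hy'⟩ := mem_closure_iff.1 hy.2 v hv hyv
    exact (hVirr.2 u v hu hv ⟨x', hx', hx'u⟩ ⟨y', hy', hy'v⟩).mono
      (Set.inter_subset_inter_left _ hVX0)
  -- Maximality: `V` is open in `X`, so an irreducible `Z` containing it meets it in a dense subset
  -- and lies in its closure.
  · rintro Z ⟨hZX, hZ⟩ hle q hq
    refine ⟨hZX hq, mem_closure_iff.2 fun o ho hqo => ?_⟩
    obtain ⟨p, hp⟩ := hVirr.1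
    obtain ⟨x, hxZ, hxo, hxO⟩ := hZ.2 o O ho hO ⟨q, hq, hqo⟩
      ⟨p, hle (hVX0 hp), (hVO ▸ hp : p ∈ X ∩ O).2⟩
    exact ⟨x, hxo, hVO ▸ ⟨hZX hxZ, hxO⟩⟩
  · ext q
    constructor
    · intro hq
      exact ⟨hVX0 hq, (hVO ▸ hq : q ∈ X ∩ O).2⟩
    · rintro ⟨⟨hqX, -⟩, hqO⟩
      rw [hVO]
      exact ⟨hqX, hqO⟩
  · intro α hα
    rw [hVimage]
    exact ⟨α, hα, rfl⟩
  · exact fun q hq => hGF q hq.1 hq.2.2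

end Rational

/-! ### The Kasteleyn matrix -/

section KasteleynMatrix

open Matrix

variable {n k : ℕ}

/-- The functional obtained by evaluating the coefficients. -/
def pairing (x : Fin 2 → ℂ) (r : Fin n → Poly) (h : Fin n → ℂ) : ℂ :=
  ∑ j, MvPolynomial.eval x (r j) * h j

theorem pairing_add (x : Fin 2 → ℂ) (r s : Fin n → Poly) (h : Fin n → ℂ) :
    pairing x (r + s) h = pairing x r h + pairing x s h := by
  simp only [pairing, Pi.add_apply, map_add, add_mul, Finset.sum_add_distrib]

theorem pairing_smul (x : Fin 2 → ℂ) (p : Poly) (r : Fin n → Poly) (h : Fin n → ℂ) :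
    pairing x (p • r) h = MvPolynomial.eval x p * pairing x r h := by
  simp only [pairing, Pi.smul_apply, smul_eq_mul, map_mul, Finset.mul_sum, mul_assoc]

theorem pairing_sum {ι : Type*} (s : Finset ι) (x : Fin 2 → ℂ) (r : ι → Fin n → Poly)
    (h : Fin n → ℂ) : pairing x (∑ i ∈ s, r i) h = ∑ i ∈ s, pairing x (r i) h := by
  simp only [pairing, Finset.sum_apply, map_sum, Finset.sum_mul]
  rw [Finset.sum_comm]

theorem pairing_vecMul (x : Fin 2 → ℂ) (t : Fin n → Poly) (M : Matrix (Fin n) (Fin n) Poly)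
    (h : Fin n → ℂ) : pairing x (t ᵥ* M) h
      = ∑ i, MvPolynomial.eval x (t i) * pairing x (M i) h := by
  simp only [pairing, Matrix.vecMul, dotProduct, map_sum, map_mul, Finset.sum_mul, Finset.mul_sum]
  rw [Finset.sum_comm]
  simp only [mul_assoc]

theorem idx_coe (j : ℕ) : idx n k ((j : ℤ), 0) = (j : ZMod n) := by
  simp [idx]

variable [NeZero n]

/-- The residue modulo `n` of an integer. -/
def residue (n : ℕ) [NeZero n] (m : ℤ) : Fin n :=
  ⟨(m % n).toNat, by
    have h1 := Int.emod_nonneg m (Int.natCast_ne_zero.2 (NeZero.ne n))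
    have h2 := Int.emod_lt_of_pos m (Int.natCast_pos.2 (NeZero.pos n))
    omega⟩

theorem residue_val (m : ℤ) : ((residue n m : ℕ) : ℤ) = m % n :=
  Int.toNat_of_nonneg (Int.emod_nonneg m (Int.natCast_ne_zero.2 (NeZero.ne n)))

theorem residue_natCast (m : ℕ) : residue n m = ⟨m % n, Nat.mod_lt _ (NeZero.pos n)⟩ := by
  apply Fin.ext
  have := residue_val (n := n) m
  simp only
  omega

theorem residue_add_of_dvd {a b : ℤ} (h : (n : ℤ) ∣ a) : residue n (a + b) = residue n b := by
  obtain ⟨c, rfl⟩ := h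
  have h1 := residue_val (n := n) (b + n * c)
  have h2 := residue_val (n := n) b
  rw [Int.add_mul_emod_self_left] at h1
  rw [add_comm]
  exact Fin.ext (by omega)

/-- The quasi-periodic function with given values at the vertices `(j, 0)`, `0 ≤ j < n`. -/
def extension (α : H1 n k) (h : Fin n → ℂ) (v : ℤ × ℤ) : ℂ :=
  α.w ^ v.2 * (α.z ^ level n k v * h (residue n (v.1 + k * v.2)))

theorem extension_mem (α : H1 n k) (h : Fin n → ℂ) : extension α h ∈ quasiPeriodic α := by
  intro γ v
  unfold extension
  rw [α.val_eq, level_add γ.2, Prod.snd_add, zpow_add₀ α.w_ne_zero, zpow_add₀ α.z_ne_zero,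
    show (↑γ + v : ℤ × ℤ).1 + (k : ℤ) * ((γ : ℤ × ℤ).2 + v.2)
      = ((γ : ℤ × ℤ).1 + k * (γ : ℤ × ℤ).2) + (v.1 + k * v.2) by rw [Prod.fst_add]; ring,
    residue_add_of_dvd (mem_deck_iff.1 γ.2)]
  ring

/-- The vertices `(j, 0)` with `0 ≤ j < n` form a fundamental domain. They have level and height
`0`, so the deck transformation inherits both from `v`. -/
theorem exists_deck_add (n k : ℕ) [NeZero n] (v : ℤ × ℤ) : ∃ γ : deck n k,
    v = (γ : ℤ × ℤ) + (((residue n (v.1 + k * v.2) : ℕ) : ℤ), 0) ∧ level n k γ = level n k v ∧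
      (γ : ℤ × ℤ).2 = v.2 := by
  have h := Int.emod_add_mul_ediv (v.1 + k * v.2) n
  have hr := residue_val (n := n) (v.1 + k * v.2)
  have hn : (n : ℤ) ≠ 0 := Int.natCast_ne_zero.2 (NeZero.ne n)
  have he : v.1 - (residue n (v.1 + k * v.2) : ℕ) + k * v.2
      = n * ((v.1 + k * v.2) / n) := by
    rw [hr]; linarith
  refine ⟨⟨(v.1 - (residue n (v.1 + k * v.2) : ℕ), v.2), mem_deck_iff.2 ⟨_, he⟩⟩, ?_, ?_, rfl⟩
  · ext <;> simp
  · unfold level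
    simp only
    rw [he, Int.mul_ediv_cancel_left _ hn]

theorem extension_restrict {α : H1 n k} {f : ℤ × ℤ → ℂ} (hf : f ∈ quasiPeriodic α) :
    extension α (fun j => f ((j : ℕ), 0)) = f := by
  funext v
  obtain ⟨γ, hv, hl, h2⟩ := exists_deck_add n k v
  conv_rhs => rw [hv, hf γ, α.val_eq, hl, h2]
  unfold extension
  ring

theorem extension_apply_natCast (α : H1 n k) (h : Fin n → ℂ) (a b : ℕ) :
    extension α h (a, b) = α.w ^ b * (α.z ^ ((a + k * b) / n)
      * h ⟨(a + k * b) % n, Nat.mod_lt _ (NeZero.pos n)⟩) := by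
  unfold extension level
  have h1 : ((a : ℤ) + k * b) = ((a + k * b : ℕ) : ℤ) := by push_cast; ring
  simp only
  rw [h1, residue_natCast, ← Int.natCast_div, zpow_natCast, zpow_natCast]

theorem extension_apply_coe (α : H1 n k) (h : Fin n → ℂ) (j : Fin n) :
    extension α h ((j : ℕ), 0) = h j := by
  have := extension_apply_natCast α h j 0
  simp only [Nat.cast_zero, mul_zero, add_zero, pow_zero, one_mul, Nat.div_eq_of_lt j.2] at this
  rw [this]
  congr 1
  exact Fin.ext (Nat.mod_eq_of_lt j.2)

theorem eq_zero_of_restrict {α : H1 n k} {f : ℤ × ℤ → ℂ} (hf : f ∈ quasiPeriodic α)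
    (h : ∀ j : Fin n, f ((j : ℕ), 0) = 0) : f = 0 := by
  rw [← extension_restrict hf]
  funext v
  simp [extension, h]

/-- The functional on quasi-periodic functions, in terms of their values at `(j, 0)`, that takes
the value at the vertex `(a, b)`. -/
def site (n k : ℕ) [NeZero n] (a b : ℕ) : Fin n → Poly := fun j =>
  if (j : ℕ) = (a + k * b) % n then MvPolynomial.X 1 ^ b * MvPolynomial.X 0 ^ ((a + k * b) / n)
  else 0

theorem pairing_site (x : Fin 2 → ℂ) (a b : ℕ) (h : Fin n → ℂ) :
    pairing x (site n k a b) h = x 1 ^ b * (x 0 ^ ((a + k * b) / n)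
      * h ⟨(a + k * b) % n, Nat.mod_lt _ (NeZero.pos n)⟩) := by
  unfold pairing
  rw [Finset.sum_eq_single ⟨(a + k * b) % n, Nat.mod_lt _ (NeZero.pos n)⟩]
  · simp [site, mul_assoc]
  · intro j _ hj
    rw [site, if_neg fun h => hj (Fin.ext h), map_zero, zero_mul]
  · simp

theorem pairing_coord_site (α : H1 n k) (h : Fin n → ℂ) (a b : ℕ) :
    pairing α.coord (site n k a b) h = extension α h (a, b) := by
  rw [pairing_site, extension_apply_natCast]
  rfl

/-- The edges at a black vertex, with natural coordinates. -/
def offsetNat : Fin 4 → ℕ × ℕ := ![(0, 0), (1, 0), (0, 1), (1, 1)]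

theorem offset_eq (e : Fin 4) : offset e = (((offsetNat e).1 : ℤ), ((offsetNat e).2 : ℤ)) := by
  fin_cases e <;> rfl

/-- The matrix of the Kasteleyn operator in the coordinates `z, w`. -/
def kmatrix (k : ℕ) (κ : ZMod n → Fin 4 → ℂ) : Matrix (Fin n) (Fin n) Poly := fun j =>
  ∑ e : Fin 4, (MvPolynomial.C (κ ((j : ℕ) : ZMod n) e) : Poly) •
    site n k ((j : ℕ) + (offsetNat e).1) (offsetNat e).2

theorem pairing_kmatrix (x : Fin 2 → ℂ) (κ : ZMod n → Fin 4 → ℂ) (j : Fin n) (h : Fin n → ℂ) :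
    pairing x (kmatrix k κ j) h = ∑ e : Fin 4, κ ((j : ℕ) : ZMod n) e *
      pairing x (site n k ((j : ℕ) + (offsetNat e).1) (offsetNat e).2) h := by
  unfold kmatrix
  rw [pairing_sum]
  simp only [pairing_smul, MvPolynomial.eval_C]

theorem kasteleyn_extension (κ : ZMod n → Fin 4 → ℂ) (α : H1 n k) (h : Fin n → ℂ) (j : Fin n) :
    kasteleyn n k κ (extension α h) ((j : ℕ), 0) = pairing α.coord (kmatrix k κ j) h := by
  rw [pairing_kmatrix]
  change ∑ e : Fin 4, κ (idx n k (((j : ℕ) : ℤ), 0)) e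
    * extension α h ((((j : ℕ) : ℤ), 0) + offset e) = _
  refine Finset.sum_congr rfl fun e _ => ?_
  rw [idx_coe, pairing_coord_site, offset_eq]
  congr 3
  · simp

/-- The determinant of the Kasteleyn matrix, the equation of the spectral curve. -/
def kdet (k : ℕ) (κ : ZMod n → Fin 4 → ℂ) : Poly := (kmatrix k κ).det

/-- The Kasteleyn matrix at a point. -/
def kmatrixAt (k : ℕ) (κ : ZMod n → Fin 4 → ℂ) (x : Fin 2 → ℂ) : Matrix (Fin n) (Fin n) ℂ :=
  (kmatrix k κ).map (MvPolynomial.eval x)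

theorem eval_kdet (κ : ZMod n → Fin 4 → ℂ) (x : Fin 2 → ℂ) :
    MvPolynomial.eval x (kdet k κ) = (kmatrixAt k κ x).det :=
  RingHom.map_det _ _

/-- Formulated on all of `ℂ²` rather than on the torus, since it is also needed at the boundary
point with `w = 0`. -/
theorem eval_kdet_eq_zero_iff (κ : ZMod n → Fin 4 → ℂ) (x : Fin 2 → ℂ) :
    MvPolynomial.eval x (kdet k κ) = 0 ↔
      ∃ h : Fin n → ℂ, h ≠ 0 ∧ ∀ j, pairing x (kmatrix k κ j) h = 0 := by
  rw [eval_kdet, ← Matrix.exists_mulVec_eq_zero_iff]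
  refine exists_congr fun h => and_congr_right fun _ => ?_
  exact ⟨fun h0 j => congrFun h0 j, fun h0 => funext h0⟩

theorem kasteleyn_eq_zero_iff (κ : ZMod n → Fin 4 → ℂ) (α : H1 n k) (h : Fin n → ℂ) :
    kasteleyn n k κ (extension α h) = 0 ↔ ∀ j, pairing α.coord (kmatrix k κ j) h = 0 := by
  simp only [← kasteleyn_extension]
  exact ⟨fun h0 j => congrFun h0 _,
    eq_zero_of_restrict (kasteleyn_mem κ α _ (extension_mem α h))⟩

instance finiteDimensional_quasiPeriodic (α : H1 n k) :
    FiniteDimensional ℂ (quasiPeriodic α) := by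
  let L : quasiPeriodic α →ₗ[ℂ] (Fin n → ℂ) :=
    { toFun := fun f j => (f : ℤ × ℤ → ℂ) ((j : ℕ), 0)
      map_add' := fun f g => rfl
      map_smul' := fun c f => rfl }
  refine FiniteDimensional.of_injective L ((injective_iff_map_eq_zero L).2 fun f hf => ?_)
  exact Subtype.ext (eq_zero_of_restrict f.2 fun j => congrFun hf j)

/-- For an endomorphism of a finite-dimensional space, failure of bijectivity is the existence of a
kernel vector. -/
theorem not_bijective_kasteleynOn_iff (κ : ZMod n → Fin 4 → ℂ) (α : H1 n k) :
    ¬ Function.Bijective (kasteleynOn κ α) ↔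
      ∃ f ∈ quasiPeriodic α, f ≠ 0 ∧ kasteleyn n k κ f = 0 := by
  have h : Function.Bijective (kasteleynOn κ α) ↔ Function.Injective (kasteleynOn κ α) :=
    ⟨fun h => h.1, fun h => ⟨h, LinearMap.injective_iff_surjective.1 h⟩⟩
  rw [h, injective_iff_map_eq_zero]
  push Not
  constructor
  · rintro ⟨f, hf, hf0⟩
    exact ⟨f, f.2, fun h0 => hf0 (Subtype.ext h0), congrArg Subtype.val hf⟩
  · rintro ⟨f, hf, hf0, hK⟩
    exact ⟨⟨f, hf⟩, Subtype.ext hK, fun h0 => hf0 (congrArg Subtype.val h0)⟩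

theorem eval_kdet_coord_eq_zero_iff (κ : ZMod n → Fin 4 → ℂ) (α : H1 n k) :
    α.eval (kdet k κ) = 0 ↔ ∃ f ∈ quasiPeriodic α, f ≠ 0 ∧ kasteleyn n k κ f = 0 := by
  rw [H1.eval, eval_kdet_eq_zero_iff]
  constructor
  · rintro ⟨h, h0, hK⟩
    refine ⟨_, extension_mem α h, fun he => h0 (funext fun j => ?_),
      (kasteleyn_eq_zero_iff κ α h).2 hK⟩
    rw [← extension_apply_coe α h j, he]
    rfl
  · rintro ⟨f, hf, hf0, hK⟩
    refine ⟨fun j => f ((j : ℕ), 0), fun h0 => hf0 (eq_zero_of_restrict hf fun j => congrFun h0 j),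
      (kasteleyn_eq_zero_iff κ α _).1 ?_⟩
    rwa [extension_restrict hf]

end KasteleynMatrix

/-! ### Points in general position and their spectral curves -/

section GeneralPosition

variable {n k : ℕ}

/-- Any three of the vectors are independent. -/
def GeneralPosition (A : ZMod n → Fin 3 → ℂ) : Prop :=
  ∀ i j l : ZMod n, i ≠ j → i ≠ l → j ≠ l → triple (A i) (A j) (A l) ≠ 0

theorem natCast_ne_of_lt {a b : ℕ} (ha : a < n) (hb : b < n) (hab : a ≠ b) :
    (a : ZMod n) ≠ b := fun h =>
  hab (by rwa [ZMod.natCast_eq_natCast_iff', Nat.mod_eq_of_lt ha, Nat.mod_eq_of_lt hb] at h)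

theorem whiteNbr_eq (v : ZMod n) (e : Fin 4) :
    whiteNbr n k v e = v + ![(0 : ZMod n), 1, k, k + 1] e := by
  unfold whiteNbr
  fin_cases e <;> simp [idx, offset, add_comm]

theorem blackNbr_eq (v : ZMod n) (e : Fin 4) :
    blackNbr n k v e = v - ![(0 : ZMod n), 1, k, k + 1] e := by
  unfold blackNbr
  fin_cases e <;> simp [idx, offset, add_comm]

theorem offsets_injective (hk : 2 ≤ k) (hkn : k + 2 ≤ n) :
    Function.Injective (![(0 : ZMod n), 1, k, k + 1] : Fin 4 → ZMod n) := by
  have h01 := natCast_ne_of_lt (n := n) (a := 0) (b := 1) (by omega) (by omega) (by omega)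
  have h0k := natCast_ne_of_lt (n := n) (a := 0) (b := k) (by omega) (by omega) (by omega)
  have h0k1 := natCast_ne_of_lt (n := n) (a := 0) (b := k + 1) (by omega) (by omega) (by omega)
  have h1k := natCast_ne_of_lt (n := n) (a := 1) (b := k) (by omega) (by omega) (by omega)
  have h1k1 := natCast_ne_of_lt (n := n) (a := 1) (b := k + 1) (by omega) (by omega) (by omega)
  have hkk1 := natCast_ne_of_lt (n := n) (a := k) (b := k + 1) (by omega) (by omega) (by omega)
  push_cast at h01 h0k h0k1 h1k h1k1 hkk1
  intro i j hij
  fin_cases i <;> fin_cases j <;> simp at hij <;> first | rfl | (exfalso; simp_all)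

theorem whiteNbr_injective (hk : 2 ≤ k) (hkn : k + 2 ≤ n) (v : ZMod n) :
    Function.Injective (whiteNbr n k v) := fun i j hij => by
  rw [whiteNbr_eq, whiteNbr_eq] at hij
  exact offsets_injective hk hkn (add_left_cancel hij)

theorem GeneralPosition.triple_ne_zero {A : ZMod n → Fin 3 → ℂ} (hA : GeneralPosition A)
    (hk : 2 ≤ k) (hkn : k + 2 ≤ n) (v : ZMod n) {a b c : Fin 4} (hab : a ≠ b) (hac : a ≠ c)
    (hbc : b ≠ c) : triple (A (whiteNbr n k v a)) (A (whiteNbr n k v b))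
      (A (whiteNbr n k v c)) ≠ 0 :=
  have h := whiteNbr_injective hk hkn v
  hA _ _ _ (h.ne hab) (h.ne hac) (h.ne hbc)

theorem GeneralPosition.isWhiteCircuit {A : ZMod n → Fin 3 → ℂ} (hA : GeneralPosition A)
    (hk : 2 ≤ k) (hkn : k + 2 ≤ n) {P : ProjTuple n} (hP : IsLift A P) : IsWhiteCircuit k P :=
  fun v => isCircuit_of_triple (fun e => hP (whiteNbr n k v e))
    (hA.triple_ne_zero hk hkn v (by decide) (by decide) (by decide))
    (hA.triple_ne_zero hk hkn v (by decide) (by decide) (by decide))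
    (hA.triple_ne_zero hk hkn v (by decide) (by decide) (by decide))
    (hA.triple_ne_zero hk hkn v (by decide) (by decide) (by decide))

/-- The weights are the signed 3 × 3 minors of the four vectors, nonzero by general position. -/
theorem GeneralPosition.exists_weights {A : ZMod n → Fin 3 → ℂ} (hA : GeneralPosition A)
    (hk : 2 ≤ k) (hkn : k + 2 ≤ n) : ∃ κ : ZMod n → Fin 4 → ℂ, IsKasteleynWeights k A κ := by
  refine ⟨fun v => ![triple (A (whiteNbr n k v 1)) (A (whiteNbr n k v 2)) (A (whiteNbr n k v 3)),
    -triple (A (whiteNbr n k v 0)) (A (whiteNbr n k v 2)) (A (whiteNbr n k v 3)),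
    triple (A (whiteNbr n k v 0)) (A (whiteNbr n k v 1)) (A (whiteNbr n k v 3)),
    -triple (A (whiteNbr n k v 0)) (A (whiteNbr n k v 1)) (A (whiteNbr n k v 2))],
    fun v e => ?_, fun v => ?_⟩
  · fin_cases e
    · exact hA.triple_ne_zero hk hkn v (by decide) (by decide) (by decide)
    · exact neg_ne_zero.2 (hA.triple_ne_zero hk hkn v (by decide) (by decide) (by decide))
    · exact hA.triple_ne_zero hk hkn v (by decide) (by decide) (by decide)
    · exact neg_ne_zero.2 (hA.triple_ne_zero hk hkn v (by decide) (by decide) (by decide))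
  · rw [Fin.sum_univ_four]
    simp only [Matrix.cons_val, neg_smul, ← sub_eq_add_neg]
    exact four_term_relation _ _ _ _

/-- Linear relations between four vectors of which three are independent are proportional. -/
theorem relation_unique {a b c d : Fin 3 → ℂ} (h : triple a b c ≠ 0) {x y : Fin 4 → ℂ}
    (hx : x 0 • a + x 1 • b + x 2 • c + x 3 • d = 0)
    (hy : y 0 • a + y 1 • b + y 2 • c + y 3 • d = 0) (hx3 : x 3 ≠ 0) :
    ∀ e, y e = (y 3 / x 3) * x e := by
  have hlin := linearIndependent_of_triple_ne_zero h
  rw [Fintype.linearIndependent_iff] at hlin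
  have := hlin ![y 0 - (y 3 / x 3) * x 0, y 1 - (y 3 / x 3) * x 1, y 2 - (y 3 / x 3) * x 2] (by
    simp only [Fin.sum_univ_three, Matrix.cons_val]
    funext i
    have hxi := congrFun hx i
    have hyi := congrFun hy i
    have hd := div_mul_cancel₀ (y 3) hx3
    simp only [Pi.add_apply, Pi.smul_apply, smul_eq_mul, Pi.zero_apply] at hxi hyi ⊢
    linear_combination hyi - (y 3 / x 3) * hxi + d i * hd)
  intro e
  have h0 := this 0
  have h1 := this 1
  have h2 := this 2
  simp only [Matrix.cons_val, sub_eq_zero] at h0 h1 h2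
  fin_cases e
  · exact h0
  · exact h1
  · exact h2
  · exact (div_mul_cancel₀ _ hx3).symm

theorem idx_add_offset (v : ℤ × ℤ) (e : Fin 4) :
    idx n k (v + offset e) = whiteNbr n k (idx n k v) e := map_add _ _ _

theorem idx_deck_add (γ : deck n k) (v : ℤ × ℤ) : idx n k (γ + v) = idx n k v := by
  rw [map_add, show idx n k γ = 0 from γ.2, zero_add]

/-- The spectral curve is the zero set of the determinant of the Kasteleyn matrix. -/
theorem mem_spectralCurve_iff [NeZero n] (hk : 2 ≤ k) (hkn : k + 2 ≤ n)
    {A : ZMod n → Fin 3 → ℂ} (hA : GeneralPosition A) {P : ProjTuple n} (hP : IsLift A P)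
    {κ : ZMod n → Fin 4 → ℂ} (hκ : IsKasteleynWeights k A κ) (α : H1 n k) :
    α ∈ spectralCurve n k P ↔ α.eval (kdet k κ) = 0 := by
  rw [eval_kdet_coord_eq_zero_iff]
  constructor
  · rintro ⟨A', κ', hA', hκ', hbij⟩
    obtain ⟨f, hf, hf0, hK⟩ := (not_bijective_kasteleynOn_iff κ' α).1 hbij
    obtain ⟨c, hc, rfl⟩ := hP.exists_smul hA'
    -- Rescaling the lifts by `c` multiplies the weights by `c⁻¹`, up to a factor at each black
    -- vertex, because the relation is unique; this is compensated by rescaling `f`.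
    refine ⟨fun v => (c (idx n k v))⁻¹ * f v, fun γ v => ?_, fun h0 => hf0 (funext fun v => ?_),
      funext fun v => ?_⟩
    · simp only [idx_deck_add, hf γ v]
      ring
    · exact (mul_eq_zero.1 (congrFun h0 v)).resolve_left (inv_ne_zero (hc _))
    · have hrel := relation_unique
        (hA.triple_ne_zero hk hkn (idx n k v) (a := 0) (b := 1) (c := 2) (by decide) (by decide)
          (by decide)) (x := κ (idx n k v))
        (y := fun e => κ' (idx n k v) e * c (whiteNbr n k (idx n k v) e))
        (by simpa [Fin.sum_univ_four] using hκ.2 (idx n k v))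
        (by simpa [Fin.sum_univ_four, smul_smul] using hκ'.2 (idx n k v)) (hκ.1 _ _)
      set t := κ' (idx n k v) 3 * c (whiteNbr n k (idx n k v) 3) / κ (idx n k v) 3 with ht
      have ht0 : t ≠ 0 := div_ne_zero (mul_ne_zero (hκ'.1 _ _) (hc _)) (hκ.1 _ _)
      have hKv : ∑ e, κ' (idx n k v) e * f (v + offset e) = 0 := congrFun hK v
      change ∑ e, κ (idx n k v) e * ((c (idx n k (v + offset e)))⁻¹ * f (v + offset e)) = 0
      rw [← mul_right_inj' ht0, mul_zero, Finset.mul_sum, ← hKv]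
      refine Finset.sum_congr rfl fun e _ => ?_
      rw [← mul_assoc, ← hrel e, idx_add_offset]
      field_simp [hc]
  · rintro ⟨f, hf, hf0, hK⟩
    exact ⟨A, κ, hP, hκ, (not_bijective_kasteleynOn_iff κ α).2 ⟨f, hf, hf0, hK⟩⟩

end GeneralPosition

/-! ### The boundary of the spectral curve -/

section Boundary

open Matrix

variable {n k : ℕ} {κ : ZMod n → Fin 4 → ℂ}

/-- The solution on the boundary `w = 0` of the spectral curve. -/
def boundarySolution (κ : ZMod n → Fin 4 → ℂ) (m : ℕ) : ℂ :=
  ∏ i ∈ Finset.range m, -(κ (i : ZMod n) 0 / κ (i : ZMod n) 1)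

theorem boundarySolution_ne_zero (hκ : ∀ v e, κ v e ≠ 0) (m : ℕ) : boundarySolution κ m ≠ 0 :=
  Finset.prod_ne_zero_iff.2 fun _ _ => neg_ne_zero.2 (div_ne_zero (hκ _ _) (hκ _ _))

theorem boundarySolution_succ (m : ℕ) : boundarySolution κ (m + 1)
    = boundarySolution κ m * -(κ (m : ZMod n) 0 / κ (m : ZMod n) 1) :=
  Finset.prod_range_succ _ _

/-- The ratios of weights are `n`-periodic, so the product over one period is the multiplier of the
sequence. It becomes the `z`-coordinate of `boundaryPoint`. -/
theorem boundarySolution_add (m : ℕ) :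
    boundarySolution κ (n + m) = boundarySolution κ n * boundarySolution κ m := by
  unfold boundarySolution
  rw [Finset.prod_range_add]
  simp

theorem boundarySolution_mul_add (q r : ℕ) :
    boundarySolution κ (n * q + r) = boundarySolution κ n ^ q * boundarySolution κ r := by
  induction q with
  | zero => simp
  | succ q ih =>
    rw [Nat.mul_succ, show n * q + n + r = n + (n * q + r) by ring, boundarySolution_add, ih]
    ring

theorem boundarySolution_div_mod (m : ℕ) : boundarySolution κ n ^ (m / n)
    * boundarySolution κ (m % n) = boundarySolution κ m := by
  rw [← boundarySolution_mul_add, Nat.div_add_mod]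

variable [NeZero n]

/-- The point of the closure of the spectral curve on the line `w = 0`. -/
def boundaryPoint (κ : ZMod n → Fin 4 → ℂ) : Fin 2 → ℂ := ![boundarySolution κ n, 0]

/-- The functional on the restriction to `0 ≤ j < n` of the boundary solution. -/
def boundaryPairing (κ : ZMod n → Fin 4 → ℂ) (r : Fin n → Poly) : ℂ :=
  pairing (boundaryPoint κ) r fun j => boundarySolution κ j

/-- Setting `w = 0` kills all sites of positive height; on the bottom row the wrap-around factor `z`
is exactly the multiplier of the boundary solution. -/
theorem boundaryPairing_site (a b : ℕ) : boundaryPairing κ (site n k a b)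
    = if b = 0 then boundarySolution κ a else 0 := by
  unfold boundaryPairing
  rw [pairing_site]
  split_ifs with hb
  · subst hb
    simp [boundaryPoint, boundarySolution_div_mod]
  · simp [boundaryPoint, hb]

/-- At `w = 0` only the two horizontal edges survive, leaving the recursion that defines
`boundarySolution`. -/
theorem boundaryPairing_kmatrix (hκ : ∀ v e, κ v e ≠ 0) (j : Fin n) :
    boundaryPairing κ (kmatrix k κ j) = 0 := by
  unfold boundaryPairing
  rw [pairing_kmatrix]
  have h := fun a b => boundaryPairing_site (κ := κ) (n := n) (k := k) a b
  unfold boundaryPairing at h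
  simp only [h, Fin.sum_univ_four, offsetNat, Matrix.cons_val, add_zero, if_true, one_ne_zero,
    if_false, mul_zero]
  rw [boundarySolution_succ]
  have := hκ ((j : ℕ) : ZMod n) 1
  field_simp
  ring

/-- This serves as a test: a functional with nonzero boundary pairing is not a combination of rows.
-/
theorem boundaryPairing_vecMul (hκ : ∀ v e, κ v e ≠ 0) (t : Fin n → Poly) :
    boundaryPairing κ (t ᵥ* kmatrix k κ) = 0 := by
  unfold boundaryPairing
  rw [pairing_vecMul]
  refine Finset.sum_eq_zero fun i _ => ?_
  rw [show pairing (boundaryPoint κ) (kmatrix k κ i) _ = 0 from boundaryPairing_kmatrix hκ i,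
    mul_zero]

theorem eval_boundaryPoint_kdet (hκ : ∀ v e, κ v e ≠ 0) :
    MvPolynomial.eval (boundaryPoint κ) (kdet k κ) = 0 :=
  (eval_kdet_eq_zero_iff κ _).2 ⟨fun j => boundarySolution κ j, fun h =>
    boundarySolution_ne_zero hκ _ (congrFun h 0), boundaryPairing_kmatrix hκ⟩

theorem eval_kmatrix (x : Fin 2 → ℂ) (i j : Fin n) : MvPolynomial.eval x (kmatrix k κ i j)
    = ∑ e : Fin 4, κ ((i : ℕ) : ZMod n) e * MvPolynomial.eval x
      (site n k ((i : ℕ) + (offsetNat e).1) (offsetNat e).2 j) := by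
  simp [kmatrix]

theorem eval_site (x : Fin 2 → ℂ) (a b : ℕ) (j : Fin n) : MvPolynomial.eval x (site n k a b j)
    = if (j : ℕ) = (a + k * b) % n then x 1 ^ b * x 0 ^ ((a + k * b) / n) else 0 := by
  unfold site
  split_ifs <;> simp

theorem kmatrixAt_bottom (z : ℂ) (i j : Fin n) : kmatrixAt k κ ![z, 0] i j =
    (if j = i then κ ((i : ℕ) : ZMod n) 0 else 0) +
      if (j : ℕ) = (i + 1) % n then κ ((i : ℕ) : ZMod n) 1 * z ^ (((i : ℕ) + 1) / n) else 0 := by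
  unfold kmatrixAt
  rw [Matrix.map_apply, eval_kmatrix]
  simp only [eval_site, Fin.sum_univ_four, offsetNat, Matrix.cons_val, mul_zero, add_zero,
    pow_zero, one_mul, pow_one, zero_mul, ite_self, Nat.mod_eq_of_lt i.2, Nat.div_eq_of_lt i.2,
    mul_ite, mul_one, Fin.ext_iff]

/-- At `w = 0` the matrix has a diagonal, a superdiagonal and one corner entry; the corner carries
the factor `z`, so at `z = 0` the matrix is upper triangular. -/
theorem eval_zero_kdet (hn : 2 ≤ n) : MvPolynomial.eval ![0, 0] (kdet k κ)
    = ∏ i : Fin n, κ ((i : ℕ) : ZMod n) 0 := by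
  rw [eval_kdet, Matrix.det_of_isUpperTriangular]
  · refine Finset.prod_congr rfl fun i _ => ?_
    rw [kmatrixAt_bottom, if_pos rfl, if_neg, add_zero]
    have := i.2
    rcases Nat.lt_or_ge (i + 1) n with h | h
    · rw [Nat.mod_eq_of_lt h]; omega
    · rw [show (i : ℕ) + 1 = n by omega, Nat.mod_self]; omega
  · intro i j hij
    have hij' : (j : ℕ) < i := hij
    rw [kmatrixAt_bottom, if_neg (by rintro rfl; exact lt_irrefl _ hij), zero_add]
    rcases Nat.lt_or_ge (i + 1) n with h | h
    · rw [if_neg]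
      rw [Nat.mod_eq_of_lt h]; omega
    · have := i.2
      rw [show (i : ℕ) + 1 = n by omega, Nat.div_self (NeZero.pos n)]
      simp

/-- At `w = 0` the variable `z` occurs in the last row only, and linearly; the determinant is linear
in that row. -/
theorem exists_eval_bottom_kdet (k : ℕ) (κ : ZMod n → Fin 4 → ℂ) :
    ∃ c : ℂ, ∀ z : ℂ, MvPolynomial.eval ![z, 0] (kdet k κ)
      = MvPolynomial.eval ![0, 0] (kdet k κ) + z * c := by
  have hlt : n - 1 < n := Nat.sub_lt (NeZero.pos n) one_pos
  set L : Fin n := ⟨n - 1, hlt⟩ with hL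
  set v : Fin n → ℂ := fun j => if (j : ℕ) = 0 then κ ((L : ℕ) : ZMod n) 1 else 0 with hv
  have hLn : (L : ℕ) + 1 = n := by
    have : (L : ℕ) = n - 1 := rfl
    omega
  refine ⟨((kmatrixAt k κ ![0, 0]).updateRow L v).det, fun z => ?_⟩
  have h : kmatrixAt k κ ![z, 0] = (kmatrixAt k κ ![0, 0]).updateRow L
      (kmatrixAt k κ ![0, 0] L + z • v) := by
    ext i j
    rcases eq_or_ne i L with rfl | hi
    · rw [Matrix.updateRow_self, Pi.add_apply, kmatrixAt_bottom, kmatrixAt_bottom, hLn,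
        Nat.div_self (NeZero.pos n), Nat.mod_self, Pi.smul_apply, hv]
      simp only [pow_one, smul_eq_mul]
      split_ifs <;> ring
    · rw [Matrix.updateRow_ne hi, kmatrixAt_bottom, kmatrixAt_bottom, Nat.div_eq_of_lt]
      · simp
      · have h1 := i.2
        have h2 : (i : ℕ) ≠ L := fun h => hi (Fin.ext h)
        omega
  rw [eval_kdet, eval_kdet, h, Matrix.det_updateRow_add, Matrix.det_updateRow_smul,
    Matrix.updateRow_eq_self]

/-- The restriction of a polynomial to the line `w = 0`. -/
def restrictBottom : Poly →+* Polynomial ℂ :=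
  (MvPolynomial.aeval ![Polynomial.X, 0] : Poly →ₐ[ℂ] Polynomial ℂ).toRingHom

theorem eval_restrictBottom (z : ℂ) (p : Poly) :
    (restrictBottom p).eval z = MvPolynomial.eval ![z, 0] p := by
  induction p using MvPolynomial.induction_on with
  | C a => simp [restrictBottom]
  | add p q hp hq => simp only [map_add, Polynomial.eval_add, hp, hq]
  | mul_X p i hp =>
    simp only [map_mul, Polynomial.eval_mul, hp]
    congr 1
    fin_cases i <;> simp [restrictBottom]

/-- The restriction is `c * z + c₀` with `c₀ ≠ 0`. It has a root, the boundary point, which forces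
`c ≠ 0`. -/
theorem irreducible_restrictBottom_kdet (hn : 2 ≤ n) (hκ : ∀ v e, κ v e ≠ 0) :
    Irreducible (restrictBottom (kdet k κ)) := by
  obtain ⟨c, hc⟩ := exists_eval_bottom_kdet k κ
  set c₀ := MvPolynomial.eval ![0, 0] (kdet k κ) with hc₀
  have hc0 : c₀ ≠ 0 := by
    rw [hc₀, eval_zero_kdet hn]
    exact Finset.prod_ne_zero_iff.2 fun i _ => hκ _ _
  have h : restrictBottom (kdet k κ) = Polynomial.C c * Polynomial.X + Polynomial.C c₀ :=
    Polynomial.funext fun z => by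
      rw [eval_restrictBottom, hc]
      simp
      ring
  have hc1 : c ≠ 0 := by
    rintro rfl
    have := hc (boundarySolution κ n)
    rw [show ![boundarySolution κ n, 0] = boundaryPoint κ from rfl,
      eval_boundaryPoint_kdet hκ, mul_zero, add_zero] at this
    exact hc0 this.symm
  refine Polynomial.irreducible_of_degree_eq_one ?_
  rw [h]
  exact Polynomial.degree_linear hc1

/-- The determinant does not vanish at the origin. -/
theorem not_X_dvd_kdet (hn : 2 ≤ n) (hκ : ∀ v e, κ v e ≠ 0) (i : Fin 2) :
    ¬ (MvPolynomial.X i ∣ kdet k κ) := by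
  rintro ⟨q, hq⟩
  have h := eval_zero_kdet (k := k) (κ := κ) hn
  rw [hq, map_mul, MvPolynomial.eval_X] at h
  have h0 : (![0, 0] : Fin 2 → ℂ) i = 0 := by fin_cases i <;> rfl
  rw [h0, zero_mul] at h
  exact Finset.prod_ne_zero_iff.2 (fun i _ => hκ _ _) h.symm

end Boundary

/-! ### Irreducibility of the determinant -/

section Irreducibility

variable {n k : ℕ}

/-- The zero set of a polynomial in `H¹(T², ℂˣ)`. -/
def zeroSet (n k : ℕ) (p : Poly) : Set (H1 n k) := {α | α.eval p = 0}

theorem isClosed_zeroSet (p : Poly) : IsClosed (zeroSet n k p) := by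
  have : zeroSet n k p = (basicOpen n k p)ᶜ := by
    ext α
    simp [zeroSet, basicOpen]
  rw [this]
  exact (isOpen_basicOpen p).isClosed_compl

variable [NeZero n] {κ : ZMod n → Fin 4 → ℂ}

/-- The Nullstellensatz in the plane; the factor `X 0 * X 1` takes care of zeros of `p` on the axes,
which lie outside the torus. -/
theorem exists_dvd_pow_of_mem_idealOf {p q : Poly} (h : q ∈ idealOf (zeroSet n k p)) :
    ∃ N : ℕ, p ∣ (MvPolynomial.X 0 * MvPolynomial.X 1 * q) ^ N := by
  have hmem : MvPolynomial.X 0 * MvPolynomial.X 1 * q ∈ MvPolynomial.vanishingIdeal ℂ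
      (MvPolynomial.zeroLocus ℂ (Ideal.span {p})) := by
    intro x hx
    have hae : ∀ r, MvPolynomial.aeval x r = MvPolynomial.eval x r := fun r =>
      RingHom.congr_fun (MvPolynomial.coe_aeval_eq_eval x) r
    have hxp : MvPolynomial.eval x p = 0 :=
      (hae p).symm.trans (hx p (Ideal.mem_span_singleton_self p))
    rw [hae]
    simp only [map_mul, MvPolynomial.eval_X]
    by_cases h0 : x 0 = 0
    · simp [h0]
    by_cases h1 : x 1 = 0
    · simp [h1]
    have hcoord : (H1.ofCoord n k (x 0) (x 1) h0 h1).coord = x := by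
      unfold H1.coord
      rw [H1.ofCoord_z, H1.ofCoord_w]
      ext i
      fin_cases i <;> rfl
    have := h (H1.ofCoord n k (x 0) (x 1) h0 h1) (by
      change MvPolynomial.eval _ p = 0
      rwa [hcoord])
    rw [H1.eval, hcoord] at this
    rw [this, mul_zero]
  rw [MvPolynomial.vanishingIdeal_zeroLocus_eq_radical] at hmem
  obtain ⟨N, hN⟩ := hmem
  exact ⟨N, Ideal.mem_span_singleton.1 hN⟩

theorem dvd_of_dvd_X_mul {p q : Poly} {i : Fin 2} (hp : ¬ MvPolynomial.X i ∣ p)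
    (h : p ∣ MvPolynomial.X i * q) : p ∣ q := by
  obtain ⟨r, hr⟩ := h
  have hX : Prime (MvPolynomial.X i : Poly) := MvPolynomial.X_prime
  obtain ⟨s, rfl⟩ := (hX.dvd_or_dvd (⟨q, hr.symm⟩ : MvPolynomial.X i ∣ p * r)).resolve_left hp
  exact ⟨s, mul_left_cancel₀ hX.ne_zero (by rw [hr]; ring)⟩

theorem dvd_of_dvd_X_pow_mul {p q : Poly} {i : Fin 2} (hp : ¬ MvPolynomial.X i ∣ p) (N : ℕ)
    (h : p ∣ MvPolynomial.X i ^ N * q) : p ∣ q := by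
  induction N with
  | zero => simpa using h
  | succ N ih =>
    rw [pow_succ', mul_assoc] at h
    exact ih (dvd_of_dvd_X_mul hp h)

theorem exists_kdet_dvd_pow (hn : 2 ≤ n) (hκ : ∀ v e, κ v e ≠ 0) {q : Poly}
    (h : q ∈ idealOf (zeroSet n k (kdet k κ))) : ∃ N : ℕ, kdet k κ ∣ q ^ N := by
  obtain ⟨N, hN⟩ := exists_dvd_pow_of_mem_idealOf h
  refine ⟨N, ?_⟩
  rw [mul_pow, mul_pow, mul_assoc] at hN
  exact dvd_of_dvd_X_pow_mul (not_X_dvd_kdet hn hκ 1) N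
    (dvd_of_dvd_X_pow_mul (not_X_dvd_kdet hn hκ 0) N hN)

/-- Applied to the restriction to `w = 0`, this selects the factor of the determinant that passes
through the boundary point. -/
theorem exists_irreducible_factor_map_not_isUnit {R T : Type*} [CommRing R] [IsDomain R]
    [WfDvdMonoid R] [CommRing T] (φ : R →+* T) (x : R) (hx : x ≠ 0) (hu : ¬ IsUnit (φ x)) :
    ∃ p, Irreducible p ∧ p ∣ x ∧ ¬ IsUnit (φ p) := by
  induction x using WfDvdMonoid.induction_on_irreducible with
  | zero => exact absurd rfl hx
  | unit u hu' => exact absurd (hu'.map φ) hu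
  | mul a i ha hi ih =>
    by_cases h : IsUnit (φ i)
    · obtain ⟨p, hp, hpa, hpu⟩ := ih ha fun h' => hu (by rw [map_mul]; exact h.mul h')
      exact ⟨p, hp, hpa.mul_left i, hpu⟩
    · exact ⟨i, hi, dvd_mul_right _ _, h⟩

/-- If the spectral curve is irreducible, then so is its equation. -/
theorem irreducible_kdet (hn : 2 ≤ n) (hκ : ∀ v e, κ v e ≠ 0)
    (hS : IsIrreducible (zeroSet n k (kdet k κ))) : Irreducible (kdet k κ) := by
  have hirr := irreducible_restrictBottom_kdet (k := k) hn hκ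
  have hne : kdet k κ ≠ 0 := fun h => hirr.ne_zero (by rw [h, map_zero])
  obtain ⟨p, hp, ⟨g, hg⟩, hpu⟩ := exists_irreducible_factor_map_not_isUnit restrictBottom
    (kdet k κ) hne hirr.not_isUnit
  have hgu : IsUnit (restrictBottom g) := by
    have := hirr.isUnit_or_isUnit (a := restrictBottom p) (b := restrictBottom g)
      (by rw [← map_mul, hg])
    exact this.resolve_left hpu
  have hI := idealOf_isPrime hS
  have hmem : p * g ∈ idealOf (zeroSet n k (kdet k κ)) := hg ▸ fun α hα => hα
  have hunit : IsUnit g := by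
    -- If `p` vanishes on the curve, every irreducible factor of `g` is associated to `p`, whose
    -- restriction is not a unit, while that of `g` is. If `g` vanishes on the curve, `kdet` divides
    -- a power of `g`, so its restriction would be a unit.
    rcases hI.mem_or_mem hmem with h | h
    · obtain ⟨N, hN⟩ := exists_kdet_dvd_pow hn hκ h
      by_contra hgn
      have hg0 : g ≠ 0 := fun h => hne (by rw [hg, h, mul_zero])
      obtain ⟨r, hr, hrg⟩ := WfDvdMonoid.exists_irreducible_factor hgn hg0
      have hrp : r ∣ p := hr.prime.dvd_of_dvd_pow
        (hrg.trans ((Dvd.intro_left p hg.symm).trans hN))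
      have hpr : p ∣ r := (hr.associated_of_dvd hp hrp).symm.dvd
      exact hpu (isUnit_of_dvd_unit (map_dvd restrictBottom (hpr.trans hrg)) hgu)
    · obtain ⟨N, hN⟩ := exists_kdet_dvd_pow hn hκ h
      have := map_dvd restrictBottom hN
      rw [map_pow] at this
      exact absurd (isUnit_of_dvd_unit this (hgu.pow N)) hirr.not_isUnit
  rw [hg, irreducible_mul_isUnit hunit]
  exact hp

theorem mem_idealOf_kdet_iff (hn : 2 ≤ n) (hκ : ∀ v e, κ v e ≠ 0)
    (hS : IsIrreducible (zeroSet n k (kdet k κ))) {q : Poly} :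
    q ∈ idealOf (zeroSet n k (kdet k κ)) ↔ kdet k κ ∣ q := by
  constructor
  · intro h
    obtain ⟨N, hN⟩ := exists_kdet_dvd_pow hn hκ h
    exact (irreducible_kdet hn hκ hS).prime.dvd_of_dvd_pow hN
  · rintro ⟨r, rfl⟩ α hα
    rw [map_mul, show α.eval (kdet k κ) = 0 from hα, zero_mul]

/-- If `β` were the only point, `kdet` would divide `w - β.w`, whose restriction to `w = 0` is a
nonzero constant. -/
theorem exists_ne_of_isIrreducible (hn : 2 ≤ n) (hκ : ∀ v e, κ v e ≠ 0)
    (hS : IsIrreducible (zeroSet n k (kdet k κ))) (β : H1 n k) :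
    ∃ α ∈ zeroSet n k (kdet k κ), α ≠ β := by
  by_contra hcon
  push Not at hcon
  have hmem : MvPolynomial.X 1 - MvPolynomial.C β.w ∈ idealOf (zeroSet n k (kdet k κ)) := by
    intro α hα
    rw [hcon α hα]
    simp
  have hdvd := map_dvd restrictBottom ((mem_idealOf_kdet_iff hn hκ hS).1 hmem)
  refine (irreducible_restrictBottom_kdet (k := k) hn hκ).not_isUnit (isUnit_of_dvd_unit hdvd ?_)
  have : restrictBottom (MvPolynomial.X 1 - MvPolynomial.C β.w) = Polynomial.C (-β.w) :=
    Polynomial.funext fun z => by rw [eval_restrictBottom]; simp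
  rw [this, Polynomial.isUnit_C]
  exact (neg_ne_zero.2 β.w_ne_zero).isUnit

/-- An irreducible spectral curve is one-dimensional. -/
theorem topologicalKrullDim_zeroSet_kdet (hn : 2 ≤ n) (hκ : ∀ v e, κ v e ≠ 0)
    (hS : IsIrreducible (zeroSet n k (kdet k κ))) :
    topologicalKrullDim (zeroSet n k (kdet k κ)) = 1 := by
  set Δ := kdet k κ with hΔ
  set S := zeroSet n k Δ with hSdef
  have hclosed : ∀ Z : TopologicalSpace.IrreducibleCloseds S,
      IsClosed (Subtype.val '' (Z : Set S)) := fun Z =>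
    (isClosed_zeroSet Δ).isClosedEmbedding_subtypeVal.isClosedMap _ Z.isClosed
  have hirr : ∀ Z : TopologicalSpace.IrreducibleCloseds S,
      IsIrreducible (Subtype.val '' (Z : Set S)) := fun Z =>
    Z.isIrreducible.image _ continuous_subtype_val.continuousOn
  have hker : ∀ Z : TopologicalSpace.IrreducibleCloseds S,
      RingHom.ker (Ideal.Quotient.mk (Ideal.span {Δ})) ≤ idealOf (Subtype.val '' (Z : Set S)) := by
    intro Z
    rw [Ideal.mk_ker, Ideal.span_singleton_le_iff_mem]
    rintro _ ⟨α, -, rfl⟩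
    exact α.2
  refine le_antisymm ?_ ?_
  -- Upper bound: chains of irreducible closed sets give chains of primes of `ℂ[z, w]/(Δ)`, whose
  -- dimension is at most `2 - 1` because `Δ` is not a zero divisor.
  · let φ : TopologicalSpace.IrreducibleCloseds S →
        (PrimeSpectrum (Poly ⧸ Ideal.span {Δ}))ᵒᵈ := fun Z =>
      OrderDual.toDual ⟨(idealOf (Subtype.val '' (Z : Set S))).map (Ideal.Quotient.mk _),
        have := idealOf_isPrime (hirr Z)
        Ideal.map_isPrime_of_surjective Ideal.Quotient.mk_surjective (hker Z)⟩
    have hφ : StrictMono φ := by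
      intro Z Y hZY
      have hss : Subtype.val '' (Z : Set S) ⊂ Subtype.val '' (Y : Set S) :=
        Subtype.val_injective.image_strictMono hZY
      have hlt := idealOf_lt (hclosed Z) hss
      change (⟨_, _⟩ : PrimeSpectrum (Poly ⧸ Ideal.span {Δ})) < ⟨_, _⟩
      rw [← PrimeSpectrum.asIdeal_lt_asIdeal]
      refine lt_of_le_of_ne (Ideal.map_mono hlt.le) fun heq => hlt.ne ?_
      have := congrArg (Ideal.comap (Ideal.Quotient.mk (Ideal.span {Δ}))) heq
      simp only at this
      rwa [Ideal.comap_map_of_surjective' _ Ideal.Quotient.mk_surjective,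
        Ideal.comap_map_of_surjective' _ Ideal.Quotient.mk_surjective,
        sup_eq_left.2 (hker Z), sup_eq_left.2 (hker Y)] at this
    have h1 : topologicalKrullDim S ≤ ringKrullDim (Poly ⧸ Ideal.span {Δ}) := by
      refine (Order.krullDim_le_of_strictMono φ hφ).trans ?_
      rw [Order.krullDim_orderDual]
      rfl
    have h2 : ringKrullDim (Poly ⧸ Ideal.span {Δ}) + 1 ≤ ringKrullDim Poly :=
      ringKrullDim_quotient_succ_le_of_nonZeroDivisor
        (mem_nonZeroDivisors_of_ne_zero (irreducible_kdet hn hκ hS).ne_zero)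
    rw [MvPolynomial.ringKrullDim_of_isNoetherianRing, ringKrullDim_eq_zero_of_field,
      Nat.card_eq_fintype_card, Fintype.card_fin, zero_add] at h2
    refine h1.trans ?_
    generalize ringKrullDim (Poly ⧸ Ideal.span {Δ}) = d at h2
    rw [show ((2 : ℕ) : WithBot ℕ∞) = 1 + 1 by norm_num] at h2
    exact (ENat.WithBot.add_le_add_one_right_iff).1 h2
  -- Lower bound: a point is strictly contained in the irreducible curve.
  · rw [topologicalKrullDim, Order.one_le_krullDim_iff]
    obtain ⟨β, hβ⟩ := hS.1
    obtain ⟨α, hα, hαβ⟩ := exists_ne_of_isIrreducible hn hκ hS β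
    refine ⟨⟨{⟨β, hβ⟩}, isIrreducible_singleton, ?_⟩, ⟨Set.univ, ?_, isClosed_univ⟩, ?_⟩
    · have := (isClosed_singleton β).preimage (continuous_subtype_val (p := (· ∈ S)))
      convert this
      ext x
      simp [Subtype.ext_iff]
    · have := Subtype.irreducibleSpace hS
      exact IrreducibleSpace.isIrreducible_univ S
    · refine lt_of_le_of_ne (fun x _ => Set.mem_univ x) fun heq => hαβ ?_
      have hmem : (⟨α, hα⟩ : S) ∈ ({⟨β, hβ⟩} : Set S) := by
        rw [show ({⟨β, hβ⟩} : Set S) = Set.univ from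
          congrArg TopologicalSpace.IrreducibleCloseds.carrier heq]
        exact Set.mem_univ _
      exact congrArg Subtype.val hmem

end Irreducibility

/-! ### Functionals that vanish on the kernel along the spectral curve -/

section RowSpace

open Matrix

variable {n k : ℕ} {κ : ZMod n → Fin 4 → ℂ}

/-- If a functional vanishes on all columns of the adjugate modulo the determinant, then it is
a combination of rows. -/
theorem exists_vecMul_of_dvd {M : Matrix (Fin n) (Fin n) Poly} (hM : M.det ≠ 0)
    {r : Fin n → Poly} (h : ∀ v, M.det ∣ (r ᵥ* M.adjugate) v) : ∃ t, r = t ᵥ* M := by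
  choose t ht using h
  refine ⟨t, ?_⟩
  have h1 : r ᵥ* M.adjugate = M.det • t := funext ht
  -- Multiply by `M` on the right, use `adj M * M = det M`, and cancel `det M`.
  have h2 : M.det • r = M.det • (t ᵥ* M) := by
    rw [← Matrix.smul_vecMul, ← h1, Matrix.vecMul_vecMul, Matrix.adjugate_mul,
      Matrix.vecMul_smul, Matrix.vecMul_one]
  exact smul_right_injective _ hM h2

theorem pairing_adjugate (x : Fin 2 → ℂ) (M : Matrix (Fin n) (Fin n) Poly) (r : Fin n → Poly)
    (v : Fin n) : pairing x r (fun j => MvPolynomial.eval x (M.adjugate j v))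
      = MvPolynomial.eval x ((r ᵥ* M.adjugate) v) := by
  simp only [pairing, Matrix.vecMul, dotProduct, map_sum, map_mul]

theorem pairing_row_adjugate {x : Fin 2 → ℂ} (M : Matrix (Fin n) (Fin n) Poly)
    (hx : MvPolynomial.eval x M.det = 0) (i v : Fin n) :
    pairing x (M i) (fun j => MvPolynomial.eval x (M.adjugate j v)) = 0 := by
  rw [pairing_adjugate]
  have : (M i ᵥ* M.adjugate) v = (M * M.adjugate) i v := rfl
  rw [this, Matrix.mul_adjugate, Matrix.smul_apply, smul_eq_mul, map_mul, hx, zero_mul]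

/-- Where a minor does not vanish, the solutions are determined by one of their values. -/
theorem eq_zero_of_adjugate_ne_zero {x : Fin 2 → ℂ} (M : Matrix (Fin n) (Fin n) Poly)
    {i v : Fin n} (hiv : MvPolynomial.eval x (M.adjugate i v) ≠ 0) {h : Fin n → ℂ}
    (hh : ∀ j, pairing x (M j) h = 0) (hi : h i = 0) : h = 0 := by
  by_contra hne
  -- This entry of the adjugate is the determinant of `M` with row `v` replaced by the `i`-th
  -- coordinate functional, and that matrix annihilates `h`.
  rw [Matrix.adjugate_apply, RingHom.map_det] at hiv
  refine hiv (Matrix.exists_mulVec_eq_zero_iff.1 ⟨h, hne, funext fun j => ?_⟩)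
  rcases eq_or_ne j v with rfl | hj
  · simp only [Matrix.mulVec, dotProduct, RingHom.mapMatrix_apply, Matrix.map_apply,
      Matrix.updateRow_self, Pi.zero_apply]
    rw [Finset.sum_eq_single i]
    · rw [hi, mul_zero]
    · intro b _ hb
      rw [Pi.single_eq_of_ne hb, map_zero, zero_mul]
    · simp
  · simp only [Matrix.mulVec, dotProduct, RingHom.mapMatrix_apply, Matrix.map_apply,
      Matrix.updateRow_ne hj, Pi.zero_apply]
    exact hh j

/-! ### The Kasteleyn matrix as a pencil in `w`, and generic kernels. -/

variable [NeZero n]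

/-- The functional on sequences with `g (m + n) = z g m`, in terms of their values at
`0 ≤ j < n`, that takes the value at `m`. -/
def seqSite (n : ℕ) (z : ℂ) (m : ℕ) (j : Fin n) : ℂ := if (j : ℕ) = m % n then z ^ (m / n) else 0

/-- The sequence with `g (m + n) = z g m` and given values at `0 ≤ j < n`. -/
def seqExtension (z : ℂ) (h : Fin n → ℂ) (m : ℕ) : ℂ :=
  z ^ (m / n) * h ⟨m % n, Nat.mod_lt _ (NeZero.pos n)⟩

theorem sum_seqSite_mul (z : ℂ) (m : ℕ) (h : Fin n → ℂ) :
    ∑ j, seqSite n z m j * h j = seqExtension z h m := by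
  rw [Finset.sum_eq_single ⟨m % n, Nat.mod_lt _ (NeZero.pos n)⟩]
  · simp [seqSite, seqExtension]
  · intro j _ hj
    rw [seqSite, if_neg fun h => hj (Fin.ext h), zero_mul]
  · simp

theorem seqExtension_add (z : ℂ) (h : Fin n → ℂ) (m : ℕ) :
    seqExtension z h (m + n) = z * seqExtension z h m := by
  unfold seqExtension
  rw [Nat.add_div_right _ (NeZero.pos n), pow_succ]
  simp only [Nat.add_mod_right]
  ring

theorem seqExtension_coe (z : ℂ) (h : Fin n → ℂ) (j : Fin n) : seqExtension z h j = h j := by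
  unfold seqExtension
  rw [Nat.div_eq_of_lt j.2, pow_zero, one_mul]
  congr 1
  exact Fin.ext (Nat.mod_eq_of_lt j.2)

/-- The coefficient of `w` in the Kasteleyn matrix. -/
def topMatrix (k : ℕ) (κ : ZMod n → Fin 4 → ℂ) (z : ℂ) : Matrix (Fin n) (Fin n) ℂ := fun i j =>
  κ ((i : ℕ) : ZMod n) 2 * seqSite n z (i + k) j + κ ((i : ℕ) : ZMod n) 3 * seqSite n z (i + 1 + k) j

/-- The constant coefficient in `w` of the Kasteleyn matrix. -/
def bottomMatrix (κ : ZMod n → Fin 4 → ℂ) (z : ℂ) : Matrix (Fin n) (Fin n) ℂ := fun i j =>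
  κ ((i : ℕ) : ZMod n) 0 * seqSite n z i j + κ ((i : ℕ) : ZMod n) 1 * seqSite n z (i + 1) j

/-- A kernel vector extends to a sequence with multiplier `z` that satisfies a two-term recursion,
whose multiplier over a period is `p n`. Any `z` other than `0` and `p n` therefore works. -/
theorem exists_det_topMatrix_ne_zero (hκ : ∀ v e, κ v e ≠ 0) (hk : k ≤ n) :
    ∃ z, (topMatrix k κ z).det ≠ 0 := by
  set p : ℕ → ℂ := fun m => ∏ i ∈ Finset.range m, -(κ (i : ZMod n) 2 / κ (i : ZMod n) 3) with hp
  obtain ⟨z, hz⟩ := Set.Infinite.nonempty (Set.Finite.infinite_compl (Set.toFinite {0, p n}))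
  have hz0 : z ≠ 0 := fun h => hz (by simp [h])
  have hzp : z ≠ p n := fun h => hz (by simp [h])
  refine ⟨z, fun hdet => ?_⟩
  obtain ⟨h, hne, hh⟩ := Matrix.exists_mulVec_eq_zero_iff.2 hdet
  have hrec : ∀ i < n, seqExtension z h (i + 1 + k)
      = -(κ (i : ZMod n) 2 / κ (i : ZMod n) 3) * seqExtension z h (i + k) := by
    intro i hi
    have := congrFun hh ⟨i, hi⟩
    simp only [Matrix.mulVec, dotProduct, topMatrix, add_mul, Finset.sum_add_distrib, mul_assoc,
      ← Finset.mul_sum, sum_seqSite_mul, Pi.zero_apply] at this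
    have h3 := hκ i 3
    field_simp
    linear_combination this
  have hsol : ∀ m ≤ n, seqExtension z h (m + k) = p m * seqExtension z h k := by
    intro m hm
    induction m with
    | zero => simp [hp]
    | succ m ih =>
      rw [hrec m (by omega), ih (by omega)]
      simp only [hp, Finset.prod_range_succ]
      ring
  have hk0 : seqExtension z h k = 0 := by
    have h1 := hsol n le_rfl
    rw [add_comm, seqExtension_add] at h1
    have h2 : (z - p n) * seqExtension z h k = 0 := by linear_combination h1
    exact (mul_eq_zero.1 h2).resolve_left (sub_ne_zero.2 hzp)
  have hall : ∀ m ≤ n, seqExtension z h (m + k) = 0 := fun m hm => by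
    rw [hsol m hm, hk0, mul_zero]
  refine hne (funext fun j => ?_)
  rcases Nat.lt_or_ge j k with hj | hj
  · have h1 := hall (j + n - k) (by omega)
    rw [show (j : ℕ) + n - k + k = j + n by omega, seqExtension_add, seqExtension_coe] at h1
    exact (mul_eq_zero.1 h1).resolve_left hz0
  · have h1 := hall (j - k) (by omega)
    rwa [Nat.sub_add_cancel hj, seqExtension_coe] at h1

/-- Substitution of a number for `z`. -/
def restrictVertical (z : ℂ) : Poly →+* Polynomial ℂ :=
  (MvPolynomial.aeval ![Polynomial.C z, Polynomial.X] : Poly →ₐ[ℂ] Polynomial ℂ).toRingHom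

theorem restrictVertical_C (z c : ℂ) :
    restrictVertical z (MvPolynomial.C c) = Polynomial.C c := by
  simp [restrictVertical]

theorem restrictVertical_site (z : ℂ) (a b : ℕ) (j : Fin n) :
    restrictVertical z (site n k a b j)
      = Polynomial.X ^ b * Polynomial.C (seqSite n z (a + k * b) j) := by
  unfold site seqSite
  split_ifs <;> simp [restrictVertical]

theorem restrictVertical_kmatrix (z : ℂ) (i j : Fin n) :
    restrictVertical z (kmatrix k κ i j) = Polynomial.C (bottomMatrix κ z i j)
      + Polynomial.X * Polynomial.C (topMatrix k κ z i j) := by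
  simp only [kmatrix, Finset.sum_apply, Pi.smul_apply, smul_eq_mul, map_mul,
    restrictVertical_C, restrictVertical_site, Fin.sum_univ_four, offsetNat, Matrix.cons_val,
    bottomMatrix, topMatrix, map_add, mul_zero, add_zero, mul_one, pow_zero, pow_one, one_mul]
  ring

/-- For generic `z`, a nonzero functional whose coefficients do not depend on `w` is not a
combination of the rows of the Kasteleyn matrix. -/
theorem exists_eq_zero_of_const_eq_vecMul (hκ : ∀ v e, κ v e ≠ 0) (hk : k ≤ n) :
    ∃ z : ℂ, ∀ (t : Fin n → Poly) (c : Fin n → ℂ),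
      (∀ j, restrictVertical z ((t ᵥ* kmatrix k κ) j) = Polynomial.C (c j)) → c = 0 := by
  obtain ⟨z, hz⟩ := exists_det_topMatrix_ne_zero hκ hk
  refine ⟨z, fun t c h => ?_⟩
  set s : Fin n → Polynomial ℂ := fun i => restrictVertical z (t i) with hs
  have hj : ∀ j, Polynomial.C (c j) = ∑ i, (s i * Polynomial.C (bottomMatrix κ z i j)
      + s i * Polynomial.C (topMatrix k κ z i j) * Polynomial.X) := by
    intro j
    rw [← h j, Matrix.vecMul, dotProduct, map_sum]
    refine Finset.sum_congr rfl fun i _ => ?_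
    rw [map_mul, restrictVertical_kmatrix]
    ring
  -- In degree `d + 1` the constant `c j` contributes nothing, so once the coefficients of `s` in
  -- degree `d + 1` vanish, those in degree `d` are killed by the invertible top matrix. Descending
  -- induction then gives `s = 0`.
  have hstep : ∀ d, (∀ i, (s i).coeff (d + 1) = 0) → ∀ i, (s i).coeff d = 0 := by
    intro d hd
    have hv : (fun i => (s i).coeff d) ᵥ* topMatrix k κ z = 0 := by
      funext j
      have := congrArg (fun q => Polynomial.coeff q (d + 1)) (hj j)
      simp only [Polynomial.coeff_C_succ, Polynomial.finsetSum_coeff, Polynomial.coeff_add,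
        Polynomial.coeff_mul_C, Polynomial.coeff_mul_X, hd, zero_mul, zero_add] at this
      exact this.symm
    by_contra hcon
    exact hz (Matrix.exists_vecMul_eq_zero_iff.1 ⟨_, fun h0 => hcon fun i => congrFun h0 i, hv⟩)
  set D := ∑ i, (s i).natDegree with hD
  have hbig : ∀ d, D < d → ∀ i, (s i).coeff d = 0 := fun d hd i =>
    Polynomial.coeff_eq_zero_of_natDegree_lt
      (lt_of_le_of_lt (Finset.single_le_sum (f := fun i => (s i).natDegree)
        (fun _ _ => Nat.zero_le _) (Finset.mem_univ i)) hd)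
  have hall : ∀ m d, D < d + m → ∀ i, (s i).coeff d = 0 := by
    intro m
    induction m with
    | zero => exact hbig
    | succ m ih => exact fun d hd => hstep d (ih (d + 1) (by omega))
  have hs0 : ∀ i, s i = 0 := fun i => Polynomial.ext fun d => by
    rw [hall (D + 1) d (by omega) i, Polynomial.coeff_zero]
  funext j
  have := hj j
  simp only [hs0, zero_mul, add_zero, Finset.sum_const_zero] at this
  exact Polynomial.C_eq_zero.1 this

/-- On a nonempty open subset of an irreducible spectral curve the kernel is one-dimensional,
is spanned by a vector with polynomial coordinates, and given functionals that are not
combinations of rows do not vanish on it. -/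
theorem exists_generic_kernel (hn : 2 ≤ n) (hκ : ∀ v e, κ v e ≠ 0)
    (hS : IsIrreducible (zeroSet n k (kdet k κ))) {ι : Type*} [Fintype ι]
    (r : ι → Fin n → Poly) (hr : ∀ s t, r s ≠ t ᵥ* kmatrix k κ) :
    ∃ (H : Poly) (h : Fin n → Poly),
      (∃ α ∈ zeroSet n k (kdet k κ), α.eval H ≠ 0) ∧
      ∀ α ∈ zeroSet n k (kdet k κ), α.eval H ≠ 0 →
        (∀ j, pairing α.coord (kmatrix k κ j) (fun i => α.eval (h i)) = 0) ∧
        (∀ h' : Fin n → ℂ, (∀ j, pairing α.coord (kmatrix k κ j) h' = 0) →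
          ∃ c : ℂ, ∀ j, h' j = c * α.eval (h j)) ∧
        ∀ s, pairing α.coord (r s) (fun i => α.eval (h i)) ≠ 0 := by
  set M := kmatrix k κ with hM
  have hirr := irreducible_kdet hn hκ hS
  have hdet : M.det ≠ 0 := hirr.ne_zero
  have hex : ∀ s, ∃ v, ¬ M.det ∣ (r s ᵥ* M.adjugate) v := by
    intro s
    by_contra hcon
    push Not at hcon
    obtain ⟨t, ht⟩ := exists_vecMul_of_dvd hdet hcon
    exact hr s t ht
  choose v hv using hex
  -- The first coordinate functional is not a combination of rows, since the boundary solution has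
  -- first entry `1` (an empty product).
  obtain ⟨v₀, hv₀⟩ : ∃ v₀, ¬ M.det ∣ M.adjugate 0 v₀ := by
    by_contra hcon
    push Not at hcon
    obtain ⟨t, ht⟩ := exists_vecMul_of_dvd (r := Pi.single 0 1) hdet fun v => by
      rw [Matrix.single_one_vecMul]
      exact hcon v
    have h0 := boundaryPairing_vecMul (k := k) hκ t
    rw [← hM, ← ht] at h0
    refine one_ne_zero (α := ℂ) (Eq.trans ?_ h0)
    unfold boundaryPairing pairing
    rw [Finset.sum_eq_single 0]
    · simp [boundarySolution]
    · intro b _ hb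
      rw [Pi.single_eq_of_ne hb, map_zero, zero_mul]
    · simp
  -- Since `Δ` is prime and generates the ideal of the curve, finitely many such conditions hold
  -- simultaneously at some point of it.
  have hdvd : ¬ M.det ∣ (∏ s, (r s ᵥ* M.adjugate) (v s)) * M.adjugate 0 v₀ := fun h => by
    rcases hirr.prime.dvd_or_dvd h with h | h
    · obtain ⟨s, -, hs⟩ := hirr.prime.exists_mem_finset_dvd h
      exact hv s hs
    · exact hv₀ h
  refine ⟨(∏ s, (r s ᵥ* M.adjugate) (v s)) * M.adjugate 0 v₀, fun j => M.adjugate j v₀, ?_, ?_⟩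
  · by_contra hcon
    push Not at hcon
    exact hdvd ((mem_idealOf_kdet_iff hn hκ hS).1 hcon)
  · intro α hα hH
    rw [map_mul, map_prod, mul_ne_zero_iff, Finset.prod_ne_zero_iff] at hH
    obtain ⟨h1, h2⟩ := hH
    have hker : ∀ v j, pairing α.coord (M j) (fun i => α.eval (M.adjugate i v)) = 0 :=
      fun v j => pairing_row_adjugate M hα j v
    have hspan : ∀ h' : Fin n → ℂ, (∀ j, pairing α.coord (M j) h' = 0) →
        ∃ c : ℂ, ∀ j, h' j = c * α.eval (M.adjugate j v₀) := by
      intro h' hh'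
      refine ⟨h' 0 / α.eval (M.adjugate 0 v₀), fun j => ?_⟩
      have h0 := eq_zero_of_adjugate_ne_zero M (h := fun j => h' j
        - h' 0 / α.eval (M.adjugate 0 v₀) * α.eval (M.adjugate j v₀)) h2 (fun i => ?_) ?_
      · exact sub_eq_zero.1 (congrFun h0 j)
      · have e1 := hh' i
        have e2 := hker v₀ i
        unfold pairing at e1 e2 ⊢
        calc _ = ∑ j, MvPolynomial.eval α.coord (M i j) * h' j
              - h' 0 / α.eval (M.adjugate 0 v₀) *
                ∑ j, MvPolynomial.eval α.coord (M i j) * α.eval (M.adjugate j v₀) := by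
              rw [Finset.mul_sum, ← Finset.sum_sub_distrib]
              exact Finset.sum_congr rfl fun j _ => by ring
          _ = 0 := by rw [e1, e2, mul_zero, sub_zero]
      · exact sub_eq_zero.2 (div_mul_cancel₀ _ h2).symm
    -- Column `v s` of the adjugate is a multiple of the spanning column `v₀`, so a functional
    -- vanishing on the latter vanishes on the former.
    refine ⟨hker v₀, hspan, fun s hs => h1 s (Finset.mem_univ s) ?_⟩
    obtain ⟨c, hc⟩ := hspan _ (hker (v s))
    refine (pairing_adjugate α.coord M (r s) (v s)).symm.trans ?_
    change pairing α.coord (r s) (fun j => α.eval (M.adjugate j (v s))) = 0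
    rw [show (fun j => α.eval (M.adjugate j (v s))) = fun j => c * α.eval (M.adjugate j v₀) from
      funext hc]
    unfold pairing at hs ⊢
    rw [← mul_zero c, ← hs, Finset.mul_sum]
    exact Finset.sum_congr rfl fun j _ => by ring

end RowSpace

/-! ### Cohomology classes of coherent tilings -/

section Tilings

open Matrix

variable {n k : ℕ} {P q : ProjTuple n} {A l : ZMod n → Fin 3 → ℂ} {α : H1 n k}

/-- Changing the lifts alters the cocycle by the coboundary of a Λ-invariant function, which the
potentials absorb. -/
theorem IsTilingClass.exists_of_isLift (h : IsTilingClass P q α) (hA : IsLift A P)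
    (hl : IsLift l q) : ∃ fW fB : ℤ × ℤ → ℂ, (∀ v, fW v ≠ 0) ∧ (∀ v, fB v ≠ 0) ∧
      fW ∈ quasiPeriodic α ∧ fB ∈ quasiPeriodic α ∧ ∀ (v : ℤ × ℤ) (e : Fin 4),
        l (idx n k v) ⬝ᵥ A (whiteNbr n k (idx n k v) e) = (fB v)⁻¹ * fW (v + offset e) := by
  obtain ⟨A', l', fW, fB, hA', hl', hW, hB, hWq, hBq, hf⟩ := h
  obtain ⟨c, hc, rfl⟩ := hA'.exists_smul hA
  obtain ⟨d, hd, rfl⟩ := hl'.exists_smul hl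
  refine ⟨fun v => c (idx n k v) * fW v, fun v => (d (idx n k v))⁻¹ * fB v,
    fun v => mul_ne_zero (hc _) (hW v), fun v => mul_ne_zero (inv_ne_zero (hd _)) (hB v),
    fun γ v => ?_, fun γ v => ?_, fun v e => ?_⟩
  · simp only [idx_deck_add, hWq γ v]
    ring
  · simp only [idx_deck_add, hBq γ v]
    ring
  · have := hf v e
    rw [idx_add_offset] at this
    beta_reduce
    rw [smul_dotProduct, dotProduct_smul, this, idx_add_offset, mul_inv, inv_inv, smul_eq_mul,
      smul_eq_mul]
    ring

/-- The ratio of the values at the ends of a horizontal edge. -/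
def xRatio (A l : ZMod n → Fin 3 → ℂ) (v : ZMod n) : ℂ := (l v ⬝ᵥ A (v + 1)) / (l v ⬝ᵥ A v)

/-- The ratio of the values at the ends of a vertical edge. -/
def yRatio (k : ℕ) (A l : ZMod n → Fin 3 → ℂ) (v : ZMod n) : ℂ :=
  (l v ⬝ᵥ A (v + k)) / (l v ⬝ᵥ A v)

theorem idx_eq_intCast (v : ℤ × ℤ) : idx n k v = ((v.1 + k * v.2 : ℤ) : ZMod n) := by
  simp [idx]

/-- Here `z = fW (n, 0) / fW (0, 0)`; the shear `(-k, 1)` carries `(k, 0)` to `(0, 1)`, so `w = fW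
(0, 1) / fW (k, 0)`. Both quotients are telescoping products along paths. -/
theorem IsTilingClass.coord_eq (h : IsTilingClass P q α) (hA : IsLift A P) (hl : IsLift l q) :
    α.z = ∏ j ∈ Finset.range n, xRatio A l (j : ZMod n) ∧
    α.w = yRatio k A l 0 * (∏ j ∈ Finset.range k, xRatio A l (j : ZMod n))⁻¹ := by
  obtain ⟨fW, fB, hW, hB, hWq, -, hf⟩ := h.exists_of_isLift hA hl
  have h0 : ∀ v, l (idx n k v) ⬝ᵥ A (idx n k v) = (fB v)⁻¹ * fW v := fun v => by
    have := hf v 0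
    rw [whiteNbr_eq, show offset 0 = 0 from rfl, add_zero, Matrix.cons_val_zero, add_zero] at this
    exact this
  have hx : ∀ v, fW (v + (1, 0)) = xRatio A l (idx n k v) * fW v := fun v => by
    have := hf v 1
    rw [whiteNbr_eq] at this
    simp only [offset, Matrix.cons_val] at this
    rw [xRatio, this, h0]
    have := hW v
    have := hB v
    field_simp
  have hy : ∀ v, fW (v + (0, 1)) = yRatio k A l (idx n k v) * fW v := fun v => by
    have := hf v 2
    rw [whiteNbr_eq] at this
    simp only [offset, Matrix.cons_val] at this
    rw [yRatio, this, h0]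
    have := hW v
    have := hB v
    field_simp
  have hrow : ∀ m : ℕ, fW ((m : ℤ), 0)
      = (∏ j ∈ Finset.range m, xRatio A l (j : ZMod n)) * fW (0, 0) := by
    intro m
    induction m with
    | zero => simp
    | succ m ih =>
      have := hx ((m : ℤ), 0)
      rw [idx_coe, Prod.mk_add_mk, add_zero] at this
      rw [Nat.cast_succ, this, ih, Finset.prod_range_succ]
      ring
  have hz := hWq (horizontalPeriod n k) (0, 0)
  have hw := hWq (shearPeriod n k) ((k : ℤ), 0)
  rw [show (horizontalPeriod n k : ℤ × ℤ) + (0, 0) = ((n : ℤ), 0) by simp [horizontalPeriod],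
    hrow] at hz
  rw [show (shearPeriod n k : ℤ × ℤ) + ((k : ℤ), 0) = (0, 0) + (0, 1) by simp [shearPeriod], hy,
    hrow] at hw
  rw [show idx n k (0, 0) = 0 by simp [idx]] at hw
  have hne : (∏ j ∈ Finset.range k, xRatio A l (j : ZMod n)) ≠ 0 := fun h => by
    have := hrow k
    rw [h, zero_mul] at this
    exact hW _ this
  refine ⟨(mul_right_cancel₀ (hW _) hz).symm, ?_⟩
  rw [← mul_assoc] at hw
  rw [mul_right_cancel₀ (hW _) hw]
  change α.w = α.w * _ * _
  field_simp

theorem IsTilingClass.unique {β : H1 n k} (hα : IsTilingClass P q α) (hβ : IsTilingClass P q β) :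
    α = β := by
  obtain ⟨h1, h2⟩ := hα.coord_eq (isLift_rep P) (isLift_rep q)
  obtain ⟨h3, h4⟩ := hβ.coord_eq (isLift_rep P) (isLift_rep q)
  exact H1.ext_coord (h1.trans h3.symm) (h2.trans h4.symm)

theorem IsTilingClass.classMap_eq (h : IsTilingClass P q α) : classMap k P q = α :=
  (Classical.epsilon_spec (p := fun α : H1 n k => IsTilingClass P q α) ⟨α, h⟩).unique h

theorem div_eq_one_of_mul_eq {a b c d : ℂ} (h : a * b = c * d) (hc : c ≠ 0) (hd : d ≠ 0) :
    a * b / (c * d) = 1 := by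
  rw [h, div_self (mul_ne_zero hc hd)]

/-- Around a face every potential occurs once in the numerator and once in the denominator. The
auxiliary equations list the pairings on the two faces at `(m, 0)`. -/
theorem IsTilingClass.isCoherent (h : IsTilingClass P q α) : IsCoherent k P q := by
  obtain ⟨fW, fB, hW, hB, -, -, hf⟩ := h.exists_of_isLift (isLift_rep P) (isLift_rep q)
  have key : ∀ (v w : ℤ × ℤ) (i j : ZMod n) (e : Fin 4), idx n k v = i →
      whiteNbr n k i e = j → v + offset e = w →
      (q i).rep ⬝ᵥ (P j).rep = (fB v)⁻¹ * fW w := by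
    rintro v _ _ _ e rfl rfl rfl
    exact hf v e
  intro i
  obtain ⟨m, rfl⟩ := ZMod.intCast_surjective i
  have h00 := key (m, 0) (m, 0) m m 0 (by simp [idx]) (by simp [whiteNbr_eq]) (by simp [offset])
  have h01 := key (m, 0) (m + 1, 0) m (m + 1) 1 (by simp [idx]) (by simp [whiteNbr_eq])
    (by simp [offset])
  have h02 := key (m, 0) (m, 1) m (m + k) 2 (by simp [idx]) (by simp [whiteNbr_eq])
    (by simp [offset])
  have hd0 := key (m, -1) (m, 0) (m - k) m 2 (by simp [idx, sub_eq_add_neg])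
    (by simp [whiteNbr_eq]) (by simp [offset])
  have hd1 := key (m, -1) (m + 1, 0) (m - k) (m + 1) 3 (by simp [idx, sub_eq_add_neg])
    (by simp [whiteNbr_eq]; ring) (by simp [offset])
  have hl0 := key (m - 1, 0) (m, 0) (m - 1) m 1 (by simp [idx]) (by simp [whiteNbr_eq])
    (by simp [offset])
  have hl1 := key (m - 1, 0) (m, 1) (m - 1) (m + k) 3 (by simp [idx])
    (by simp [whiteNbr_eq]) (by simp [offset])
  constructor
  · unfold multiRatio
    rw [hd0, h01, hd1, h00]
    exact div_eq_one_of_mul_eq (by ring) (mul_ne_zero (inv_ne_zero (hB _)) (hW _))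
      (mul_ne_zero (inv_ne_zero (hB _)) (hW _))
  · unfold multiRatio
    rw [h00, hl1, h02, hl0]
    exact div_eq_one_of_mul_eq (by ring) (mul_ne_zero (inv_ne_zero (hB _)) (hW _))
      (mul_ne_zero (inv_ne_zero (hB _)) (hW _))

theorem exists_seq_of_ratio (u : ℤ → ℂ) (hu : ∀ m, u m ≠ 0) :
    ∃ g : ℤ → ℂ, (∀ m, g m ≠ 0) ∧ ∀ m, g (m + 1) = u m * g m := by
  refine ⟨fun m => match m with
    | Int.ofNat a => ∏ i ∈ Finset.range a, u i
    | Int.negSucc a => (∏ i ∈ Finset.range (a + 1), u (Int.negSucc i))⁻¹, fun m => ?_, fun m => ?_⟩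
  · cases m with
    | ofNat a => exact Finset.prod_ne_zero_iff.2 fun _ _ => hu _
    | negSucc a => exact inv_ne_zero (Finset.prod_ne_zero_iff.2 fun _ _ => hu _)
  · cases m with
    | ofNat a =>
      change ∏ i ∈ Finset.range (a + 1), u i = u a * ∏ i ∈ Finset.range a, u i
      rw [Finset.prod_range_succ, mul_comm]
    | negSucc a =>
      cases a with
      | zero =>
        change ∏ i ∈ Finset.range 0, u i = _
        simp [hu]
      | succ a =>
        change (∏ i ∈ Finset.range (a + 1), u (Int.negSucc i))⁻¹
          = u (Int.negSucc (a + 1)) * (∏ i ∈ Finset.range (a + 1 + 1), u (Int.negSucc i))⁻¹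
        rw [Finset.prod_range_succ _ (a + 1), mul_inv]
        field_simp [hu]

theorem eq_of_step {T : Type*} (f : ℤ → T) (h : ∀ m, f (m + 1) = f m) (m : ℤ) : f m = f 0 := by
  induction m using Int.induction_on with
  | zero => rfl
  | succ m ih => rw [h, ih]
  | pred m ih => rw [← ih, ← h, sub_add_cancel]

theorem eq_zpow_mul_of_step {g : ℤ → ℂ} {c : ℂ} {d : ℤ} (hc : c ≠ 0)
    (h : ∀ m, g (m + d) = c * g m) (i m : ℤ) : g (d * i + m) = c ^ i * g m := by
  have := eq_of_step (fun i => c ^ (-i) * g (d * i + m)) (fun i => by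
    rw [show d * (i + 1) + m = d * i + m + d by ring, h, neg_add, zpow_add₀ hc]
    field_simp) i
  simp only [mul_zero, zero_add, neg_zero, zpow_zero, one_mul] at this
  rw [← this, ← mul_assoc, ← zpow_add₀ hc, add_neg_cancel, zpow_zero, one_mul]

theorem mul_ne_zero_and_eq_of_div_eq_one {a b c d : ℂ} (h : a * b / (c * d) = 1) :
    a ≠ 0 ∧ b ≠ 0 ∧ c ≠ 0 ∧ d ≠ 0 ∧ a * b = c * d := by
  have hcd : c * d ≠ 0 := fun h0 => by rw [h0, div_zero] at h; exact zero_ne_one h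
  have he : a * b = c * d := (div_eq_one_iff_eq hcd).1 h
  have hab : a * b ≠ 0 := he ▸ hcd
  exact ⟨left_ne_zero_of_mul hab, right_ne_zero_of_mul hab, left_ne_zero_of_mul hcd,
    right_ne_zero_of_mul hcd, he⟩

/-- A coherent tiling has a cohomology class. -/
theorem IsCoherent.exists_isTilingClass [NeZero n] (h : IsCoherent k P q) :
    ∃ α : H1 n k, IsTilingClass P q α := by
  set A : ZMod n → Fin 3 → ℂ := fun i => (P i).rep with hA
  set l : ZMod n → Fin 3 → ℂ := fun i => (q i).rep with hl
  -- With division by zero giving `0`, a multi-ratio equal to `1` also says that all four pairings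
  -- are nonzero.
  have h1 : ∀ v : ZMod n, l (v - k) ⬝ᵥ A v ≠ 0 ∧ l v ⬝ᵥ A (v + 1) ≠ 0 ∧
      l (v - k) ⬝ᵥ A (v + 1) ≠ 0 ∧ l v ⬝ᵥ A v ≠ 0 ∧ (l (v - k) ⬝ᵥ A v) * (l v ⬝ᵥ A (v + 1))
        = (l (v - k) ⬝ᵥ A (v + 1)) * (l v ⬝ᵥ A v) := fun v =>
    mul_ne_zero_and_eq_of_div_eq_one (h v).1
  have h2 : ∀ v : ZMod n, l v ⬝ᵥ A v ≠ 0 ∧ l (v - 1) ⬝ᵥ A (v + k) ≠ 0 ∧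
      l v ⬝ᵥ A (v + k) ≠ 0 ∧ l (v - 1) ⬝ᵥ A v ≠ 0 ∧ (l v ⬝ᵥ A v) * (l (v - 1) ⬝ᵥ A (v + k))
        = (l v ⬝ᵥ A (v + k)) * (l (v - 1) ⬝ᵥ A v) := fun v =>
    mul_ne_zero_and_eq_of_div_eq_one (h v).2
  have hx0 : ∀ v, xRatio A l v ≠ 0 := fun v => div_ne_zero (h1 v).2.1 (h1 v).2.2.2.1
  have hy0 : ∀ v, yRatio k A l v ≠ 0 := fun v => div_ne_zero (h2 v).2.2.1 (h2 v).1
  have e1 : ∀ v, l v ⬝ᵥ A (v + 1) = xRatio A l v * (l v ⬝ᵥ A v) := fun v =>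
    (div_mul_cancel₀ _ (h2 v).1).symm
  have e2 : ∀ v, l v ⬝ᵥ A (v + k) = yRatio k A l v * (l v ⬝ᵥ A v) := fun v =>
    (div_mul_cancel₀ _ (h2 v).1).symm
  have e3 : ∀ v, l v ⬝ᵥ A (v + k + 1) = xRatio A l (v + k) * (l v ⬝ᵥ A (v + k)) := fun v => by
    obtain ⟨-, -, -, ha, hb⟩ := h1 (v + k)
    rw [add_sub_cancel_right, e1 (v + k)] at hb
    exact mul_right_cancel₀ ha (by linear_combination -hb)
  have e4 : ∀ v, l v ⬝ᵥ A (v + k + 1) = yRatio k A l (v + 1) * (l v ⬝ᵥ A (v + 1)) := fun v => by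
    obtain ⟨ha, -, -, -, hb⟩ := h2 (v + 1)
    rw [add_sub_cancel_right, e2 (v + 1), show v + 1 + (k : ZMod n) = v + k + 1 by ring] at hb
    exact mul_left_cancel₀ ha (by linear_combination hb)
  -- The two ways around the square of neighbours of a black vertex agree: the horizontal and
  -- vertical ratios are compatible.
  have e5 : ∀ v, yRatio k A l (v + 1) * xRatio A l v
      = xRatio A l (v + k) * yRatio k A l v := fun v => by
    refine mul_right_cancel₀ (h2 v).1 ?_
    rw [mul_assoc, mul_assoc, ← e1, ← e2, ← e3, ← e4]
  obtain ⟨g, hg0, hg⟩ := exists_seq_of_ratio (fun m : ℤ => xRatio A l (m : ZMod n))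
    fun m => hx0 _
  -- The quotient `g (m + n) / g m` is constant, because the ratios depend on the index modulo `n`.
  obtain ⟨z, hz⟩ : ∃ z, ∀ m, g (m + n) = z * g m := by
    refine ⟨g (0 + n) / g 0, fun m => ?_⟩
    rw [← eq_of_step (fun m => g (m + n) / g m) (fun m => ?_) m]
    · exact (div_mul_cancel₀ _ (hg0 m)).symm
    · rw [show m + 1 + (n : ℤ) = m + n + 1 by ring, hg, hg]
      simp only [Int.cast_add, Int.cast_natCast, CharP.cast_eq_zero, add_zero]
      rw [mul_div_mul_left _ _ (hx0 _)]
  -- Likewise the compatibility `e5` makes `yRatio m * g m / g (m + k)` constant.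
  obtain ⟨w, hw⟩ : ∃ w, ∀ m : ℤ, w * g (m + k) = yRatio k A l (m : ZMod n) * g m := by
    refine ⟨yRatio k A l ((0 : ℤ) : ZMod n) * g 0 / g (0 + k), fun m => ?_⟩
    rw [← eq_of_step (fun m : ℤ => yRatio k A l (m : ZMod n) * g m / g (m + k)) (fun m => ?_) m]
    · exact div_mul_cancel₀ _ (hg0 _)
    · rw [show m + 1 + (k : ℤ) = m + k + 1 by ring, hg, hg]
      rw [div_eq_div_iff (mul_ne_zero (hx0 _) (hg0 _)) (hg0 _)]
      push_cast
      linear_combination (g m * g (m + k)) * e5 (m : ZMod n)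
  have hz0 : z ≠ 0 := fun h => hg0 (0 + n) (by rw [hz, h, zero_mul])
  have hw0 : w ≠ 0 := fun h => by
    have := hw 0
    rw [h, zero_mul] at this
    exact mul_ne_zero (hy0 _) (hg0 _) this.symm
  -- This potential has horizontal ratios `xRatio` by the choice of `g`, and vertical ratios
  -- `yRatio` by the choice of `w`.
  set fW : ℤ × ℤ → ℂ := fun v => w ^ v.2 * g (v.1 + k * v.2) with hfW
  have hW0 : ∀ v, fW v ≠ 0 := fun v => mul_ne_zero (zpow_ne_zero _ hw0) (hg0 _)
  have hWq : fW ∈ quasiPeriodic (H1.ofCoord n k z w hz0 hw0) := by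
    intro γ v
    simp only [hfW]
    rw [H1.ofCoord_val, Prod.snd_add, Prod.fst_add,
      show (γ : ℤ × ℤ).1 + v.1 + k * ((γ : ℤ × ℤ).2 + v.2)
        = n * level n k γ + (v.1 + k * v.2) by
          have := level_mul γ.2
          linear_combination -this,
      eq_zpow_mul_of_step hz0 hz, zpow_add₀ hw0]
    ring
  have hWx : ∀ v, fW (v + (1, 0)) = xRatio A l (idx n k v) * fW v := fun v => by
    simp only [hfW]
    rw [idx_eq_intCast, Prod.fst_add, Prod.snd_add, add_zero,
      show v.1 + 1 + (k : ℤ) * v.2 = v.1 + k * v.2 + 1 by ring, hg]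
    ring
  have hWy : ∀ v, fW (v + (0, 1)) = yRatio k A l (idx n k v) * fW v := fun v => by
    simp only [hfW]
    rw [idx_eq_intCast, Prod.fst_add, Prod.snd_add, add_zero, zpow_add₀ hw0, zpow_one,
      show v.1 + (k : ℤ) * (v.2 + 1) = v.1 + k * v.2 + k by ring]
    linear_combination w ^ v.2 * hw (v.1 + k * v.2)
  have hWxy : ∀ v, fW (v + (1, 1))
      = xRatio A l (idx n k v + k) * (yRatio k A l (idx n k v) * fW v) := fun v => by
    rw [show v + (1, 1) = v + (0, 1) + (1, 0) by rw [add_assoc]; rfl, hWx, hWy, map_add]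
    simp [idx]
  refine ⟨_, A, l, fW, fun v => fW v / (l (idx n k v) ⬝ᵥ A (idx n k v)), isLift_rep P,
    isLift_rep q, hW0, fun v => div_ne_zero (hW0 v) (h2 _).1, hWq, fun γ v => ?_, fun v e => ?_⟩
  · beta_reduce
    rw [idx_deck_add, hWq γ v, mul_div_assoc]
  · rw [idx_add_offset, whiteNbr_eq, inv_div]
    have hv := hW0 v
    fin_cases e
    · simp only [offset, Fin.zero_eta, Matrix.cons_val]
      rw [show v + ((0, 0) : ℤ × ℤ) = v from add_zero v, add_zero, div_mul_cancel₀ _ hv]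
    · simp only [offset, Fin.mk_one, Matrix.cons_val]
      rw [hWx, e1]
      field_simp
    · simp only [offset, Fin.reduceFinMk, Matrix.cons_val]
      rw [hWy, e2]
      field_simp
    · simp only [offset, Fin.reduceFinMk, Matrix.cons_val]
      rw [hWxy, ← add_assoc, e3, e2]
      field_simp

/-! ### The class as a rational function -/

theorem dotProduct_rationalOn {X : Set (ProjTuple n)} (v : ZMod n) (a b : Fin 3 → ℂ)
    (hb : ∀ q ∈ X, ∀ l, IsLift l q → l v ⬝ᵥ b ≠ 0) :
    RationalOn X fun q => ((q v).rep ⬝ᵥ a) / ((q v).rep ⬝ᵥ b) := by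
  have hev : ∀ (a : Fin 3 → ℂ) (l : ZMod n → Fin 3 → ℂ),
      evalLift (∑ j, MvPolynomial.C (a j) * MvPolynomial.X (v, j)) l = l v ⬝ᵥ a := fun a l => by
    simp [evalLift, dotProduct, mul_comm]
  refine ⟨∑ j, MvPolynomial.C (a j) * MvPolynomial.X (v, j),
    ∑ j, MvPolynomial.C (b j) * MvPolynomial.X (v, j), ⟨fun c hc l => ?_, fun c hc l => ?_⟩,
    fun q hq l hl => ?_⟩
  · rw [hev, hev, rescale, smul_dotProduct, smul_eq_mul, mul_ne_zero_iff_left (hc v)]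
  · rw [hev, hev, hev, hev, rescale, smul_dotProduct, smul_dotProduct, smul_eq_mul, smul_eq_mul]
    ring
  · rw [hev, hev]
    refine ⟨hb q hq l hl, ?_⟩
    obtain ⟨c, hc, hrep⟩ := hl.exists_smul (isLift_rep q)
    have hv : (q v).rep = c v • l v := congrFun hrep v
    beta_reduce
    rw [hv, smul_dotProduct, smul_dotProduct, smul_eq_mul, smul_eq_mul,
      mul_div_mul_left _ _ (hc v)]

theorem IsTilingClass.pairing_ne_zero (h : IsTilingClass P q α) (hA : IsLift A P)
    (hl : IsLift l q) (v : ZMod n) (e : Fin 4) : l v ⬝ᵥ A (whiteNbr n k v e) ≠ 0 := by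
  obtain ⟨fW, fB, hW, hB, -, -, hf⟩ := h.exists_of_isLift hA hl
  obtain ⟨m, rfl⟩ := ZMod.intCast_surjective v
  have := hf (m, 0) e
  rw [show idx n k (m, 0) = m by simp [idx]] at this
  rw [this]
  exact mul_ne_zero (inv_ne_zero (hB _)) (hW _)

theorem rationalOn_classMap {X : Set (ProjTuple n)} {F : ProjTuple n → H1 n k}
    (hX : ∀ q ∈ X, IsTilingClass P q (F q)) :
    RationalOn X (fun q => (F q).z) ∧ RationalOn X fun q => (F q).w := by
  have hP := isLift_rep P
  have h0 : ∀ (v : ZMod n), ∀ q ∈ X, ∀ l, IsLift l q → l v ⬝ᵥ (P v).rep ≠ 0 :=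
    fun v q hq l hl => by
      have := (hX q hq).pairing_ne_zero hP hl v 0
      rwa [whiteNbr_eq, Matrix.cons_val_zero, add_zero] at this
  have h1 : ∀ (v : ZMod n), ∀ q ∈ X, ∀ l, IsLift l q → l v ⬝ᵥ (P (v + 1)).rep ≠ 0 :=
    fun v q hq l hl => by
      have := (hX q hq).pairing_ne_zero hP hl v 1
      rwa [whiteNbr_eq] at this
  have hx : ∀ v, RationalOn X fun q => xRatio (fun i => (P i).rep) (fun i => (q i).rep) v :=
    fun v => dotProduct_rationalOn v _ _ (h0 v)
  constructor
  · exact (rationalOn_prod (Finset.range n) fun j _ => hx (j : ZMod n)).congr fun q hq =>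
      ((hX q hq).coord_eq hP (isLift_rep q)).1
  · refine RationalOn.congr (RationalOn.mul (dotProduct_rationalOn 0 (P (0 + k)).rep (P 0).rep
      (h0 0)) ((rationalOn_prod (Finset.range k) fun j _ => hx (j : ZMod n)).inv ?_)) fun q hq =>
      ((hX q hq).coord_eq hP (isLift_rep q)).2
    intro q hq
    exact Finset.prod_ne_zero_iff.2 fun j _ =>
      div_ne_zero (h1 _ q hq _ (isLift_rep q)) (h0 _ q hq _ (isLift_rep q))

/-- Diagonals are lifted by cross products, which are polynomial and change under `c` by the factors
`c i * c (i + k)`, so scale invariance survives the substitution. -/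
theorem RationalOn.comp_diagonals {X Y : Set (ProjTuple n)} {θ : ProjTuple n → ℂ}
    (h : RationalOn X θ) (hY : ∀ Q ∈ Y, diagonals k Q ∈ X)
    (hne : ∀ Q ∈ Y, ∀ i, Q i ≠ Q (i + k)) : RationalOn Y fun Q => θ (diagonals k Q) := by
  obtain ⟨N, D, ⟨hD, hi⟩, h⟩ := h
  set x : ZMod n × Fin 3 → MvPolynomial (ZMod n × Fin 3) ℂ := fun p =>
    crossProduct (fun j => MvPolynomial.X (p.1, j)) (fun j => MvPolynomial.X (p.1 + k, j)) p.2
    with hx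
  have hev : ∀ (E : MvPolynomial (ZMod n × Fin 3) ℂ) (l : ZMod n → Fin 3 → ℂ),
      evalLift (MvPolynomial.aeval x E) l
        = evalLift E fun i => crossProduct (l i) (l (i + k)) := by
    intro E l
    induction E using MvPolynomial.induction_on with
    | C a => simp [evalLift, MvPolynomial.algebraMap_eq]
    | add p q hp hq => rw [map_add, evalLift_add, evalLift_add, hp, hq]
    | mul_X p i hp =>
      rw [map_mul, evalLift_mul, evalLift_mul, hp, MvPolynomial.aeval_X, evalLift_X]
      congr 1
      obtain ⟨i, j⟩ := i
      fin_cases j <;> simp [hx, evalLift, cross_apply]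
  have hcross : ∀ (c : ZMod n → ℂ) (l : ZMod n → Fin 3 → ℂ),
      (fun i => crossProduct (rescale c l i) (rescale c l (i + k)))
        = rescale (fun i => c i * c (i + k)) fun i => crossProduct (l i) (l (i + k)) := fun c l =>
    funext fun i => cross_smul_smul _ _ _ _
  refine ⟨MvPolynomial.aeval x N, MvPolynomial.aeval x D,
    ⟨fun c hc l => ?_, fun c hc l => ?_⟩, fun Q hQ l hl => ?_⟩
  · rw [hev, hev, hcross]
    exact hD _ (fun i => mul_ne_zero (hc _) (hc _)) _
  · rw [hev, hev, hev, hev, hcross]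
    exact hi _ (fun i => mul_ne_zero (hc _) (hc _)) _
  · rw [hev, hev]
    exact h _ (hY Q hQ) _ (hl.cross (hne Q hQ))

end Tilings

/-! ### Lines from solutions of the Kasteleyn equation -/

section Lines

open Matrix

variable {n k : ℕ} {A : ZMod n → Fin 3 → ℂ} {κ : ZMod n → Fin 4 → ℂ} {α : H1 n k}
  {f : ℤ × ℤ → ℂ}

/-- The covector at a black vertex with prescribed values on three of its neighbours. -/
def lineAt (k : ℕ) (A : ZMod n → Fin 3 → ℂ) (f : ℤ × ℤ → ℂ) (v : ℤ × ℤ) : Fin 3 → ℂ :=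
  (triple (A (idx n k v)) (A (idx n k v + 1)) (A (idx n k v + k)))⁻¹ •
    (f v • crossProduct (A (idx n k v + 1)) (A (idx n k v + k))
      + f (v + (1, 0)) • crossProduct (A (idx n k v + k)) (A (idx n k v))
      + f (v + (0, 1)) • crossProduct (A (idx n k v)) (A (idx n k v + 1)))

theorem GeneralPosition.triple_add_ne_zero (hA : GeneralPosition A) (i : ZMod n) {a b c : ZMod n}
    (hab : a ≠ b) (hac : a ≠ c) (hbc : b ≠ c) :
    triple (A (i + a)) (A (i + b)) (A (i + c)) ≠ 0 :=
  hA _ _ _ (fun h => hab (add_left_cancel h)) (fun h => hac (add_left_cancel h))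
    fun h => hbc (add_left_cancel h)

/-- The elements `0, 1, k, k + 1` of `ℤ/n` are distinct. -/
structure DistinctOffsets (n k : ℕ) : Prop where
  one_ne : (1 : ZMod n) ≠ 0
  k_ne : (k : ZMod n) ≠ 0
  k_ne_one : (k : ZMod n) ≠ 1
  k_add_one_ne : (k : ZMod n) + 1 ≠ 0
  two_ne : (2 : ZMod n) ≠ 0

theorem distinctOffsets (hk : 2 ≤ k) (hkn : k + 2 ≤ n) : DistinctOffsets n k where
  one_ne := by
    have := natCast_ne_of_lt (n := n) (a := 1) (b := 0) (by omega) (by omega) (by omega)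
    exact_mod_cast this
  k_ne := by
    have := natCast_ne_of_lt (n := n) (a := k) (b := 0) (by omega) (by omega) (by omega)
    exact_mod_cast this
  k_ne_one := by
    have := natCast_ne_of_lt (n := n) (a := k) (b := 1) (by omega) (by omega) (by omega)
    exact_mod_cast this
  k_add_one_ne := by
    have := natCast_ne_of_lt (n := n) (a := k + 1) (b := 0) (by omega) (by omega) (by omega)
    exact_mod_cast this
  two_ne := by
    have := natCast_ne_of_lt (n := n) (a := 2) (b := 0) (by omega) (by omega) (by omega)
    exact_mod_cast this

theorem GeneralPosition.triple_zero_one_k (hA : GeneralPosition A) (hd : DistinctOffsets n k)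
    (i : ZMod n) : triple (A i) (A (i + 1)) (A (i + k)) ≠ 0 := by
  have := hA.triple_add_ne_zero i hd.one_ne.symm hd.k_ne.symm hd.k_ne_one.symm
  rwa [add_zero] at this

theorem interpolation_dot {a b c : Fin 3 → ℂ} (h : triple a b c ≠ 0) (x y z : ℂ) :
    let l := (triple a b c)⁻¹ • (x • crossProduct b c + y • crossProduct c a
      + z • crossProduct a b)
    l ⬝ᵥ a = x ∧ l ⬝ᵥ b = y ∧ l ⬝ᵥ c = z := by
  have key : ∀ u, (x • crossProduct b c + y • crossProduct c a + z • crossProduct a b) ⬝ᵥ u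
      = x * triple u b c + y * triple u c a + z * triple u a b := fun u => by
    simp only [triple_eq, dot_eq, Pi.add_apply, Pi.smul_apply, smul_eq_mul, cross_zero, cross_one,
      cross_two]
    ring
  have h1 : triple a c a = 0 := by simp only [triple_eq]; ring
  have h2 : triple a a b = 0 := by simp only [triple_eq]; ring
  have h3 : triple b b c = 0 := by simp only [triple_eq]; ring
  have h4 : triple b a b = 0 := by simp only [triple_eq]; ring
  have h5 : triple c b c = 0 := by simp only [triple_eq]; ring
  have h6 : triple c c a = 0 := by simp only [triple_eq]; ring
  have h7 : triple b c a = triple a b c := triple_rotate _ _ _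
  have h8 : triple c a b = triple a b c := by simp only [triple_eq]; ring
  intro l
  refine ⟨?_, ?_, ?_⟩ <;> simp only [l, smul_dotProduct, key, smul_eq_mul, h1, h2, h3, h4, h5, h6,
    h7, h8] <;> field_simp <;> ring

theorem lineAt_dot_zero (hA : GeneralPosition A) (hd : DistinctOffsets n k) (v : ℤ × ℤ) :
    lineAt k A f v ⬝ᵥ A (idx n k v) = f v :=
  (interpolation_dot (hA.triple_zero_one_k hd _) _ _ _).1

theorem lineAt_dot_one (hA : GeneralPosition A) (hd : DistinctOffsets n k) (v : ℤ × ℤ) :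
    lineAt k A f v ⬝ᵥ A (idx n k v + 1) = f (v + (1, 0)) :=
  (interpolation_dot (hA.triple_zero_one_k hd _) _ _ _).2.1

theorem lineAt_dot_k (hA : GeneralPosition A) (hd : DistinctOffsets n k) (v : ℤ × ℤ) :
    lineAt k A f v ⬝ᵥ A (idx n k v + k) = f (v + (0, 1)) :=
  (interpolation_dot (hA.triple_zero_one_k hd _) _ _ _).2.2

theorem weights_relation (hκ : IsKasteleynWeights k A κ) (i : ZMod n) :
    κ i 0 • A i + κ i 1 • A (i + 1) + κ i 2 • A (i + k) + κ i 3 • A (i + k + 1) = 0 := by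
  have := hκ.2 i
  simp only [Fin.sum_univ_four, whiteNbr_eq, Matrix.cons_val, add_zero, ← add_assoc] at this
  exact this

theorem kasteleyn_apply (κ : ZMod n → Fin 4 → ℂ) (f : ℤ × ℤ → ℂ) (v : ℤ × ℤ) :
    kasteleyn n k κ f v = κ (idx n k v) 0 * f v + κ (idx n k v) 1 * f (v + (1, 0))
      + κ (idx n k v) 2 * f (v + (0, 1)) + κ (idx n k v) 3 * f (v + (1, 1)) := by
  change ∑ e : Fin 4, κ (idx n k v) e * f (v + offset e) = _
  rw [Fin.sum_univ_four, show offset 0 = 0 from rfl, add_zero]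
  rfl

/-- Comparing the relation among the four points with the Kasteleyn equation for `f` forces the
fourth value, since its weight is nonzero. -/
theorem lineAt_dot_k_add_one (hA : GeneralPosition A) (hd : DistinctOffsets n k)
    (hκ : IsKasteleynWeights k A κ) (hK : kasteleyn n k κ f = 0) (v : ℤ × ℤ) :
    lineAt k A f v ⬝ᵥ A (idx n k v + k + 1) = f (v + (1, 1)) := by
  have h1 := congrArg (fun u => lineAt k A f v ⬝ᵥ u) (weights_relation hκ (idx n k v))
  simp only [dotProduct_add, dotProduct_smul, dotProduct_zero, lineAt_dot_zero hA hd,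
    lineAt_dot_one hA hd, lineAt_dot_k hA hd, smul_eq_mul] at h1
  have h2 := congrFun hK v
  rw [kasteleyn_apply, Pi.zero_apply] at h2
  exact mul_left_cancel₀ (hκ.1 (idx n k v) 3) (by linear_combination h1 - h2)

theorem lineAt_dot (hA : GeneralPosition A) (hd : DistinctOffsets n k)
    (hκ : IsKasteleynWeights k A κ) (hK : kasteleyn n k κ f = 0) (v : ℤ × ℤ) (e : Fin 4) :
    lineAt k A f v ⬝ᵥ A (whiteNbr n k (idx n k v) e) = f (v + offset e) := by
  rw [whiteNbr_eq]
  fin_cases e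
  · simp only [Fin.zero_eta, Matrix.cons_val, add_zero, show offset 0 = 0 from rfl]
    exact lineAt_dot_zero hA hd v
  · exact lineAt_dot_one hA hd v
  · exact lineAt_dot_k hA hd v
  · simp only [Fin.reduceFinMk, Matrix.cons_val, ← add_assoc]
    exact lineAt_dot_k_add_one hA hd hκ hK v

theorem lineAt_deck_add (hf : f ∈ quasiPeriodic α) (γ : deck n k) (v : ℤ × ℤ) :
    lineAt k A f (γ + v) = α.val γ • lineAt k A f v := by
  unfold lineAt
  rw [idx_deck_add, add_assoc (γ : ℤ × ℤ) v, add_assoc (γ : ℤ × ℤ) v, hf, hf, hf, smul_comm (α.val γ)]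
  simp only [smul_add, mul_smul]

theorem eq_lineAt (hA : GeneralPosition A) (hd : DistinctOffsets n k) {l : Fin 3 → ℂ} {v : ℤ × ℤ}
    (h : ∀ e, l ⬝ᵥ A (whiteNbr n k (idx n k v) e) = f (v + offset e)) : l = lineAt k A f v := by
  refine covector_ext (hA.triple_zero_one_k hd (idx n k v)) ?_ ?_ ?_
  · rw [lineAt_dot_zero hA hd]
    have := h 0
    rwa [whiteNbr_eq, show offset 0 = 0 from rfl, add_zero, Matrix.cons_val_zero,
      add_zero] at this
  · rw [lineAt_dot_one hA hd]
    have := h 1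
    rwa [whiteNbr_eq] at this
  · rw [lineAt_dot_k hA hd]
    have := h 2
    rwa [whiteNbr_eq] at this

/-- A quasi-periodic solution of the Kasteleyn equation whose lines are in general position. -/
structure IsGenericSolution (A : ZMod n → Fin 3 → ℂ) (κ : ZMod n → Fin 4 → ℂ) (α : H1 n k)
    (f : ℤ × ℤ → ℂ) : Prop where
  mem : f ∈ quasiPeriodic α
  ker : kasteleyn n k κ f = 0
  ne_zero : ∀ v, f v ≠ 0
  horizontal : ∀ v, lineAt k A f (v + (1, 0)) ≠ lineAt k A f v
  vertical : ∀ v, lineAt k A f (v + (0, 1)) ≠ lineAt k A f v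
  -- Up to sign this is the value of the line at the intersection of `A_i A_{i+1}` and `A_{i+k}
  -- A_{i+k+1}`.
  crossing : ∀ v,
    triple (A (idx n k v + 1)) (A (idx n k v + k)) (A (idx n k v + k + 1)) * f v
      - triple (A (idx n k v)) (A (idx n k v + k)) (A (idx n k v + k + 1)) * f (v + (1, 0)) ≠ 0

theorem idx_add_one (v : ℤ × ℤ) : idx n k (v + (1, 0)) = idx n k v + 1 := by
  rw [map_add]
  simp [idx]

theorem idx_add_k (v : ℤ × ℤ) : idx n k (v + (0, 1)) = idx n k v + k := by
  rw [map_add]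
  simp [idx]

/-- Coincidence of the lines at horizontally adjacent black vertices. -/
theorem relation_of_horizontal_eq (hA : GeneralPosition A) (hd : DistinctOffsets n k)
    (hκ : IsKasteleynWeights k A κ) (hK : kasteleyn n k κ f = 0) {v : ℤ × ℤ} {i : ZMod n}
    (hi : idx n k v = i) (h : lineAt k A f (v + (1, 0)) = lineAt k A f v) :
    triple (A (i + k)) (A (i + k + 1)) (A (i + k + 2)) * f (v + (1, 0))
      - triple (A (i + 1)) (A (i + k + 1)) (A (i + k + 2)) * f (v + (0, 1))
      + triple (A (i + 1)) (A (i + k)) (A (i + k + 2)) * f (v + (1, 1))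
      - triple (A (i + 1)) (A (i + k)) (A (i + k + 1)) * f (v + (2, 1)) = 0 := by
  subst hi
  -- The common covector has known values at five points, four around one black vertex and four
  -- around the other; the relation among four of these points becomes a relation among values of
  -- `f`.
  have h1 := congrArg (fun u => lineAt k A f v ⬝ᵥ u) (four_term_relation (A (idx n k v + 1))
    (A (idx n k v + k)) (A (idx n k v + k + 1)) (A (idx n k v + k + 2)))
  have h2 := lineAt_dot_k_add_one hA hd hκ hK (v + (1, 0))
  rw [h, idx_add_one, show idx n k v + 1 + (k : ZMod n) + 1 = idx n k v + k + 2 by ring,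
    add_assoc v] at h2
  simp only [dotProduct_add, dotProduct_sub, dotProduct_smul, dotProduct_zero, smul_eq_mul,
    lineAt_dot_one hA hd, lineAt_dot_k hA hd, lineAt_dot_k_add_one hA hd hκ hK, h2] at h1
  exact h1

/-- Coincidence of the lines at vertically adjacent black vertices. -/
theorem relation_of_vertical_eq (hA : GeneralPosition A) (hd : DistinctOffsets n k)
    (hκ : IsKasteleynWeights k A κ) (hK : kasteleyn n k κ f = 0) {v : ℤ × ℤ} {i : ZMod n}
    (hi : idx n k v = i) (h : lineAt k A f (v + (0, 1)) = lineAt k A f v) :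
    triple (A (i + k)) (A (i + k + 1)) (A (i + k + k)) * f v
      - triple (A i) (A (i + k + 1)) (A (i + k + k)) * f (v + (0, 1))
      + triple (A i) (A (i + k)) (A (i + k + k)) * f (v + (1, 1))
      - triple (A i) (A (i + k)) (A (i + k + 1)) * f (v + (0, 2)) = 0 := by
  subst hi
  have h1 := congrArg (fun u => lineAt k A f v ⬝ᵥ u) (four_term_relation (A (idx n k v))
    (A (idx n k v + k)) (A (idx n k v + k + 1)) (A (idx n k v + k + k)))
  have h2 := lineAt_dot_k hA hd (f := f) (v + (0, 1))
  rw [h, idx_add_k, add_assoc v] at h2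
  simp only [dotProduct_add, dotProduct_sub, dotProduct_smul, dotProduct_zero, smul_eq_mul,
    lineAt_dot_zero hA hd, lineAt_dot_k hA hd, lineAt_dot_k_add_one hA hd hκ hK, h2] at h1
  exact h1

end Lines

/-! ### Existence of generic solutions -/

section GenericSolutions

open Matrix MvPolynomial

variable {n k : ℕ} {A : ZMod n → Fin 3 → ℂ} {κ : ZMod n → Fin 4 → ℂ}

theorem boundaryPairing_add (r s : Fin n → Poly) :
    boundaryPairing κ (r + s) = boundaryPairing κ r + boundaryPairing κ s := pairing_add _ _ _ _

theorem boundaryPairing_C_smul (c : ℂ) (r : Fin n → Poly) :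
    boundaryPairing κ ((C c : Poly) • r) = c * boundaryPairing κ r := by
  unfold boundaryPairing
  rw [pairing_smul, eval_C]

variable [NeZero n]

/-- The functionals whose vanishing describes degenerate solutions. -/
def degeneracyRow (k : ℕ) (A : ZMod n → Fin 3 → ℂ) (j : ℕ) : Fin 4 → Fin n → Poly :=
  let i : ZMod n := j
  ![site n k j 0,
    (C (triple (A (i + k)) (A (i + k + 1)) (A (i + k + 2))) : Poly) • site n k (j + 1) 0
      + (C (-triple (A (i + 1)) (A (i + k + 1)) (A (i + k + 2))) : Poly) • site n k j 1
      + (C (triple (A (i + 1)) (A (i + k)) (A (i + k + 2))) : Poly) • site n k (j + 1) 1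
      + (C (-triple (A (i + 1)) (A (i + k)) (A (i + k + 1))) : Poly) • site n k (j + 2) 1,
    (C (triple (A (i + k)) (A (i + k + 1)) (A (i + k + k))) : Poly) • site n k j 0
      + (C (-triple (A i) (A (i + k + 1)) (A (i + k + k))) : Poly) • site n k j 1
      + (C (triple (A i) (A (i + k)) (A (i + k + k))) : Poly) • site n k (j + 1) 1
      + (C (-triple (A i) (A (i + k)) (A (i + k + 1))) : Poly) • site n k j 2,
    (C (triple (A (i + 1)) (A (i + k)) (A (i + k + 1))) : Poly) • site n k j 0
      + (C (-triple (A i) (A (i + k)) (A (i + k + 1))) : Poly) • site n k (j + 1) 0]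

/-- The first three rows have a single term of height `0`, with nonzero coefficient, so their
boundary pairing is nonzero. The last has two such terms, which might cancel at the boundary; but it
is free of `w`, and the pencil argument applies. -/
theorem degeneracyRow_ne_vecMul (hA : GeneralPosition A) (hk : 2 ≤ k) (hkn : k + 2 ≤ n)
    (hκ : ∀ v e, κ v e ≠ 0) (j : Fin n) (s : Fin 4) (t : Fin n → Poly) :
    degeneracyRow k A j s ≠ t ᵥ* kmatrix k κ := by
  intro h
  have hd := distinctOffsets hk hkn
  have hb := boundaryPairing_vecMul (k := k) hκ t
  rw [← h] at hb
  have hsol := boundarySolution_ne_zero hκ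
  set i : ZMod n := ((j : ℕ) : ZMod n) with hi
  fin_cases s
  · simp only [degeneracyRow, Fin.zero_eta, Matrix.cons_val, boundaryPairing_site, if_true] at hb
    exact hsol _ hb
  · simp only [degeneracyRow, Fin.mk_one, Matrix.cons_val, boundaryPairing_add,
      boundaryPairing_C_smul, boundaryPairing_site, if_true, one_ne_zero, if_false, mul_zero,
      add_zero] at hb
    refine mul_ne_zero ?_ (hsol _) hb
    have := hA.triple_add_ne_zero (i + k) hd.one_ne.symm hd.two_ne.symm
      (show (1 : ZMod n) ≠ 2 from fun h => hd.one_ne (by linear_combination -h))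
    rwa [add_zero] at this
  · simp only [degeneracyRow, Fin.reduceFinMk, Matrix.cons_val, boundaryPairing_add,
      boundaryPairing_C_smul, boundaryPairing_site, if_true, one_ne_zero, if_false, mul_zero,
      add_zero, OfNat.ofNat_ne_zero] at hb
    exact mul_ne_zero (hA.triple_zero_one_k hd (i + k)) (hsol _) hb
  · obtain ⟨z, hz⟩ := exists_eq_zero_of_const_eq_vecMul hκ (show k ≤ n by omega)
    have hc := hz t (fun m => triple (A (i + 1)) (A (i + k)) (A (i + k + 1)) * seqSite n z j m
      + -triple (A i) (A (i + k)) (A (i + k + 1)) * seqSite n z (j + 1) m) (fun m => by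
      rw [← h]
      simp only [degeneracyRow, Fin.reduceFinMk, Matrix.cons_val, Pi.add_apply, Pi.smul_apply,
        smul_eq_mul, map_add, map_mul, restrictVertical_C, restrictVertical_site, mul_zero,
        add_zero, pow_zero, one_mul]
      rfl)
    have hcj := congrFun hc j
    have hj := j.2
    have hne : (j : ℕ) ≠ (j + 1) % n := by
      rcases Nat.lt_or_ge (j + 1) n with h | h
      · rw [Nat.mod_eq_of_lt h]; omega
      · rw [show (j : ℕ) + 1 = n by omega, Nat.mod_self]; omega
    simp only [seqSite, Nat.mod_eq_of_lt hj, if_true, if_neg hne, Nat.div_eq_of_lt hj, pow_zero,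
      mul_one, mul_zero, add_zero, Pi.zero_apply] at hcj
    have := hA.triple_add_ne_zero i hd.k_ne_one.symm
      (show (1 : ZMod n) ≠ k + 1 from fun h => hd.k_ne (by linear_combination -h))
      (show (k : ZMod n) ≠ k + 1 from fun h => hd.one_ne (by linear_combination -h))
    rw [← add_assoc] at this
    exact this hcj

theorem exists_generic_solution (hA : GeneralPosition A) (hk : 2 ≤ k) (hkn : k + 2 ≤ n)
    (hκ : IsKasteleynWeights k A κ) (hS : IsIrreducible (zeroSet n k (kdet k κ))) :
    ∃ (H : Poly) (h : Fin n → Poly),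
      (∃ α ∈ zeroSet n k (kdet k κ), α.eval H ≠ 0) ∧
      ∀ α ∈ zeroSet n k (kdet k κ), α.eval H ≠ 0 →
        IsGenericSolution A κ α (extension α fun i => α.eval (h i)) ∧
        ∀ f ∈ quasiPeriodic α, kasteleyn n k κ f = 0 →
          ∃ c : ℂ, ∀ v, f v = c * extension α (fun i => α.eval (h i)) v := by
  have hd := distinctOffsets hk hkn
  obtain ⟨H, h, hH, hh⟩ := exists_generic_kernel (by omega) hκ.1 hS
    (fun s : Fin n × Fin 4 => degeneracyRow k A s.1 s.2)
    fun s t => degeneracyRow_ne_vecMul hA hk hkn hκ.1 s.1 s.2 t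
  refine ⟨H, h, hH, fun α hα hαH => ?_⟩
  obtain ⟨hker, hspan, hr⟩ := hh α hα hαH
  have hmem := extension_mem α fun i => α.eval (h i)
  have hK := (kasteleyn_eq_zero_iff κ α _).2 hker
  have hpair := pairing_coord_site α fun i => α.eval (h i)
  set f := extension α fun i => α.eval (h i) with hf
  have hev : ∀ c : ℂ, MvPolynomial.eval α.coord (C c) = c := fun c => eval_C c
  -- Deck translations only rescale, so each condition need be checked at the `n` base vertices.
  have hbase : ∀ v : ℤ × ℤ, ∃ (γ : deck n k) (j : Fin n), v = (γ : ℤ × ℤ) + (((j : ℕ) : ℤ), 0) :=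
    fun v => by
      obtain ⟨γ, hv, -⟩ := exists_deck_add n k v
      exact ⟨γ, _, hv⟩
  refine ⟨⟨hmem, hK, fun v => ?_, fun v heq => ?_, fun v heq => ?_, fun v heq => ?_⟩,
    fun f' hf' hK' => ?_⟩
  · obtain ⟨γ, j, rfl⟩ := hbase v
    rw [hmem γ]
    refine mul_ne_zero (α.val_ne_zero γ) ?_
    have := hr (j, 0)
    simp only [degeneracyRow, Matrix.cons_val, hpair] at this
    exact_mod_cast this
  · obtain ⟨γ, j, rfl⟩ := hbase v
    rw [add_assoc, lineAt_deck_add hmem, lineAt_deck_add hmem] at heq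
    have h0 := relation_of_horizontal_eq hA hd hκ hK (idx_coe (j : ℕ))
      (smul_right_injective _ (α.val_ne_zero γ) heq)
    have := hr (j, 1)
    simp only [degeneracyRow, Matrix.cons_val, hpair, pairing_add, pairing_smul, hev] at this
    refine this (Eq.trans ?_ h0)
    simp only [Prod.mk_add_mk, Nat.cast_add, Nat.cast_one, Nat.cast_zero, Nat.cast_ofNat, add_zero,
      zero_add]
    ring
  · obtain ⟨γ, j, rfl⟩ := hbase v
    rw [add_assoc, lineAt_deck_add hmem, lineAt_deck_add hmem] at heq
    have h0 := relation_of_vertical_eq hA hd hκ hK (idx_coe (j : ℕ))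
      (smul_right_injective _ (α.val_ne_zero γ) heq)
    have := hr (j, 2)
    simp only [degeneracyRow, Matrix.cons_val, hpair, pairing_add, pairing_smul, hev] at this
    refine this (Eq.trans ?_ h0)
    simp only [Prod.mk_add_mk, Nat.cast_add, Nat.cast_one, Nat.cast_zero, Nat.cast_ofNat, add_zero,
      zero_add]
    ring
  · obtain ⟨γ, j, rfl⟩ := hbase v
    rw [idx_deck_add, idx_coe, add_assoc (γ : ℤ × ℤ), hmem γ, hmem γ] at heq
    have := hr (j, 3)
    simp only [degeneracyRow, Matrix.cons_val, hpair, pairing_add, pairing_smul, hev] at this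
    refine this (mul_left_cancel₀ (α.val_ne_zero γ) (Eq.trans ?_ (heq.trans (mul_zero _).symm)))
    simp only [Prod.mk_add_mk, Nat.cast_add, Nat.cast_one, Nat.cast_zero, add_zero]
    ring
  · obtain ⟨c, hc⟩ := hspan (fun j => f' ((j : ℕ), 0)) ((kasteleyn_eq_zero_iff κ α _).1 (by
      rwa [extension_restrict hf']))
    refine ⟨c, fun v => ?_⟩
    have hdiff := eq_zero_of_restrict (α := α) (f := f' - c • f)
      (Submodule.sub_mem _ hf' (Submodule.smul_mem _ c hmem)) (fun j => by
        rw [Pi.sub_apply, Pi.smul_apply, hf, extension_apply_coe, smul_eq_mul]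
        exact sub_eq_zero.2 (hc j))
    exact sub_eq_zero.1 (congrFun hdiff v)

end GenericSolutions

/-! ### Black data from solutions of the Kasteleyn equation -/

section BlackData

open Matrix

variable {n k : ℕ} {P q : ProjTuple n} {A l : ZMod n → Fin 3 → ℂ} {κ : ZMod n → Fin 4 → ℂ}
  {α : H1 n k} {f : ℤ × ℤ → ℂ}

/-- Here `x - p` and `y - p` are nonzero multiples of `u × v` and `u' × v'`. The lines `p, x, y` are
therefore concurrent only if `p` passes through the intersection of the lines `uv` and `u'v'`. -/
theorem triple_ne_zero_of_sub {p x y u v u' v' : Fin 3 → ℂ} (h : crossProduct u v ≠ 0)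
    (h' : crossProduct u' v' ≠ 0)
    (hp : p ⬝ᵥ crossProduct (crossProduct u v) (crossProduct u' v') ≠ 0)
    (hxu : x ⬝ᵥ u = p ⬝ᵥ u) (hxv : x ⬝ᵥ v = p ⬝ᵥ v) (hyu : y ⬝ᵥ u' = p ⬝ᵥ u')
    (hyv : y ⬝ᵥ v' = p ⬝ᵥ v') (hx : x ≠ p) (hy : y ≠ p) : triple p x y ≠ 0 := by
  obtain ⟨s, hs⟩ := exists_smul_cross h (l := x - p) (by rw [sub_dotProduct, hxu, sub_self])
    (by rw [sub_dotProduct, hxv, sub_self])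
  obtain ⟨t, ht⟩ := exists_smul_cross h' (l := y - p) (by rw [sub_dotProduct, hyu, sub_self])
    (by rw [sub_dotProduct, hyv, sub_self])
  have hs0 : s ≠ 0 := fun h0 => hx (sub_eq_zero.1 (by rw [hs, h0, zero_smul]))
  have ht0 : t ≠ 0 := fun h0 => hy (sub_eq_zero.1 (by rw [ht, h0, zero_smul]))
  have key : triple p x y = triple p (x - p) (y - p) := by
    simp only [triple_eq, Pi.sub_apply]
    ring
  rw [key, hs, ht, triple, cross_smul_smul, dotProduct_smul, smul_eq_mul]
  exact mul_ne_zero (mul_ne_zero hs0 ht0) hp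

/-- The lines `uv` and `uw` meet at `u`, where `p` does not vanish. -/
theorem triple_ne_zero_of_sub_of_common {p x y u v w : Fin 3 → ℂ} (h : triple u v w ≠ 0)
    (hp : p ⬝ᵥ u ≠ 0) (hxu : x ⬝ᵥ u = p ⬝ᵥ u) (hxv : x ⬝ᵥ v = p ⬝ᵥ v) (hyu : y ⬝ᵥ u = p ⬝ᵥ u)
    (hyw : y ⬝ᵥ w = p ⬝ᵥ w) (hx : x ≠ p) (hy : y ≠ p) : triple p x y ≠ 0 := by
  refine triple_ne_zero_of_sub (cross_ne_zero_of_triple (u := w) ?_)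
    (cross_ne_zero_of_triple (u := v) ?_) ?_ hxu hxv hyu hyw hx hy
  · rwa [← triple_rotate]
  · rw [triple_swap]
    exact neg_ne_zero.2 h
  · rw [cross_cross_self, dotProduct_smul, smul_eq_mul]
    exact mul_ne_zero h hp

theorem cross_cross (a b c d : Fin 3 → ℂ) :
    crossProduct (crossProduct a b) (crossProduct c d) = triple a c d • b - triple b c d • a := by
  ext i
  fin_cases i <;> simp [triple_eq, cross_apply] <;> ring

theorem lineAt_smul (c : ℂ) (v : ℤ × ℤ) :
    lineAt k A (fun v => c * f v) v = c • lineAt k A f v := by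
  unfold lineAt
  simp only [mul_smul]
  rw [← smul_add, ← smul_add, smul_comm]

/-- Pairing the relation at a black vertex with its covector turns it into the Kasteleyn equation
for `fW`. -/
theorem IsTilingClass.exists_solution (h : IsTilingClass P q α) (hA : IsLift A P)
    (hAg : GeneralPosition A) (hd : DistinctOffsets n k) (hl : IsLift l q)
    (hκ : IsKasteleynWeights k A κ) : ∃ fW fB : ℤ × ℤ → ℂ, fW ∈ quasiPeriodic α ∧
      kasteleyn n k κ fW = 0 ∧ (∀ v, fW v ≠ 0) ∧ (∀ v, fB v ≠ 0) ∧
      ∀ v, fB v • l (idx n k v) = lineAt k A fW v := by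
  obtain ⟨fW, fB, hW, hB, hWq, -, hf⟩ := h.exists_of_isLift hA hl
  have hval : ∀ v e, fW (v + offset e)
      = fB v * (l (idx n k v) ⬝ᵥ A (whiteNbr n k (idx n k v) e)) := fun v e => by
    rw [hf, mul_inv_cancel_left₀ (hB v)]
  refine ⟨fW, fB, hWq, funext fun v => ?_, hW, hB, fun v => eq_lineAt hAg hd fun e => ?_⟩
  · change ∑ e : Fin 4, κ (idx n k v) e * fW (v + offset e) = 0
    have := congrArg (fun u => fB v * (l (idx n k v) ⬝ᵥ u)) (hκ.2 (idx n k v))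
    simp only [dotProduct_sum, dotProduct_smul, dotProduct_zero, mul_zero, smul_eq_mul] at this
    rw [← this, Finset.mul_sum]
    refine Finset.sum_congr rfl fun e _ => ?_
    rw [hval]
    ring
  · rw [hval, smul_dotProduct, smul_eq_mul]

theorem IsGenericSolution.lineAt_ne_zero (hA : GeneralPosition A) (hd : DistinctOffsets n k)
    (hf : IsGenericSolution A κ α f) (v : ℤ × ℤ) : lineAt k A f v ≠ 0 := fun h0 => by
  have h := lineAt_dot_zero (f := f) hA hd v
  rw [h0, zero_dotProduct] at h
  exact hf.ne_zero v h.symm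

/-- The lines at three consecutive black vertices of a column are not concurrent. -/
theorem IsGenericSolution.triple_vertical_ne_zero (hA : GeneralPosition A)
    (hd : DistinctOffsets n k) (hκ : IsKasteleynWeights k A κ) (hf : IsGenericSolution A κ α f)
    (v : ℤ × ℤ) : triple (lineAt k A f (v + (0, 1))) (lineAt k A f v)
      (lineAt k A f (v + (0, 2))) ≠ 0 := by
  have h2 : v + (0, 2) = v + (0, 1) + (0, 1) := by rw [add_assoc]; rfl
  have hij : ∀ i : ZMod n, crossProduct (A i) (A (i + 1)) ≠ 0 := fun i =>
    cross_ne_zero_of_triple (u := A (i + k)) (by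
      rw [← triple_rotate]
      exact hA.triple_zero_one_k hd i)
  rw [h2]
  -- The middle line agrees with the lower one on its own points `i, i + 1`, and with the upper one
  -- on `i + k, i + k + 1`; `crossing` keeps it off the intersection of the two lines spanned.
  refine triple_ne_zero_of_sub (hij (idx n k (v + (0, 1)))) (hij (idx n k (v + (0, 1)) + k))
    ?_ ?_ ?_ ?_ ?_ (hf.vertical v).symm (hf.vertical _)
  · rw [cross_cross, dotProduct_sub, dotProduct_smul, dotProduct_smul, lineAt_dot_zero hA hd,
      lineAt_dot_one hA hd]
    have := hf.crossing (v + (0, 1))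
    rw [smul_eq_mul, smul_eq_mul]
    rwa [← neg_ne_zero, neg_sub] at this
  · rw [lineAt_dot_zero hA hd, idx_add_k, lineAt_dot_k hA hd]
  · rw [lineAt_dot_one hA hd, idx_add_k, lineAt_dot_k_add_one hA hd hκ hf.ker, add_assoc]
    rfl
  · rw [← idx_add_k, lineAt_dot_zero hA hd, idx_add_k (v + (0, 1)), lineAt_dot_k hA hd]
  · rw [← idx_add_k, lineAt_dot_one hA hd, idx_add_k (v + (0, 1)),
      lineAt_dot_k_add_one hA hd hκ hf.ker, add_assoc]
    rfl

theorem eval_crossProduct (α : H1 n k) (x y : Fin 3 → Poly) :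
    (fun j => α.eval (crossProduct x y j))
      = crossProduct (fun j => α.eval (x j)) (fun j => α.eval (y j)) := by
  funext j
  fin_cases j <;> simp [cross_apply]

variable [NeZero n]

/-- The covectors at the black vertices `(i, 0)`, `0 ≤ i < n`. -/
def linesOf (k : ℕ) (A : ZMod n → Fin 3 → ℂ) (f : ℤ × ℤ → ℂ) : ZMod n → Fin 3 → ℂ := fun i =>
  lineAt k A f ((i.val : ℤ), 0)

theorem idx_val (i : ZMod n) : idx n k ((i.val : ℤ), 0) = i := by
  rw [idx_coe, ZMod.natCast_zmod_val]

theorem extension_one_ne_zero (α : H1 n k) (v : ℤ × ℤ) : extension α (fun _ => 1) v ≠ 0 :=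
  mul_ne_zero (zpow_ne_zero _ α.w_ne_zero)
    (mul_ne_zero (zpow_ne_zero _ α.z_ne_zero) one_ne_zero)

/-- The scale factor is what later serves as the potential `fB`. -/
theorem lineAt_eq_smul (hf : f ∈ quasiPeriodic α) (v : ℤ × ℤ) :
    lineAt k A f v = extension α (fun _ => 1) v • linesOf k A f (idx n k v) := by
  obtain ⟨γ, hv, hl, h2⟩ := exists_deck_add n k v
  have hval : (idx n k v).val = (residue n (v.1 + k * v.2) : ℕ) := by
    have h1 := residue_val (n := n) (v.1 + k * v.2)
    rw [← ZMod.val_intCast, ← idx_eq_intCast] at h1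
    exact_mod_cast h1.symm
  unfold linesOf
  rw [hval]
  conv_lhs => rw [hv, lineAt_deck_add hf, α.val_eq, hl, h2]
  unfold extension
  rw [mul_one, mul_comm]

theorem IsGenericSolution.isTilingClass (hA : GeneralPosition A) (hd : DistinctOffsets n k)
    (hκ : IsKasteleynWeights k A κ) (hf : IsGenericSolution A κ α f) (hP : IsLift A P)
    (hq : IsLift (linesOf k A f) q) : IsTilingClass P q α := by
  refine ⟨A, linesOf k A f, f, extension α fun _ => 1, hP, hq, hf.ne_zero,
    extension_one_ne_zero α, hf.mem, extension_mem α _, fun v e => ?_⟩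
  have := lineAt_dot hA hd hκ hf.ker v e
  rw [lineAt_eq_smul hf.mem, smul_dotProduct, smul_eq_mul] at this
  rw [idx_add_offset, ← this, inv_mul_cancel_left₀ (extension_one_ne_zero α v)]

theorem isLift_linesOf_lineAt (hf : f ∈ quasiPeriodic α) (hq : IsLift (linesOf k A f) q)
    {v : ℤ × ℤ} {i : ZMod n} (hi : idx n k v = i) :
    ∃ h : lineAt k A f v ≠ 0, Projectivization.mk ℂ (lineAt k A f v) h = q i := by
  subst hi
  have h0 : lineAt k A f v ≠ 0 := by
    rw [lineAt_eq_smul hf]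
    exact smul_ne_zero (extension_one_ne_zero α v) (hq.ne_zero _)
  refine ⟨h0, ?_⟩
  rw [hq.mk_eq]
  exact mk_smul_eq _ _ (lineAt_eq_smul hf v)

/-- The four covectors around `w` share their nonzero value at `A w`, and neighbours also agree at
one further point. Each triple consists of one covector and its two neighbours, so
`triple_ne_zero_of_sub_of_common` applies. -/
theorem IsGenericSolution.isBlackCircuit (hA : GeneralPosition A) (hd : DistinctOffsets n k)
    (hκ : IsKasteleynWeights k A κ) (hf : IsGenericSolution A κ α f)
    (hq : IsLift (linesOf k A f) q) : IsBlackCircuit k q := by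
  intro w
  -- With this `m` the vertex `w` is lifted to `(m + 1, 1)`, and its black neighbours are the
  -- corners of a unit square based at `(m, 0)`.
  obtain ⟨m, hm⟩ := ZMod.intCast_surjective (w - (k : ZMod n) - 1)
  have key : ∀ (v x : ℤ × ℤ) (j : ZMod n) (e : Fin 4), whiteNbr n k (idx n k v) e = j →
      v + offset e = x → lineAt k A f v ⬝ᵥ A j = f x := by
    rintro v _ _ e rfl rfl
    exact lineAt_dot hA hd hκ hf.ker v e
  set a := lineAt k A f (m + 1, 1) with ha
  set b := lineAt k A f (m, 1) with hb
  set d := lineAt k A f (m + 1, 0) with hdd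
  set c := lineAt k A f (m, 0) with hc
  have hab : a ≠ b := by simpa using hf.horizontal (m, 1)
  have hdc : d ≠ c := by simpa using hf.horizontal (m, 0)
  have had : a ≠ d := by simpa using hf.vertical (m + 1, 0)
  have hbc : b ≠ c := by simpa using hf.vertical (m, 0)
  have au : a ⬝ᵥ A w = f (m + 1, 1) :=
    key _ _ _ 0 (by simp [whiteNbr_eq, idx, hm]) (by simp [offset])
  have bu : b ⬝ᵥ A w = f (m + 1, 1) :=
    key _ _ _ 1 (by simp [whiteNbr_eq, idx, hm]; ring) (by simp [offset])
  have du : d ⬝ᵥ A w = f (m + 1, 1) :=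
    key _ _ _ 2 (by simp [whiteNbr_eq, idx, hm]) (by simp [offset])
  have cu : c ⬝ᵥ A w = f (m + 1, 1) :=
    key _ _ _ 3 (by simp [whiteNbr_eq, idx, hm]) (by simp [offset])
  have a1 : a ⬝ᵥ A (w + 1) = f (m + 2, 1) :=
    key _ _ _ 1 (by simp [whiteNbr_eq, idx, hm]) (by simp [offset]; ring)
  have d1 : d ⬝ᵥ A (w + 1) = f (m + 2, 1) :=
    key _ _ _ 3 (by simp [whiteNbr_eq, idx, hm]; ring) (by simp [offset]; ring)
  have ak : a ⬝ᵥ A (w + k) = f (m + 1, 2) :=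
    key _ _ _ 2 (by simp [whiteNbr_eq, idx, hm]) (by simp [offset])
  have bk : b ⬝ᵥ A (w + k) = f (m + 1, 2) :=
    key _ _ _ 3 (by simp [whiteNbr_eq, idx, hm]; ring) (by simp [offset])
  have b1 : b ⬝ᵥ A (w + -1) = f (m, 1) :=
    key _ _ _ 0 (by simp [whiteNbr_eq, idx, hm]; ring) (by simp [offset])
  have c1 : c ⬝ᵥ A (w + -1) = f (m, 1) :=
    key _ _ _ 2 (by simp [whiteNbr_eq, idx, hm]; ring) (by simp [offset])
  have dk : d ⬝ᵥ A (w + -k) = f (m + 1, 0) :=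
    key _ _ _ 0 (by simp [whiteNbr_eq, idx, hm]; ring) (by simp [offset])
  have ck : c ⬝ᵥ A (w + -k) = f (m + 1, 0) :=
    key _ _ _ 1 (by simp [whiteNbr_eq, idx, hm]; ring) (by simp [offset])
  have hu := hf.ne_zero (m + 1, 1)
  have htr : ∀ {x y : ZMod n}, x ≠ 0 → y ≠ 0 → x ≠ y →
      triple (A w) (A (w + x)) (A (w + y)) ≠ 0 := fun {x y} hx hy hxy => by
    have := hA.triple_add_ne_zero w hx.symm hy.symm hxy
    rwa [add_zero] at this
  have hk1 : (k : ZMod n) ≠ -1 := fun h => hd.k_add_one_ne (by rw [h, neg_add_cancel])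
  have h1k : (1 : ZMod n) ≠ -k := fun h => hd.k_add_one_ne (by linear_combination h)
  have h11 : (-1 : ZMod n) ≠ -k := fun h => hd.k_ne_one (by linear_combination h)
  refine isCircuit_of_triple (v := ![a, b, d, c]) (fun e => ?_) ?_ ?_ ?_ ?_
  · rw [blackNbr_eq]
    fin_cases e
    · exact isLift_linesOf_lineAt hf.mem hq (by simp [idx, hm])
    · exact isLift_linesOf_lineAt hf.mem hq (by simp [idx, hm]; ring)
    · exact isLift_linesOf_lineAt hf.mem hq (by simp [idx, hm])
    · exact isLift_linesOf_lineAt hf.mem hq (by simp [idx, hm]; ring)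
  · exact triple_ne_zero_of_sub_of_common (htr hd.k_ne hd.one_ne hd.k_ne_one) (au ▸ hu)
      (bu.trans au.symm) (bk.trans ak.symm) (du.trans au.symm) (d1.trans a1.symm) hab.symm had.symm
  · change triple a b c ≠ 0
    rw [triple_swap]
    exact neg_ne_zero.2 (triple_ne_zero_of_sub_of_common
      (htr hd.k_ne (neg_ne_zero.2 hd.one_ne) hk1) (bu ▸ hu)
      (au.trans bu.symm) (ak.trans bk.symm) (cu.trans bu.symm) (c1.trans b1.symm) hab hbc.symm)
  · change triple a d c ≠ 0
    rw [triple_swap]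
    exact neg_ne_zero.2 (triple_ne_zero_of_sub_of_common
      (htr hd.one_ne (neg_ne_zero.2 hd.k_ne) h1k) (du ▸ hu)
      (au.trans du.symm) (a1.trans d1.symm) (cu.trans du.symm) (ck.trans dk.symm) had hdc.symm)
  · change triple b d c ≠ 0
    rw [← triple_rotate, ← triple_rotate]
    exact triple_ne_zero_of_sub_of_common
      (htr (neg_ne_zero.2 hd.one_ne) (neg_ne_zero.2 hd.k_ne) h11) (cu ▸ hu)
      (bu.trans cu.symm) (b1.trans c1.symm) (du.trans cu.symm) (dk.trans ck.symm) hbc hdc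

theorem IsGenericSolution.triple_linesOf_ne_zero (hA : GeneralPosition A)
    (hd : DistinctOffsets n k) (hκ : IsKasteleynWeights k A κ) (hf : IsGenericSolution A κ α f)
    (i : ZMod n) : triple (linesOf k A f i) (linesOf k A f (i - k)) (linesOf k A f (i + k)) ≠ 0 := by
  obtain ⟨m, hm⟩ := ZMod.intCast_surjective (i - (k : ZMod n))
  have h := hf.triple_vertical_ne_zero hA hd hκ (m, 0)
  have h0 : idx n k (m, 0) = i - k := by simp [idx, hm]
  have h1 : idx n k ((m, 0) + (0, 1)) = i := by simp [idx, hm]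
  have h2 : idx n k ((m, 0) + (0, 2)) = i + k := by simp [idx, hm]; ring
  rw [lineAt_eq_smul hf.mem, lineAt_eq_smul hf.mem, lineAt_eq_smul hf.mem, h0, h1, h2, triple,
    cross_smul_smul, dotProduct_smul, smul_dotProduct, smul_eq_mul, smul_eq_mul] at h
  exact right_ne_zero_of_mul (right_ne_zero_of_mul h)

/-! ### Polynomial parametrizations -/

/-- The value at `(a, b)` of the quasi-periodic function with polynomial values at `(j, 0)`. -/
def sitePoly (k : ℕ) (h : Fin n → Poly) (a b : ℕ) : Poly := ∑ j, site n k a b j * h j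

theorem eval_sitePoly (α : H1 n k) (h : Fin n → Poly) (a b : ℕ) :
    α.eval (sitePoly k h a b) = extension α (fun i => α.eval (h i)) (a, b) := by
  rw [← pairing_coord_site]
  simp only [sitePoly, map_sum, map_mul]
  rfl

/-- The coordinates of the lines as polynomials. -/
def linePoly (k : ℕ) (A : ZMod n → Fin 3 → ℂ) (h : Fin n → Poly) (i : ZMod n) (j : Fin 3) : Poly :=
  MvPolynomial.C (triple (A i) (A (i + 1)) (A (i + k)))⁻¹ *
    (sitePoly k h i.val 0 * MvPolynomial.C (crossProduct (A (i + 1)) (A (i + k)) j)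
      + sitePoly k h (i.val + 1) 0 * MvPolynomial.C (crossProduct (A (i + k)) (A i) j)
      + sitePoly k h i.val 1 * MvPolynomial.C (crossProduct (A i) (A (i + 1)) j))

theorem eval_linePoly (α : H1 n k) (h : Fin n → Poly) (i : ZMod n) :
    (fun j => α.eval (linePoly k A h i j))
      = linesOf k A (extension α fun i => α.eval (h i)) i := by
  funext j
  simp only [linePoly, linesOf, lineAt, idx_val, map_mul, map_add, H1.eval_C, eval_sitePoly,
    Pi.smul_apply, Pi.add_apply, smul_eq_mul, Nat.cast_zero, Nat.cast_one, Nat.cast_add,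
    Prod.mk_add_mk, add_zero, zero_add]

/-- Solutions of the Kasteleyn equation give black data with the prescribed class. -/
theorem IsGenericSolution.mem_blackData (hk : 2 ≤ k) (hkn : k + 2 ≤ n) (hA : GeneralPosition A)
    (hκ : IsKasteleynWeights k A κ) (hf : IsGenericSolution A κ α f) (hP : IsLift A P)
    (hq : IsLift (linesOf k A f) q) : q ∈ blackData k P :=
  ⟨hA.isWhiteCircuit hk hkn hP, hf.isBlackCircuit hA (distinctOffsets hk hkn) hκ hq,
    (hf.isTilingClass hA (distinctOffsets hk hkn) hκ hP hq).isCoherent⟩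

/-- The potential `fW` of the tiling is a solution, hence a nonzero multiple of `f`, and a solution
determines its lines. This gives injectivity of 𝓕 over generic points. -/
theorem IsTilingClass.isLift_linesOf (h : IsTilingClass P q α) (hP : IsLift A P)
    (hA : GeneralPosition A) (hd : DistinctOffsets n k) (hκ : IsKasteleynWeights k A κ)
    (hspan : ∀ f' ∈ quasiPeriodic α, kasteleyn n k κ f' = 0 → ∃ c : ℂ, ∀ v, f' v = c * f v) :
    IsLift (linesOf k A f) q := by
  obtain ⟨fW, fB, hWq, hK, hW, hB, hl⟩ := h.exists_solution hP hA hd (isLift_rep q) hκ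
  obtain ⟨c, hc⟩ := hspan fW hWq hK
  obtain rfl : fW = fun v => c * f v := funext hc
  have hc0 : c ≠ 0 := left_ne_zero_of_mul (hW 0)
  convert (isLift_rep q).smul (c := fun i => c⁻¹ * fB ((i.val : ℤ), 0))
    (fun i => mul_ne_zero (inv_ne_zero hc0) (hB _)) using 2 with i
  have := hl ((i.val : ℤ), 0)
  rw [idx_val, lineAt_smul] at this
  rw [mul_smul, this, inv_smul_smul₀ hc0]
  rfl

theorem IsTilingClass.mem_zeroSet (h : IsTilingClass P q α) (hP : IsLift A P)
    (hA : GeneralPosition A) (hd : DistinctOffsets n k) (hκ : IsKasteleynWeights k A κ) :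
    α ∈ zeroSet n k (kdet k κ) := by
  obtain ⟨fW, -, hWq, hK, hW, -⟩ := h.exists_solution hP hA hd (isLift_rep q) hκ
  exact (eval_kdet_coord_eq_zero_iff κ α).2 ⟨fW, hWq, fun h0 => hW 0 (congrFun h0 0), hK⟩

end BlackData

/-! ### Inscribed polygons -/

section Inscribed

open Matrix

variable {n k : ℕ} {P Q q : ProjTuple n} {A B l : ZMod n → Fin 3 → ℂ}

theorem cross_cross_middle (u v w : Fin 3 → ℂ) :
    crossProduct (crossProduct u v) (crossProduct v w) = triple u v w • v := by
  ext i
  fin_cases i <;> simp [triple_eq, cross_apply] <;> ring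

theorem cross_dot_cross_eq (u v x y : Fin 3 → ℂ) :
    crossProduct u v ⬝ᵥ crossProduct x y = (x ⬝ᵥ u) * (y ⬝ᵥ v) - (x ⬝ᵥ v) * (y ⬝ᵥ u) := by
  simp only [dot_eq, cross_zero, cross_one, cross_two]
  ring

theorem IsLift.cross_comp (h : IsLift l q) {a b : ZMod n → ZMod n}
    (hne : ∀ i, crossProduct (l (a i)) (l (b i)) ≠ 0) :
    IsLift (fun i => crossProduct (l (a i)) (l (b i)))
      (fun i => Projectivization.cross (q (a i)) (q (b i)) : ProjTuple n) := fun i =>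
  ⟨hne i, by
    change Projectivization.mk ℂ _ (hne i) = Projectivization.cross (q (a i)) (q (b i))
    rw [h.mk_eq (a i), h.mk_eq (b i), Projectivization.cross_mk_of_cross_ne_zero _ _ (hne i)]⟩

theorem IsLift.ne_iff (h : IsLift l q) (i j : ZMod n) :
    q i ≠ q j ↔ crossProduct (l i) (l j) ≠ 0 := by
  rw [h.mk_eq i, h.mk_eq j, Ne, mk_eq_mk_iff_cross]

theorem IsLift.orthogonal_iff (hA : IsLift A P) (hl : IsLift l q) (i j : ZMod n) :
    Projectivization.orthogonal (q i) (P j) ↔ l i ⬝ᵥ A j = 0 := by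
  rw [hA.mk_eq j, hl.mk_eq i, Projectivization.orthogonal_mk]

theorem inscribed_iff (hA : IsLift A P) (hB : IsLift B Q) : Inscribed Q P ↔
    ∀ i, crossProduct (A i) (A (i + 1)) ≠ 0 ∧ crossProduct (A i) (A (i + 1)) ⬝ᵥ B i = 0 := by
  refine forall_congr' fun i => ?_
  rw [hA.ne_iff]
  refine and_congr_right fun h => ?_
  rw [hA.mk_eq i, hA.mk_eq (i + 1), hB.mk_eq i, Projectivization.cross_mk_of_cross_ne_zero _ _ h,
    Projectivization.orthogonal_mk]

theorem IsBlackCircuit.ne (h : IsBlackCircuit k q) (i : ZMod n) :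
    q i ≠ q (i + 1) ∧ q (i - k) ≠ q i := by
  have h1 := (h (i + 1)).ne (show (1 : Fin 4) ≠ 0 by decide)
  have h2 := (h i).ne (show (2 : Fin 4) ≠ 0 by decide)
  simp only [blackNbr_eq, Matrix.cons_val, sub_zero, add_sub_cancel_right] at h1 h2
  exact ⟨h1, h2⟩

/-- Coherence in terms of lifts. -/
theorem isCoherent_iff (hA : IsLift A P) (hl : IsLift l q)
    (hne : ∀ v e, l v ⬝ᵥ A (whiteNbr n k v e) ≠ 0) : IsCoherent k P q ↔ ∀ i,
      crossProduct (A i) (A (i + 1)) ⬝ᵥ crossProduct (l (i - k)) (l i) = 0 ∧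
      crossProduct (A i) (A (i + k)) ⬝ᵥ crossProduct (l (i - 1)) (l i) = 0 := by
  have e0 : ∀ v, l v ⬝ᵥ A v ≠ 0 := fun v => by simpa [whiteNbr_eq] using hne v 0
  have e1 : ∀ v, l (v - 1) ⬝ᵥ A v ≠ 0 := fun v => by simpa [whiteNbr_eq] using hne (v - 1) 1
  have ek : ∀ v, l (v - k) ⬝ᵥ A (v + 1) ≠ 0 := fun v => by
    have := hne (v - k) 3
    rw [whiteNbr_eq] at this
    simp only [Matrix.cons_val] at this
    rwa [show v - (k : ZMod n) + (k + 1) = v + 1 by ring] at this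
  have ek' : ∀ v, l v ⬝ᵥ A (v + k) ≠ 0 := fun v => by simpa [whiteNbr_eq] using hne v 2
  refine forall_congr' fun i => ?_
  -- By Lagrange's identity, equality of the two products of pairings says that the meeting point of
  -- two lines is on the line through two points.
  rw [hA.mk_eq i, hA.mk_eq (i + 1), hA.mk_eq (i + k), hl.mk_eq i, hl.mk_eq (i - k),
    hl.mk_eq (i - 1), multiRatio_mk, multiRatio_mk,
    div_eq_one_iff_eq (mul_ne_zero (ek i) (e0 i)), div_eq_one_iff_eq (mul_ne_zero (ek' i) (e1 i)),
    cross_dot_cross_eq, cross_dot_cross_eq, sub_eq_zero, sub_eq_zero]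
  refine and_congr_right fun _ => ⟨fun h => ?_, fun h => ?_⟩ <;> linear_combination -h

theorem GeneralPosition.cross_ne_zero (hA : GeneralPosition A) (hd : DistinctOffsets n k)
    (i : ZMod n) : crossProduct (A i) (A (i + 1)) ≠ 0 ∧ crossProduct (A i) (A (i + k)) ≠ 0 := by
  have h := hA.triple_zero_one_k hd i
  refine ⟨cross_ne_zero_of_triple (u := A (i + k)) ?_,
    cross_ne_zero_of_triple (u := A (i + 1)) ?_⟩
  · rwa [← triple_rotate]
  · rw [triple_swap]
    exact neg_ne_zero.2 h

theorem GeneralPosition.cross_diagonals_ne_zero (hA : GeneralPosition A)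
    (hd : DistinctOffsets n k) (i : ZMod n) :
    crossProduct (crossProduct (A i) (A (i + k)))
      (crossProduct (A (i + 1)) (A (i + 1 + k))) ≠ 0 := by
  intro h
  -- The intersection of the two diagonals is off the line `A_i A_{i+1}`, so pairing with that line
  -- detects it.
  have h1 := congrArg (fun u => crossProduct (A i) (A (i + 1)) ⬝ᵥ u) h
  have h2 : crossProduct (A i) (A (i + 1)) ⬝ᵥ A i = 0 := by
    simp only [dot_eq, cross_zero, cross_one, cross_two]
    ring
  have h3 : crossProduct (A i) (A (i + 1)) ⬝ᵥ A (i + k) = triple (A i) (A (i + 1)) (A (i + k)) := by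
    simp only [dot_eq, cross_zero, cross_one, cross_two, triple_eq]
    ring
  rw [cross_cross] at h1
  simp only [dotProduct_sub, dotProduct_smul, h2, h3, smul_eq_mul, mul_zero, sub_zero,
    dotProduct_zero] at h1
  refine mul_ne_zero ?_ (hA.triple_zero_one_k hd i) h1
  have := hA.triple_add_ne_zero i hd.one_ne.symm hd.k_add_one_ne.symm
    (show (1 : ZMod n) ≠ k + 1 from fun h => hd.k_ne (by linear_combination -h))
  rwa [add_zero, ← add_assoc, add_right_comm i (k : ZMod n) 1] at this

/-- A lift of the image of a polygon under the pentagram map. -/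
theorem isLift_pentagramMap (hA : IsLift A P)
    (hne : ∀ i, crossProduct (A i) (A (i + k)) ≠ 0)
    (hne' : ∀ i, crossProduct (crossProduct (A i) (A (i + k)))
      (crossProduct (A (i + 1)) (A (i + 1 + k))) ≠ 0) :
    IsLift (fun i => crossProduct (crossProduct (A i) (A (i + k)))
      (crossProduct (A (i + 1)) (A (i + 1 + k)))) (pentagramMap k P) :=
  (hA.cross_comp (a := fun i => i) (b := fun i => i + k) hne).cross_comp (a := fun i => i)
    (b := fun i => i + 1) hne'

theorem isLift_pentagramMap_of_diagonals (hl : IsLift l (diagonals k Q))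
    (hne : ∀ i, crossProduct (l i) (l (i + 1)) ≠ 0) :
    IsLift (fun i => crossProduct (l i) (l (i + 1))) (pentagramMap k Q) :=
  hl.cross_comp (a := fun i => i) (b := fun i => i + 1) hne

/-- The lines of a nondegenerate inscribed polygon are black data. -/
theorem diagonals_mem_blackData (hk : 2 ≤ k) (hkn : k + 2 ≤ n) (hP : IsLift A P)
    (hA : GeneralPosition A) (hQ : Q ∈ inscribedFamily k P) : diagonals k Q ∈ blackData k P := by
  have hd := distinctOffsets hk hkn
  obtain ⟨hQne, hort, hcirc, hins, hinsT⟩ := hQ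
  have hB := isLift_rep Q
  set B : ZMod n → Fin 3 → ℂ := fun i => (Q i).rep
  have hl := hB.cross hQne
  set l : ZMod n → Fin 3 → ℂ := fun i => crossProduct (B i) (B (i + k)) with hldef
  have hne : ∀ i, crossProduct (l i) (l (i + 1)) ≠ 0 := fun i =>
    (hl.ne_iff _ _).1 (hcirc.ne i).1
  refine ⟨hA.isWhiteCircuit hk hkn hP, hcirc, (isCoherent_iff hP hl fun v e h =>
    hort v e ((hP.orthogonal_iff hl _ _).2 h)).2 fun i => ⟨?_, ?_⟩⟩
  · have h := ((inscribed_iff hP hB).1 hins i).2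
    have hm : crossProduct (l (i - k)) (l i) = triple (B (i - k)) (B i) (B (i + k)) • B i := by
      simp only [hldef, sub_add_cancel]
      exact cross_cross_middle _ _ _
    rw [hm, dotProduct_smul, h, smul_zero]
  -- The side of `T_k(P)` joining the vertices `i - 1` and `i` is the diagonal `P_i P_{i+k}`, up to
  -- a factor that is nonzero because the side is defined.
  · have h := (inscribed_iff (isLift_pentagramMap hP (fun i => (hA.cross_ne_zero hd i).2)
      (hA.cross_diagonals_ne_zero hd)) (isLift_pentagramMap_of_diagonals hl hne)).1 hinsT (i - 1)
    rw [cross_cross_middle, sub_add_cancel] at h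
    exact (mul_eq_zero.1 ((smul_dotProduct _ _ _).symm.trans h.2)).resolve_left
      (left_ne_zero_of_smul h.1)

/-- The vertices of a polygon are the intersections of its diagonals. -/
theorem eq_cross_diagonals (hQ : ∀ i, Q i ≠ Q (i + k))
    (hne : ∀ i, diagonals k Q (i - k) ≠ diagonals k Q i) (i : ZMod n) :
    Projectivization.cross (diagonals k Q (i - k)) (diagonals k Q i) = Q i := by
  have hB := isLift_rep Q
  have hl := hB.cross hQ
  have h := (hl.cross_comp (a := fun i => i - k) (b := fun i => i)
    fun i => (hl.ne_iff _ _).1 (hne i)).mk_eq i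
  refine h.trans ((mk_smul_eq
    (c := triple (Q (i - k)).rep (Q i).rep (Q (i + k)).rep) _ (hB.ne_zero i) ?_).trans (hB.mk_eq i).symm)
  simp only [sub_add_cancel]
  exact cross_cross_middle _ _ _

/-- The polygon whose diagonals are given lines. -/
def polygonOf (k : ℕ) (q : ProjTuple n) : ProjTuple n := fun i : ZMod n =>
  Projectivization.cross (q (i - (k : ZMod n))) (q i)

theorem isLift_polygonOf (hl : IsLift l q)
    (ht : ∀ i, triple (l i) (l (i - k)) (l (i + k)) ≠ 0) :
    IsLift (fun i : ZMod n => crossProduct (l (i - k)) (l i)) (polygonOf k q) :=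
  hl.cross_comp (a := fun i => i - k) (b := fun i => i) fun i =>
    cross_ne_zero_of_triple (u := l (i + k)) (by
      have := ht i
      rw [triple_swap, ← triple_rotate] at this
      rw [← triple_rotate]
      have h2 := neg_ne_zero.1 this
      rwa [← triple_rotate, ← triple_rotate] at h2)

/-- Both intersection points lie on `l i`, so they span it when the three lines are not concurrent.
-/
theorem cross_polygonOf (l : ZMod n → Fin 3 → ℂ) (i : ZMod n) :
    crossProduct (crossProduct (l (i - k)) (l i)) (crossProduct (l (i + k - k)) (l (i + k)))
      = (-triple (l i) (l (i - k)) (l (i + k))) • l i := by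
  rw [add_sub_cancel_right, cross_cross_middle, triple_swap]

theorem polygonOf_ne (hl : IsLift l q) (ht : ∀ i, triple (l i) (l (i - k)) (l (i + k)) ≠ 0)
    (i : ZMod n) : polygonOf k q i ≠ polygonOf k q (i + k) := by
  rw [(isLift_polygonOf hl ht).ne_iff, cross_polygonOf]
  exact smul_ne_zero (neg_ne_zero.2 (ht i)) (hl.ne_zero i)

theorem diagonals_polygonOf (hl : IsLift l q)
    (ht : ∀ i, triple (l i) (l (i - k)) (l (i + k)) ≠ 0) : diagonals k (polygonOf k q) = q := by
  have h := (isLift_polygonOf hl ht).cross (polygonOf_ne hl ht)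
  funext i
  rw [h.mk_eq i, hl.mk_eq i]
  exact mk_smul_eq _ _ (cross_polygonOf l i)

/-- Black data without three concurrent consecutive lines come from an inscribed polygon. -/
theorem polygonOf_mem_inscribedFamily (hd : DistinctOffsets n k) (hP : IsLift A P)
    (hA : GeneralPosition A) (hD : ∀ i, triple (crossProduct (A i) (A (i + k)))
      (crossProduct (A (i + 1)) (A (i + 1 + k)))
      (crossProduct (A (i + 1 + 1)) (A (i + 1 + 1 + k))) ≠ 0)
    (hq : q ∈ blackData k P) (hl : IsLift l q)
    (hne : ∀ v e, l v ⬝ᵥ A (whiteNbr n k v e) ≠ 0)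
    (ht : ∀ i, triple (l i) (l (i - k)) (l (i + k)) ≠ 0) :
    polygonOf k q ∈ inscribedFamily k P := by
  obtain ⟨-, hcirc, hcoh⟩ := hq
  have hcoh := (isCoherent_iff hP hl hne).1 hcoh
  have hdiag := diagonals_polygonOf hl ht
  refine ⟨polygonOf_ne hl ht, fun v e => ?_, by rwa [hdiag], ?_, ?_⟩
  · rw [hdiag, hP.orthogonal_iff hl]
    exact hne v e
  · exact (inscribed_iff hP (isLift_polygonOf hl ht)).2 fun i =>
      ⟨(hA.cross_ne_zero hd i).1, (hcoh i).1⟩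
  · refine (inscribed_iff (isLift_pentagramMap hP (fun i => (hA.cross_ne_zero hd i).2)
      (hA.cross_diagonals_ne_zero hd)) (isLift_pentagramMap_of_diagonals (by rwa [hdiag])
      fun i => (hl.ne_iff _ _).1 (hcirc.ne i).1)).2 fun i => ?_
    rw [cross_cross_middle]
    -- Non-concurrency of three consecutive diagonals of `P` means that consecutive vertices of
    -- `T_k(P)` are distinct.
    refine ⟨smul_ne_zero (hD i) (hA.cross_ne_zero hd _).2, ?_⟩
    have := (hcoh (i + 1)).2
    rw [add_sub_cancel_right] at this
    rw [smul_dotProduct, this, smul_zero]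

end Inscribed

/-! ### Generic polygons -/

section Generic

open Matrix

variable {n : ℕ}

/-- The triple product of vectors of polynomials. -/
def polyTriple (u v w : Fin 3 → MvPolynomial (ZMod n × Fin 3) ℂ) : MvPolynomial (ZMod n × Fin 3) ℂ :=
  u ⬝ᵥ crossProduct v w

/-- The `i`-th vector of indeterminates. -/
def polyVec (i : ZMod n) : Fin 3 → MvPolynomial (ZMod n × Fin 3) ℂ := fun j => MvPolynomial.X (i, j)

theorem evalLift_polyVec (i : ZMod n) (A : ZMod n → Fin 3 → ℂ) :
    (fun j => evalLift (polyVec i j) A) = A i := funext fun j => evalLift_X i j A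

theorem evalLift_crossProduct (u v : Fin 3 → MvPolynomial (ZMod n × Fin 3) ℂ)
    (A : ZMod n → Fin 3 → ℂ) : (fun j => evalLift (crossProduct u v j) A)
      = crossProduct (fun j => evalLift (u j) A) (fun j => evalLift (v j) A) := by
  funext j
  fin_cases j <;> simp [cross_apply, evalLift]

theorem evalLift_polyTriple (u v w : Fin 3 → MvPolynomial (ZMod n × Fin 3) ℂ)
    (A : ZMod n → Fin 3 → ℂ) : evalLift (polyTriple u v w) A
      = triple (fun j => evalLift (u j) A) (fun j => evalLift (v j) A)
        (fun j => evalLift (w j) A) := by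
  rw [triple, ← evalLift_crossProduct]
  simp [polyTriple, evalLift, dotProduct]

theorem triple_smul_smul_smul (a b c : ℂ) (u v w : Fin 3 → ℂ) :
    triple (a • u) (b • v) (c • w) = (a * (b * c)) * triple u v w := by
  rw [triple, cross_smul_smul, dotProduct_smul, smul_dotProduct, smul_eq_mul, smul_eq_mul, triple]
  ring

theorem ne_zero_of_evalLift {F : MvPolynomial (ZMod n × Fin 3) ℂ} {A : ZMod n → Fin 3 → ℂ}
    (h : evalLift F A ≠ 0) : F ≠ 0 := by
  rintro rfl
  exact h (map_zero _)

theorem polyTriple_polyVec_ne_zero {i j l : ZMod n} (hij : i ≠ j) (hil : i ≠ l) (hjl : j ≠ l) :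
    polyTriple (polyVec i) (polyVec j) (polyVec l) ≠ 0 := by
  refine ne_zero_of_evalLift (A := fun x => if x = i then ![1, 0, 0] else
    if x = j then ![0, 1, 0] else ![0, 0, 1]) ?_
  simp [evalLift_polyTriple, evalLift_polyVec, hij.symm, hil.symm, hjl.symm, triple_eq]

theorem scaleInvariant_polyTriple_polyVec (i j l : ZMod n) :
    ScaleInvariant (polyTriple (polyVec i) (polyVec j) (polyVec l)) := fun c hc A => by
  simp only [evalLift_polyTriple, evalLift_polyVec, rescale, triple_smul_smul_smul]
  exact mul_ne_zero_iff_left (mul_ne_zero (hc _) (mul_ne_zero (hc _) (hc _)))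

/-- The triple product of three consecutive diagonals, as a polynomial. -/
def diagonalPoly (k : ℕ) (i : ZMod n) : MvPolynomial (ZMod n × Fin 3) ℂ :=
  polyTriple (crossProduct (polyVec i) (polyVec (i + k)))
    (crossProduct (polyVec (i + 1)) (polyVec (i + 1 + k)))
    (crossProduct (polyVec (i + 1 + 1)) (polyVec (i + 1 + 1 + k)))

variable {k : ℕ}

theorem evalLift_diagonalPoly (i : ZMod n) (A : ZMod n → Fin 3 → ℂ) :
    evalLift (diagonalPoly k i) A = triple (crossProduct (A i) (A (i + k)))
      (crossProduct (A (i + 1)) (A (i + 1 + k)))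
      (crossProduct (A (i + 1 + 1)) (A (i + 1 + 1 + k))) := by
  rw [diagonalPoly, evalLift_polyTriple, evalLift_crossProduct, evalLift_crossProduct,
    evalLift_crossProduct]
  simp only [evalLift_polyVec]

theorem scaleInvariant_diagonalPoly (i : ZMod n) : ScaleInvariant (diagonalPoly k i) :=
  fun c hc A => by
    simp only [evalLift_diagonalPoly, rescale, cross_smul_smul, triple_smul_smul_smul]
    exact mul_ne_zero_iff_left (by simp [hc])

theorem diagonalPoly_ne_zero (hd : DistinctOffsets n k) (hkk : (k : ZMod n) + k ≠ 0)
    (i : ZMod n) : diagonalPoly k i ≠ 0 := by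
  -- A test polygon; the order of the cases handles the coincidences `k = 2` and `k + 2 = 0`, which
  -- exclude each other as `2 k ≠ 0`.
  set A : ZMod n → Fin 3 → ℂ := fun x =>
    if x - i = 0 then ![1, 0, 0] else if x - i = k then ![0, 1, 0] else
      if x - i = 1 then ![1, -1, 0] else
        if x - i = k + 1 ∨ x - i = 2 then ![0, 0, 1] else ![1, 0, 1] with hA
  refine ne_zero_of_evalLift (A := A) ?_
  have h12 : (2 : ZMod n) ≠ 1 := fun h => hd.one_ne (by linear_combination h)
  have a0 : A i = ![1, 0, 0] := by simp [hA]
  have ak : A (i + k) = ![0, 1, 0] := by simp [hA, hd.k_ne]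
  have a1 : A (i + 1) = ![1, -1, 0] := by simp [hA, hd.one_ne, hd.k_ne_one.symm]
  have ak1 : A (i + 1 + k) = ![0, 0, 1] := by
    simp only [hA, show i + 1 + (k : ZMod n) - i = k + 1 by ring]
    simp [hd.k_add_one_ne, hd.one_ne, hd.k_ne]
  have a2 : A (i + 1 + 1) = if (2 : ZMod n) = k then ![0, 1, 0] else ![0, 0, 1] := by
    simp only [hA, show i + 1 + 1 - i = 2 by ring]
    simp [hd.two_ne, h12]
  have ak2 : A (i + 1 + 1 + k) = if (k : ZMod n) + 2 = 0 then ![1, 0, 0] else ![1, 0, 1] := by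
    simp only [hA, show i + 1 + 1 + (k : ZMod n) - i = k + 2 by ring]
    have h1 : (k : ZMod n) + 2 ≠ 1 := fun h => hd.k_add_one_ne (by linear_combination h)
    simp [hd.two_ne, h1, h12, hd.k_ne]
  rw [evalLift_diagonalPoly, a0, ak, a1, ak1, a2, ak2]
  by_cases h2 : (2 : ZMod n) = k
  · have h3 : (k : ZMod n) + 2 ≠ 0 := fun h => hkk (by rw [← h, ← h2])
    rw [if_pos h2, if_neg h3]
    simp [triple_eq, cross_apply]
  · rw [if_neg h2]
    split_ifs <;> simp [triple_eq, cross_apply]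

/-- General position of the vertices, and of consecutive diagonals unless `2 k = n`, is a generic
condition. -/
theorem exists_generic_poly [NeZero n] (hd : DistinctOffsets n k) :
    ∃ F : MvPolynomial (ZMod n × Fin 3) ℂ, F ≠ 0 ∧ ScaleInvariant F ∧ ∀ A, evalLift F A ≠ 0 →
      GeneralPosition A ∧ ((k : ZMod n) + k ≠ 0 → ∀ i, triple (crossProduct (A i) (A (i + k)))
        (crossProduct (A (i + 1)) (A (i + 1 + k)))
        (crossProduct (A (i + 1 + 1)) (A (i + 1 + 1 + k))) ≠ 0) := by
  classical
  set T : Finset (ZMod n × ZMod n × ZMod n) :=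
    {t | t.1 ≠ t.2.1 ∧ t.1 ≠ t.2.2 ∧ t.2.1 ≠ t.2.2} with hT
  -- The condition does not involve the index: `R` is everything or, if `2 k = 0` in `ZMod n`,
  -- empty. For `n = 4`, `k = 2` the diagonals `i` and `i + 2` coincide and the polynomial would be
  -- zero.
  set R : Finset (ZMod n) := {_i | (k : ZMod n) + k ≠ 0} with hR
  refine ⟨(∏ t ∈ T, polyTriple (polyVec t.1) (polyVec t.2.1) (polyVec t.2.2))
    * ∏ i ∈ R, diagonalPoly k i, mul_ne_zero (Finset.prod_ne_zero_iff.2 fun t ht => ?_)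
    (Finset.prod_ne_zero_iff.2 fun i hi => diagonalPoly_ne_zero hd (Finset.mem_filter.1 hi).2 i),
    (ScaleInvariant.prod _ fun t _ => scaleInvariant_polyTriple_polyVec _ _ _).mul
      (ScaleInvariant.prod _ fun i _ => scaleInvariant_diagonalPoly i), fun A hA => ?_⟩
  · obtain ⟨h1, h2, h3⟩ := (Finset.mem_filter.1 ht).2
    exact polyTriple_polyVec_ne_zero h1 h2 h3
  · rw [evalLift_mul, evalLift_prod, evalLift_prod, mul_ne_zero_iff, Finset.prod_ne_zero_iff,
      Finset.prod_ne_zero_iff] at hA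
    refine ⟨fun i j l hij hil hjl => ?_, fun hkk i => ?_⟩
    · have := hA.1 (i, j, l) (by simp [hT, hij, hil, hjl])
      simpa only [evalLift_polyTriple, evalLift_polyVec] using this
    · have := hA.2 i (by simp [hR, hkk])
      rwa [evalLift_diagonalPoly] at this

end Generic

/-! ### The birational parametrizations -/

section Birational

variable {n k : ℕ} {P : ProjTuple n} {A : ZMod n → Fin 3 → ℂ}
  {κ : ZMod n → Fin 4 → ℂ}

instance instNonemptyProjTuple (n : ℕ) : Nonempty (ProjTuple n) :=
  ⟨fun _ => Projectivization.mk ℂ (fun _ => 1) fun h => one_ne_zero (congrFun h 0)⟩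

/-- The tuple of points with a given lift. -/
def tupleOf (l : ZMod n → Fin 3 → ℂ) : ProjTuple n := Classical.epsilon fun q => IsLift l q

theorem isLift_tupleOf {l : ZMod n → Fin 3 → ℂ} (h : ∀ i, l i ≠ 0) : IsLift l (tupleOf l) :=
  Classical.epsilon_spec (p := fun q => IsLift l q) ⟨_, isLift_mk h⟩

variable [NeZero n]

theorem spectralCurve_eq_zeroSet (hk : 2 ≤ k) (hkn : k + 2 ≤ n) (hA : GeneralPosition A)
    (hP : IsLift A P) (hκ : IsKasteleynWeights k A κ) :
    spectralCurve n k P = zeroSet n k (kdet k κ) :=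
  Set.ext fun α => mem_spectralCurve_iff hk hkn hA hP hκ α

theorem isTilingClass_classMap {q : ProjTuple n} (hq : q ∈ blackData k P) :
    IsTilingClass P q (classMap k P q) := by
  obtain ⟨α, hα⟩ := hq.2.2.exists_isTilingClass
  rwa [hα.classMap_eq]

/-- The inverse sends α to the lines of the kernel vector of the Kasteleyn matrix, and in the second
case to the polygon of intersections `q_{i-k} ∩ q_i`. -/
theorem isBirationalOnto_spectralCurve (hk : 2 ≤ k) (hkn : k + 2 ≤ n) (hA : GeneralPosition A)
    (hP : IsLift A P) (hκ : IsKasteleynWeights k A κ) (hS : IsIrreducible (spectralCurve n k P))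
    (hD : (k : ZMod n) + k ≠ 0 → ∀ i, triple (crossProduct (A i) (A (i + k)))
      (crossProduct (A (i + 1)) (A (i + 1 + k)))
      (crossProduct (A (i + 1 + 1)) (A (i + 1 + 1 + k))) ≠ 0) :
    IsBirationalOnto (blackData k P) (spectralCurve n k P) (classMap k P) ∧
      IsBirationalOnto (inscribedFamily k P) (spectralCurve n k P)
        fun Q => classMap k P (diagonals k Q) := by
  have hd := distinctOffsets hk hkn
  have hclass : ∀ q ∈ blackData k P, IsTilingClass P q (classMap k P q) :=
    fun q hq => isTilingClass_classMap hq
  have hrat := rationalOn_classMap hclass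
  have hQ : ∀ Q ∈ inscribedFamily k P, diagonals k Q ∈ blackData k P :=
    fun Q hQ => diagonals_mem_blackData hk hkn hP hA hQ
  rw [spectralCurve_eq_zeroSet hk hkn hA hP hκ] at hS ⊢
  obtain ⟨H, h, hH, hgen⟩ := exists_generic_solution hA hk hkn hκ hS
  set f : H1 n k → ℤ × ℤ → ℂ := fun α => extension α fun i => α.eval (h i) with hf
  set G : H1 n k → ProjTuple n := fun α => tupleOf (linesOf k A (f α)) with hG
  have hlift : ∀ α ∈ zeroSet n k (kdet k κ), α.eval H ≠ 0 → IsLift (linesOf k A (f α)) (G α) :=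
    fun α hα hαH => isLift_tupleOf fun i => (hgen α hα hαH).1.lineAt_ne_zero hA hd _
  have hGclass : ∀ α ∈ zeroSet n k (kdet k κ), α.eval H ≠ 0 → IsTilingClass P (G α) α :=
    fun α hα hαH => (hgen α hα hαH).1.isTilingClass hA hd hκ hP (hlift α hα hαH)
  have hGmem : ∀ α ∈ zeroSet n k (kdet k κ), α.eval H ≠ 0 → G α ∈ blackData k P :=
    fun α hα hαH => (hgen α hα hαH).1.mem_blackData hk hkn hA hκ hP (hlift α hα hαH)
  have hmaps : ∀ q ∈ blackData k P, classMap k P q ∈ zeroSet n k (kdet k κ) :=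
    fun q hq => (hclass q hq).mem_zeroSet hP hA hd hκ
  have hGF : ∀ q ∈ blackData k P, (classMap k P q).eval H ≠ 0 → G (classMap k P q) = q :=
    fun q hq hqH => (hlift _ (hmaps q hq) hqH).eq ((hclass q hq).isLift_linesOf hP hA hd hκ
      (hgen _ (hmaps q hq) hqH).2)
  have htriple : ∀ α ∈ zeroSet n k (kdet k κ), α.eval H ≠ 0 → ∀ i,
      triple (linesOf k A (f α) i) (linesOf k A (f α) (i - k)) (linesOf k A (f α) (i + k)) ≠ 0 :=
    fun α hα hαH i => (hgen α hα hαH).1.triple_linesOf_ne_zero hA hd hκ i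
  -- If `2 k = 0`, the lines with indices `-k` and `k` coincide, contradicting non-concurrency. Thus
  -- in that case the spectral curve is never irreducible.
  have hkk : (k : ZMod n) + k ≠ 0 := fun h0 => by
    obtain ⟨α, hα, hαH⟩ := hH
    refine htriple α hα hαH 0 ?_
    rw [zero_sub, zero_add, ← eq_neg_of_add_eq_zero_left h0]
    simp only [triple_eq]
    ring
  constructor
  · refine isBirationalOnto_of_isLift hS hmaps hrat.1 hrat.2 H hH (G := G)
      (ψ := linePoly k A h) (fun α hα hαH => ?_) hGmem
      (fun α hα hαH => (hGclass α hα hαH).classMap_eq) hGF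
    have := hlift α hα hαH
    rwa [show linesOf k A (f α) = fun i j => α.eval (linePoly k A h i j) from
      funext fun i => (eval_linePoly α h i).symm] at this
  · have hdiag : ∀ α ∈ zeroSet n k (kdet k κ), α.eval H ≠ 0 →
        diagonals k (polygonOf k (G α)) = G α := fun α hα hαH =>
      diagonals_polygonOf (hlift α hα hαH) (htriple α hα hαH)
    refine isBirationalOnto_of_isLift hS (fun Q h => hmaps _ (hQ Q h))
      (hrat.1.comp_diagonals hQ fun Q h => h.1) (hrat.2.comp_diagonals hQ fun Q h => h.1) H hH
      (G := fun α => polygonOf k (G α))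
      (ψ := fun i => crossProduct (linePoly k A h (i - k)) (linePoly k A h i))
      (fun α hα hαH => ?_) (fun α hα hαH => ?_) (fun α hα hαH => ?_) (fun Q hQm hQH => ?_)
    · have := isLift_polygonOf (hlift α hα hαH) (htriple α hα hαH)
      rwa [show (fun i : ZMod n => crossProduct (linesOf k A (f α) (i - k)) (linesOf k A (f α) i))
          = fun i j => α.eval (crossProduct (linePoly k A h (i - k)) (linePoly k A h i) j) from
        funext fun i => Eq.symm ((eval_crossProduct _ _ _).trans (by
          rw [eval_linePoly, eval_linePoly]))] at this
    · exact polygonOf_mem_inscribedFamily hd hP hA (hD hkk) (hGmem α hα hαH) (hlift α hα hαH)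
        (fun v e => (hGclass α hα hαH).pairing_ne_zero hP (hlift α hα hαH) v e) (htriple α hα hαH)
    · rw [hdiag α hα hαH]
      exact (hGclass α hα hαH).classMap_eq
    · rw [hGF _ (hQ Q hQm) hQH]
      exact funext fun i => eq_cross_diagonals hQm.1 (fun j => (hQm.2.2.1.ne j).2) i

end Birational

end Pentagram

end

theorem mainTheorem8 (n k : ℕ) (hk : 2 ≤ k) (hkn : k + 2 ≤ n) :
    ∃ 𝒢 : Set (Pentagram.ProjTuple n), IsOpen 𝒢 ∧ Dense 𝒢 ∧ ∀ P ∈ 𝒢,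
      Pentagram.IsWhiteCircuit k P ∧
      (∀ q ∈ Pentagram.blackData k P,
        ∃! α : Pentagram.H1 n k, Pentagram.IsTilingClass P q α) ∧
      (∀ Q ∈ Pentagram.inscribedFamily k P,
        Pentagram.diagonals k Q ∈ Pentagram.blackData k P) ∧
      (IsIrreducible (Pentagram.spectralCurve n k P) →
        topologicalKrullDim (Pentagram.spectralCurve n k P) = 1 ∧
        Pentagram.IsBirationalOnto (Pentagram.blackData k P)
          (Pentagram.spectralCurve n k P) (Pentagram.classMap k P) ∧
        Pentagram.IsBirationalOnto (Pentagram.inscribedFamily k P)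
          (Pentagram.spectralCurve n k P)
          (fun Q => Pentagram.classMap k P (Pentagram.diagonals k Q))) := by
  have : NeZero n := ⟨by omega⟩
  have hd := Pentagram.distinctOffsets hk hkn
  obtain ⟨F, hF, hinv, hgen⟩ := Pentagram.exists_generic_poly hd
  refine ⟨Pentagram.nonvanishing F, Pentagram.isOpen_nonvanishing hinv,
    Pentagram.dense_nonvanishing hF hinv, fun P hPF => ?_⟩
  have hP := Pentagram.isLift_rep P
  obtain ⟨hA, hD⟩ := hgen _ (hPF _ hP)
  obtain ⟨κ, hκ⟩ := hA.exists_weights hk hkn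
  refine ⟨hA.isWhiteCircuit hk hkn hP, fun q hq => ?_,
    fun Q hQ => Pentagram.diagonals_mem_blackData hk hkn hP hA hQ, fun hS => ⟨?_, ?_⟩⟩
  · exact ⟨_, Pentagram.isTilingClass_classMap hq, fun β hβ => hβ.classMap_eq.symm⟩
  · rw [Pentagram.spectralCurve_eq_zeroSet hk hkn hA hP hκ] at hS ⊢
    exact Pentagram.topologicalKrullDim_zeroSet_kdet (by omega) hκ.1 hS
  · exact Pentagram.isBirationalOnto_spectralCurve hk hkn hA hP hκ hS hD
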